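/- All vector spaces are over $\mathbb{F}_2$ and graded by $\mathbb{Z}$. Definitions. A shifted Lie algebra (s-Lie algebra) is a graded vector space $M$ with a bilinear bracket $[-,-]\colon M_i\otimes M_j\to M_{i+j-1}$ satisfying $[x,y]=[y,x]$ and $[x,[y,z]]+[y,[z,x]]+[z,[x,y]]=0$; it is totally isotropic if $[x,x]=0$ for all homogeneous $x$. Let $\bar{\mathcal R}$ be the $\mathbb{F}_2$-algebra generated by symbols $\bar Q^j$, $j\ge 0$, subject to $$\bar Q^r\bar Q^s=\sum_{k=0}^{r-s-1}\binom{2s-r+1+2k}{k}\bar Q^{2s+1+k}\bar Q^{r-s-1-k}\qquad (s<r\le 2s),$$ with $\bar Q^j$ acting with degree $j-1$; for $J=(j_1,\dots,j_k)$ put $\bar Q^J=\bar Q^{j_1}\cdots\bar Q^{j_k}$ (so $\bar Q^{\emptyset}=1$). A non-negatively graded $\bar{\mathcal R}$-module $M$ is allowable if $\bar Q^{j_1}\cdots\bar Q^{j_k}x=0$ whenever $x\in M_n$, $k\ge 1$ and $j_1<j_2+\cdots+j_k+n$. An allowable $\bar{\mathcal R}$-s-Lie algebra is an s-Lie algebra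 $M$ with an allowable $\bar{\mathcal R}$-module structure on $M_{\ge 0}=\bigoplus_{n\ge 0}M_n$ such that $\bar Q^k x=[x,x]$ for $x\in M_k$, $k\ge0$, and $[x,\bar Q^k y]=0$ for all homogeneous $x\in M$, $y\in M_{\ge 0}$ and all $k\ge 0$. Morphisms are degree-preserving linear maps compatible with the structure, and "free" refers to the corresponding universal property with respect to degree-preserving linear maps. Let $\beta$ be a set of letters $x$ with degrees $|x|$. Basic products are nonassociative words in $\beta$, defined and ordered recursively by weight (number of letters): those of weight $1$ are the letters, in an arbitrary total order; those of weight $m>1$ are the $[w_1,w_2]$ with $w_1,w_2$ basic of total weight $m$, $w_1<w_2$, and $w_3\le w_1$ if $w_2=[w_3,w_4]$; they are totally ordered arbitrarily among themselves and are greater than all basic products of smaller weight. Their degrees are determined by $|[w_1,w_2]|=|w_1|+|w_2|-1$. Proposition. Let $V$ be a graded vector space concentrated in positive degrees, $L$ the free totally isotropic s-Lie algebra on $V$, and $A$ the free allowable $\bar{\mathcal R}$-module on $L$. Let $\beta$ be any basis of $V$ consisting of homogeneous elements, with any choice of orders on the basic products in the letters $\beta$ as above. Then: 1. $A$ has as a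 basis the elements $\bar Q^J w$ where $J=(j_1,\dots,j_k)$, $k\ge 0$, is completely unadmissible, i.e. $j_i>2j_{i+1}$ for $1\le i<k$, and $w$ is a basic product in the letters $\beta$ with $|w|\le j_k$ (no condition on $|w|$ if $k=0$). 2. There is exactly one bilinear bracket on $A$ such that, on this basis, * $[\bar Q^{J_1}w_1,\bar Q^{J_2}w_2]=0$ if $J_1\ne\emptyset$ or $J_2\neq\emptyset$; * for basic products $w_1,w_2$ such that the word $[w_1,w_2]$ is also a basic product, the bracket of $w_1$ and $w_2$ is the basis element $[w_1,w_2]$; * $[w,w]=\bar Q^{|w|}w$; * $[w_1,w_2]=[w_2,w_1]$ if $w_1>w_2$; * $[w_1,w_2]=[w_3,[w_4,w_1]]+[w_4,[w_1,w_3]]$ if $w_1<w_2$, $w_2=[w_3,w_4]$ and $w_1<w_3$. 3. With this bracket and its $\bar{\mathcal R}$-module structure, $A$ is an allowable $\bar{\mathcal R}$-s-Lie algebra, and together with the canonical map $V\to L\to A$ it is the free allowable $\bar{\mathcal R}$-s-Lie algebra on $V$. -/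

import Mathlib

open scoped TensorProduct

noncomputable section

namespace SpectralLie

/-! ### Graded vector spaces over `𝔽₂`

A graded vector space is a vector space `M` with a family `𝓜 : ℤ → Submodule (ZMod 2) M` of
which it is the internal direct sum. -/

section Graded

variable {M : Type*} [AddCommGroup M] [Module (ZMod 2) M]
variable {N : Type*} [AddCommGroup N] [Module (ZMod 2) N]

/-- The part `M_{≥ 0}` of a graded vector space. -/
def nonneg (𝓜 : ℤ → Submodule (ZMod 2) M) : Submodule (ZMod 2) M :=
  ⨆ n : {n : ℤ // 0 ≤ n}, 𝓜 n

/-- The grading of `M_{≥ 0}` induced from that of `M`. -/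
def nonnegGrading (𝓜 : ℤ → Submodule (ZMod 2) M) (n : ℤ) : Submodule (ZMod 2) (nonneg 𝓜) :=
  (𝓜 n).comap (nonneg 𝓜).subtype

/-- Linear maps which preserve degrees. -/
def IsGradedMap (𝓜 : ℤ → Submodule (ZMod 2) M) (𝓝 : ℤ → Submodule (ZMod 2) N)
    (f : M →ₗ[ZMod 2] N) : Prop :=
  ∀ n : ℤ, ∀ x ∈ 𝓜 n, f x ∈ 𝓝 n

theorem IsGradedMap.mem_nonneg {𝓜 : ℤ → Submodule (ZMod 2) M} {𝓝 : ℤ → Submodule (ZMod 2) N}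
    {f : M →ₗ[ZMod 2] N} (hf : IsGradedMap 𝓜 𝓝 f) {x : M} (hx : x ∈ nonneg 𝓜) :
    f x ∈ nonneg 𝓝 := by
  have h : nonneg 𝓜 ≤ (nonneg 𝓝).comap f := by
    refine iSup_le fun n y hy => ?_
    exact Submodule.mem_iSup_of_mem (p := fun n : {n : ℤ // 0 ≤ n} => 𝓝 n) n (hf n y hy)
  exact h hx

/-! ### Shifted Lie algebras over `𝔽₂` -/

/-- A shifted Lie algebra over `𝔽₂`: a bracket `M_i ⊗ M_j → M_{i+j-1}` which is symmetric and
satisfies the Jacobi identity (all signs are trivial). -/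
structure IsSLie (𝓜 : ℤ → Submodule (ZMod 2) M) (B : M →ₗ[ZMod 2] M →ₗ[ZMod 2] M) : Prop where
  internal : DirectSum.IsInternal 𝓜
  degree : ∀ i j : ℤ, ∀ x ∈ 𝓜 i, ∀ y ∈ 𝓜 j, B x y ∈ 𝓜 (i + j - 1)
  symm : ∀ x y : M, B x y = B y x
  jacobi : ∀ x y z : M, B x (B y z) + B y (B z x) + B z (B x y) = 0

/-- A totally isotropic shifted Lie algebra over `𝔽₂`: moreover `[x, x] = 0` for every
homogeneous `x`. -/
structure IsSLieTi (𝓜 : ℤ → Submodule (ZMod 2) M) (B : M →ₗ[ZMod 2] M →ₗ[ZMod 2] M) : Prop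
    extends IsSLie 𝓜 B where
  self : ∀ n : ℤ, ∀ x ∈ 𝓜 n, B x x = 0

/-- `(L, B)` is the free totally isotropic shifted Lie algebra on the graded vector space `V`,
with universal map `ι` (universal property against algebras in the universe `w`). -/
structure IsFreeSLieTi.{w, u, v} {V : Type u} [AddCommGroup V] [Module (ZMod 2) V]
    (𝓥 : ℤ → Submodule (ZMod 2) V) {L : Type v} [AddCommGroup L] [Module (ZMod 2) L]
    (𝓛 : ℤ → Submodule (ZMod 2) L) (B : L →ₗ[ZMod 2] L →ₗ[ZMod 2] L)
    (ι : V →ₗ[ZMod 2] L) : Prop where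
  isSLieTi : IsSLieTi 𝓛 B
  graded : IsGradedMap 𝓥 𝓛 ι
  universal : ∀ (E : Type w) [AddCommGroup E] [Module (ZMod 2) E]
    (𝓔 : ℤ → Submodule (ZMod 2) E) (C : E →ₗ[ZMod 2] E →ₗ[ZMod 2] E), IsSLieTi 𝓔 C →
    ∀ f : V →ₗ[ZMod 2] E, IsGradedMap 𝓥 𝓔 f →
      ∃! F : L →ₗ[ZMod 2] E, IsGradedMap 𝓛 𝓔 F ∧ (∀ x y : L, F (B x y) = C (F x) (F y)) ∧
        ∀ v : V, F (ι v) = f v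

end Graded

/-! ### The algebra `R̄` and its allowable modules -/

/-- The relations `Q̄^r Q̄^s = ∑_{k=0}^{r-s-1} (2s-r+1+2k choose k) Q̄^{2s+1+k} Q̄^{r-s-1-k}`
for `s < r ≤ 2s`. The subtractions of natural numbers below are never truncated. -/
inductive RBarRel : FreeAlgebra (ZMod 2) ℕ → FreeAlgebra (ZMod 2) ℕ → Prop
  | rel (r s : ℕ) (hsr : s < r) (hrs : r ≤ 2 * s) :
      RBarRel (FreeAlgebra.ι (ZMod 2) r * FreeAlgebra.ι (ZMod 2) s)
        (∑ k ∈ Finset.range (r - s),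
          (Nat.choose (2 * s - r + 1 + 2 * k) k : ZMod 2) •
            (FreeAlgebra.ι (ZMod 2) (2 * s + 1 + k) * FreeAlgebra.ι (ZMod 2) (r - s - 1 - k)))

/-- The `𝔽₂`-algebra `R̄` generated by the `Q̄^j`, `j ≥ 0`. -/
def RBar : Type := RingQuot RBarRel

instance : Ring RBar := inferInstanceAs (Ring (RingQuot RBarRel))

instance : Algebra (ZMod 2) RBar := inferInstanceAs (Algebra (ZMod 2) (RingQuot RBarRel))

/-- The quotient map from the free algebra. -/
def RBar.mk : FreeAlgebra (ZMod 2) ℕ →ₐ[ZMod 2] RBar := RingQuot.mkAlgHom (ZMod 2) RBarRel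

/-- The generator `Q̄^j`. -/
def Qbar (j : ℕ) : RBar := RBar.mk (FreeAlgebra.ι (ZMod 2) j)

/-- The monomial `Q̄^J = Q̄^{j_1} ⋯ Q̄^{j_k}`, equal to `1` for the empty sequence. -/
def QbarSeq (J : List ℕ) : RBar := (J.map Qbar).prod

/-- Completely unadmissible sequences: `j_i > 2 j_{i+1}` for all `i`. -/
def IsCU (J : List ℕ) : Prop := J.IsChain fun a b => 2 * b < a

/-- The degree of `Q̄^J`, that is, `∑ (j_i - 1)`. -/
def seqDeg (J : List ℕ) : ℤ := (J.map fun j => (j : ℤ) - 1).sum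

/-- Allowable modules over `R̄`: non-negatively graded modules such that
`Q̄^{j_1} ⋯ Q̄^{j_k} x = 0` for `x` of degree `n` and `j_1 < j_2 + ⋯ + j_k + n`. -/
structure IsAllowable {N : Type*} [AddCommGroup N] [Module (ZMod 2) N] [Module RBar N]
    (𝓝 : ℤ → Submodule (ZMod 2) N) : Prop where
  internal : DirectSum.IsInternal 𝓝
  nonneg : ∀ n : ℤ, n < 0 → 𝓝 n = ⊥
  degree : ∀ (j : ℕ) (n : ℤ), ∀ x ∈ 𝓝 n, Qbar j • x ∈ 𝓝 (n + j - 1)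
  vanish : ∀ (j : ℕ) (J : List ℕ) (n : ℤ), ∀ x ∈ 𝓝 n,
    (j : ℤ) < (J.sum : ℤ) + n → QbarSeq (j :: J) • x = 0

/-- `A` is the free allowable `R̄`-module on the graded vector space `W`, with universal map `ι`
(universal property against modules in the universe `w`). -/
structure IsFreeAllowable.{w, u, v} {W : Type u} [AddCommGroup W] [Module (ZMod 2) W]
    (𝓦 : ℤ → Submodule (ZMod 2) W) {A : Type v} [AddCommGroup A] [Module (ZMod 2) A]
    [Module RBar A] (𝓐 : ℤ → Submodule (ZMod 2) A) (ι : W →ₗ[ZMod 2] A) : Prop where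
  isAllowable : IsAllowable 𝓐
  graded : IsGradedMap 𝓦 𝓐 ι
  universal : ∀ (E : Type w) [AddCommGroup E] [Module (ZMod 2) E] [Module RBar E]
    (𝓔 : ℤ → Submodule (ZMod 2) E), IsAllowable 𝓔 →
    ∀ f : W →ₗ[ZMod 2] E, IsGradedMap 𝓦 𝓔 f →
      ∃! F : A →ₗ[ZMod 2] E, IsGradedMap 𝓐 𝓔 F ∧ (∀ (r : RBar) (x : A), F (r • x) = r • F x) ∧
        ∀ v : W, F (ι v) = f v

/-! ### Allowable `R̄`-shifted Lie algebras -/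

/-- The structure of an allowable `R̄`-shifted Lie algebra on a graded vector space `M`. It has
operations `Q̄^j` on `M_{≥ 0}` only, while the bracket is defined on all of `M`. -/
structure AllowableSLie {M : Type*} [AddCommGroup M] [Module (ZMod 2) M]
    (𝓜 : ℤ → Submodule (ZMod 2) M) where
  bracket : M →ₗ[ZMod 2] M →ₗ[ZMod 2] M
  isSLie : IsSLie 𝓜 bracket
  [module : Module RBar (nonneg 𝓜)]
  allowable : IsAllowable (nonnegGrading 𝓜)
  square : ∀ (k : ℕ) (x : nonneg 𝓜), (x : M) ∈ 𝓜 k →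
    ((Qbar k • x : nonneg 𝓜) : M) = bracket x x
  vanishing : ∀ (i j : ℤ) (x : M) (y : nonneg 𝓜) (k : ℕ), x ∈ 𝓜 i → (y : M) ∈ 𝓜 j →
    bracket x ((Qbar k • y : nonneg 𝓜) : M) = 0

/-- The action of `R̄` on `M_{≥ 0}`. -/
def AllowableSLie.act {M : Type*} [AddCommGroup M] [Module (ZMod 2) M]
    {𝓜 : ℤ → Submodule (ZMod 2) M} (S : AllowableSLie 𝓜) (r : RBar) (x : nonneg 𝓜) :
    nonneg 𝓜 :=
  letI := S.module
  r • x

/-- Morphisms of allowable `R̄`-shifted Lie algebras. -/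
structure IsAllowableSLieHom {M : Type*} [AddCommGroup M] [Module (ZMod 2) M]
    {𝓜 : ℤ → Submodule (ZMod 2) M} (S : AllowableSLie 𝓜)
    {N : Type*} [AddCommGroup N] [Module (ZMod 2) N]
    {𝓝 : ℤ → Submodule (ZMod 2) N} (T : AllowableSLie 𝓝) (F : M →ₗ[ZMod 2] N) : Prop where
  graded : IsGradedMap 𝓜 𝓝 F
  map_bracket : ∀ x y : M, F (S.bracket x y) = T.bracket (F x) (F y)
  map_act : ∀ (r : RBar) (x : nonneg 𝓜),
    F (S.act r x : M) = (T.act r ⟨F x, graded.mem_nonneg x.2⟩ : N)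

/-- `(A, S)` is the free allowable `R̄`-shifted Lie algebra on the graded vector space `V`, with
universal map `ι` (universal property against algebras in the universe `w`). -/
structure IsFreeAllowableSLie.{w, u, v} {V : Type u} [AddCommGroup V] [Module (ZMod 2) V]
    (𝓥 : ℤ → Submodule (ZMod 2) V) {A : Type v} [AddCommGroup A] [Module (ZMod 2) A]
    {𝓐 : ℤ → Submodule (ZMod 2) A} (S : AllowableSLie 𝓐) (ι : V →ₗ[ZMod 2] A) : Prop where
  graded : IsGradedMap 𝓥 𝓐 ι
  universal : ∀ (E : Type w) [AddCommGroup E] [Module (ZMod 2) E]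
    (𝓔 : ℤ → Submodule (ZMod 2) E) (T : AllowableSLie 𝓔) (f : V →ₗ[ZMod 2] E),
    IsGradedMap 𝓥 𝓔 f →
      ∃! F : A →ₗ[ZMod 2] E, IsAllowableSLieHom S T F ∧ ∀ v : V, F (ι v) = f v

/-! ### Construction of the free totally isotropic shifted Lie algebra

Without the grading this is the free Lie algebra over `𝔽₂` on a vector space, since the signs are
trivial; the grading takes the shift of the bracket into account. -/

section FreeLie

variable (V : Type*) [AddCommGroup V] [Module (ZMod 2) V]

/-- The Lie ideal of the free Lie algebra on the set `V` which makes `V → L(V)` linear. -/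
def linIdeal : LieIdeal (ZMod 2) (FreeLieAlgebra (ZMod 2) V) :=
  LieSubmodule.lieSpan (ZMod 2) (FreeLieAlgebra (ZMod 2) V)
    ({t | ∃ a b : V, t = FreeLieAlgebra.of (ZMod 2) (a + b) -
        (FreeLieAlgebra.of (ZMod 2) a + FreeLieAlgebra.of (ZMod 2) b)} ∪
      {t | ∃ (c : ZMod 2) (a : V), t = FreeLieAlgebra.of (ZMod 2) (c • a) -
        c • FreeLieAlgebra.of (ZMod 2) a})

/-- The free totally isotropic (shifted) Lie algebra on the vector space `V`. -/
abbrev FreeSLieTi : Type _ := FreeLieAlgebra (ZMod 2) V ⧸ linIdeal V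

/-- The bracket as a bilinear map. -/
def lieBracket : FreeSLieTi V →ₗ[ZMod 2] FreeSLieTi V →ₗ[ZMod 2] FreeSLieTi V :=
  LinearMap.mk₂ (ZMod 2) (fun x y => ⁅x, y⁆) add_lie smul_lie lie_add lie_smul

/-- The inclusion of generators. -/
def lieIncl : V →ₗ[ZMod 2] FreeSLieTi V where
  toFun v := LieSubmodule.Quotient.mk (FreeLieAlgebra.of (ZMod 2) v)
  map_add' a b := by
    rw [← LieSubmodule.Quotient.mk'_apply, ← LieSubmodule.Quotient.mk'_apply,
      ← LieSubmodule.Quotient.mk'_apply, ← map_add, ← sub_eq_zero, ← map_sub,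
      LieSubmodule.Quotient.mk'_apply, LieSubmodule.Quotient.mk_eq_zero']
    exact LieSubmodule.subset_lieSpan (Or.inl ⟨a, b, rfl⟩)
  map_smul' c a := by
    rw [RingHom.id_apply, ← LieSubmodule.Quotient.mk'_apply, ← LieSubmodule.Quotient.mk'_apply,
      ← map_smul, ← sub_eq_zero, ← map_sub,
      LieSubmodule.Quotient.mk'_apply, LieSubmodule.Quotient.mk_eq_zero']
    exact LieSubmodule.subset_lieSpan (Or.inr ⟨c, a, rfl⟩)

variable {V}

/-- Iterated brackets of homogeneous generators, with their degrees in the shifted grading. -/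
inductive IsLieMonomial (𝓥 : ℤ → Submodule (ZMod 2) V) : ℤ → FreeSLieTi V → Prop
  | incl (n : ℤ) (v : V) (hv : v ∈ 𝓥 n) : IsLieMonomial 𝓥 n (lieIncl V v)
  | bracket (i j : ℤ) (x y : FreeSLieTi V) (hx : IsLieMonomial 𝓥 i x)
      (hy : IsLieMonomial 𝓥 j y) : IsLieMonomial 𝓥 (i + j - 1) ⁅x, y⁆

/-- The grading of the free totally isotropic shifted Lie algebra. -/
def lieGrading (𝓥 : ℤ → Submodule (ZMod 2) V) (n : ℤ) : Submodule (ZMod 2) (FreeSLieTi V) :=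
  Submodule.span (ZMod 2) {x | IsLieMonomial 𝓥 n x}

end FreeLie

/-! ### Construction of the free allowable `R̄`-module

The free `R̄`-module `R̄ ⊗ W` modulo the relations of allowability; here `W` is a graded vector
space concentrated in positive degrees. -/

section FreeModule

variable {W : Type*} [AddCommGroup W] [Module (ZMod 2) W]

/-- The relations `Q̄^{j_1} ⋯ Q̄^{j_k} x = 0` for `x ∈ W_n` and `j_1 < j_2 + ⋯ + j_k + n`. -/
def allowRel (𝓦 : ℤ → Submodule (ZMod 2) W) : Submodule RBar (RBar ⊗[ZMod 2] W) :=
  Submodule.span RBar {t | ∃ (j : ℕ) (J : List ℕ) (n : ℤ) (x : W),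
    x ∈ 𝓦 n ∧ (j : ℤ) < (J.sum : ℤ) + n ∧ t = QbarSeq (j :: J) ⊗ₜ[ZMod 2] x}

/-- The free allowable `R̄`-module on `W`. -/
abbrev FreeAllowable (𝓦 : ℤ → Submodule (ZMod 2) W) : Type _ :=
  (RBar ⊗[ZMod 2] W) ⧸ allowRel 𝓦

/-- The inclusion of generators. -/
def allowIncl (𝓦 : ℤ → Submodule (ZMod 2) W) : W →ₗ[ZMod 2] FreeAllowable 𝓦 :=
  ((allowRel 𝓦).mkQ.restrictScalars (ZMod 2)).comp (TensorProduct.mk (ZMod 2) RBar W 1)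

/-- The grading of the free allowable module: `Q̄^J x` has degree `|x| + ∑ (j_i - 1)`. -/
def allowGrading (𝓦 : ℤ → Submodule (ZMod 2) W) (d : ℤ) :
    Submodule (ZMod 2) (FreeAllowable 𝓦) :=
  Submodule.span (ZMod 2) {t | ∃ (J : List ℕ) (n : ℤ) (x : W),
    x ∈ 𝓦 n ∧ n + seqDeg J = d ∧ t = QbarSeq J • allowIncl 𝓦 x}

end FreeModule

/-! ### Basic products -/

section Hall

variable {β : Type*}

/-- The basic products in the letters `β`, with respect to an ordering of the nonassociative words
in `β`. (Only the ordering of the basic products matters.) -/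
def IsBasic [LinearOrder (FreeMagma β)] : FreeMagma β → Prop
  | .of _ => True
  | .mul w₁ (.of y) => IsBasic w₁ ∧ w₁ < .of y
  | .mul w₁ (.mul w₃ w₄) =>
      IsBasic w₁ ∧ IsBasic (.mul w₃ w₄) ∧ w₁ < .mul w₃ w₄ ∧ w₃ ≤ w₁

/-- The degree of a word in the shifted grading, for letters of degrees `d`: the total degree of
the letters minus the number of brackets. -/
def wordDeg (d : β → ℤ) : FreeMagma β → ℤ
  | .of x => d x
  | .mul w₁ w₂ => wordDeg d w₁ + wordDeg d w₂ - 1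

variable {V : Type*} [AddCommGroup V] [Module (ZMod 2) V]

/-- The element of the free totally isotropic shifted Lie algebra given by a word. -/
def evalWord (b : β → V) : FreeMagma β → FreeSLieTi V
  | .of x => lieIncl V (b x)
  | .mul w₁ w₂ => ⁅evalWord b w₁, evalWord b w₂⁆

/-- The free allowable `R̄`-module on the free totally isotropic shifted Lie algebra on `V`. -/
abbrev FreeAlg (𝓥 : ℤ → Submodule (ZMod 2) V) : Type _ := FreeAllowable (lieGrading 𝓥)

/-- The grading of `FreeAlg 𝓥`. -/
def algGrading (𝓥 : ℤ → Submodule (ZMod 2) V) (n : ℤ) : Submodule (ZMod 2) (FreeAlg 𝓥) :=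
  allowGrading (lieGrading 𝓥) n

/-- The inclusion of `V` in `FreeAlg 𝓥`. -/
def algIncl (𝓥 : ℤ → Submodule (ZMod 2) V) : V →ₗ[ZMod 2] FreeAlg 𝓥 :=
  (allowIncl (lieGrading 𝓥)).comp (lieIncl V)

/-- The pairs `(J, w)` with `J = (j_1, …, j_k)` completely unadmissible and `w` a basic product of
degree at most `j_k` (there is no condition on the degree if `J` is empty). -/
def IsHallPair [LinearOrder (FreeMagma β)] (d : β → ℤ) (J : List ℕ) (w : FreeMagma β) : Prop :=
  IsCU J ∧ IsBasic w ∧ ∀ j ∈ J.getLast?, wordDeg d w ≤ (j : ℤ)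

/-- The element `Q̄^J w` of `FreeAlg 𝓥`. -/
def hallElt (𝓥 : ℤ → Submodule (ZMod 2) V) (b : β → V) (J : List ℕ) (w : FreeMagma β) :
    FreeAlg 𝓥 :=
  QbarSeq J • allowIncl (lieGrading 𝓥) (evalWord b w)

/-- The recursion for the bracket on the elements `Q̄^J w`. -/
structure IsHallBracket [LinearOrder (FreeMagma β)] (𝓥 : ℤ → Submodule (ZMod 2) V) (b : β → V)
    (d : β → ℤ) (B : FreeAlg 𝓥 →ₗ[ZMod 2] FreeAlg 𝓥 →ₗ[ZMod 2] FreeAlg 𝓥) : Prop where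
  vanish : ∀ (J₁ J₂ : List ℕ) (w₁ w₂ : FreeMagma β), IsHallPair d J₁ w₁ → IsHallPair d J₂ w₂ →
    J₁ ≠ [] ∨ J₂ ≠ [] → B (hallElt 𝓥 b J₁ w₁) (hallElt 𝓥 b J₂ w₂) = 0
  basic : ∀ w₁ w₂ : FreeMagma β, IsBasic w₁ → IsBasic w₂ → IsBasic (w₁ * w₂) →
    B (hallElt 𝓥 b [] w₁) (hallElt 𝓥 b [] w₂) = hallElt 𝓥 b [] (w₁ * w₂)
  square : ∀ (w : FreeMagma β) (k : ℕ), IsBasic w → wordDeg d w = k →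
    B (hallElt 𝓥 b [] w) (hallElt 𝓥 b [] w) = hallElt 𝓥 b [k] w
  swap : ∀ w₁ w₂ : FreeMagma β, IsBasic w₁ → IsBasic w₂ → w₂ < w₁ →
    B (hallElt 𝓥 b [] w₁) (hallElt 𝓥 b [] w₂) = B (hallElt 𝓥 b [] w₂) (hallElt 𝓥 b [] w₁)
  jacobi : ∀ w₁ w₃ w₄ : FreeMagma β, IsBasic w₁ → IsBasic (w₃ * w₄) → w₁ < w₃ * w₄ → w₁ < w₃ →
    B (hallElt 𝓥 b [] w₁) (hallElt 𝓥 b [] (w₃ * w₄)) =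
      B (hallElt 𝓥 b [] w₃) (B (hallElt 𝓥 b [] w₄) (hallElt 𝓥 b [] w₁)) +
        B (hallElt 𝓥 b [] w₄) (B (hallElt 𝓥 b [] w₁) (hallElt 𝓥 b [] w₃))

end Hall

end SpectralLie

end

universe u v w

/-!
The proof has three parts, which concern the `R̄`-module, the Lie algebra, and the square terms
of the bracket.

*Free allowable modules.* The relations and allowability rewrite every monomial into completely
unadmissible ones (`QbarSeq_smul_mem_cuSpan`). Their independence needs enough functionals on the
free allowable module on a generator. These come from modular invariants: let
`v₁, …, v_k` be the invariants of the Borel subgroup of `GL_k(𝔽₂)` attached to a complete flag,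
and attach to a sequence `J` the monomial in the `v_i` whose exponents are the excesses of `J`.
A polynomial in the `v_i` is in the Steinberg summand if, whenever one member of the flag is varied,
the sum over the three resulting flags is zero. The coefficients of such a polynomial satisfy
the relations of `R̄` (`lineSum_mem_rbarRelSubmodule`, `IsSteinberg.isWordFunctional`).
Identities between the operators that vary a flag are checked by evaluation at flags over an
algebraically closed field. The braid relation `lineSum_braid` allows one to build a Steinberg
invariant with leading exponent that of any given completely unadmissible sequence
(`exists_steinberg`), and triangularity gives independence (`freeAllowable_linearIndependent`).

*Basic products.* Apart from the grading, the free totally isotropic shifted Lie algebra is the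
free Lie algebra `L` on the vector space `V`. Collection (`IsHallPattern.bracket_mem`) shows that
basic products span. For their independence, basic products act on linear combinations of
nondecreasing lists of basic products, as they would on the Poincaré-Birkhoff-Witt basis of the
enveloping algebra (`hallAct_spec`, `hallOp_mul`); in this action the basic product `w` sends the
empty list to `[w]`. Collection is proved for any bracket that obeys the rules of the recursion up
to central squares. Applied to a product of two brackets it shows both that the recursion
determines the bracket on `A` and that a map which is right on basic products and their squares
preserves brackets (`IsHallRecursion.map_bracket`).

*Squares.* With `ι : L → A` the inclusion, `pr : A → L` the projection which kills all `Q̄^J w` with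
`J` non-empty, and `Φ` the additive operation `w ↦ Q̄^{|w|} w`, the bracket on `A` has the form
`[x, y] = ι [pr x, pr y] + Φ (D (pr x) (pr y))`. The Jacobi identity and the recursion amount to `D`
being a symmetric `2`-cocycle of `L` with values in the trivial module `L`, with `D x x = x`,
which vanishes on pairs of basic products whose product is basic. Such a cocycle is obtained in
`exists_hallCocycle` from an extension of `L` in which squares are visible: for a faithful enough
representation `M` of `L`, the space `L × M × Sym M` carries a symmetric bracket satisfying the
Jacobi identity in which `m` has the square `m ^ 2`, and these squares are central. The free
property of `A` then follows from those of `L` and of the free allowable module.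
-/

noncomputable section

namespace SpectralLie

/-! ### Polynomials in the invariants of a flag -/

section Flags

variable (K : Type*) [CommRing K]

/-- Multiplication of a polynomial in `v₂, v₃, …` by `v₁ ^ a`, that is, prepending the exponent
`a`. Here and below the list `[a₁, …, a_k]` stands for the monomial `v₁ ^ a₁ ⋯ v_k ^ a_k`, so
`List ℕ →₀ K` is the direct sum over `k` of the polynomial rings in `v₁, …, v_k`. The variable
`v_i` is the product of the vectors of `U_i` outside `U_{i-1}`, where `U_1 ⊂ ⋯ ⊂ U_k` is a
complete flag of `𝔽₂`-spaces of linear forms. -/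
def consMap (a : ℕ) : (List ℕ →₀ K) →ₗ[K] (List ℕ →₀ K) := Finsupp.lmapDomain K K (List.cons a)

@[simp] theorem consMap_single (a : ℕ) (l : List ℕ) (c : K) :
    consMap K a (Finsupp.single l c) = Finsupp.single (a :: l) c := by
  simp [consMap]

theorem consMap_apply (a : ℕ) (F : List ℕ →₀ K) (l : List ℕ) :
    consMap K a F (a :: l) = F l := by
  rw [consMap, Finsupp.lmapDomain_apply]
  exact Finsupp.mapDomain_apply (List.cons_injective) F l

theorem consMap_apply_ne {a a' : ℕ} (h : a' ≠ a) (F : List ℕ →₀ K) (l : List ℕ) :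
    consMap K a F (a' :: l) = 0 := by
  rw [consMap, Finsupp.lmapDomain_apply]
  refine Finsupp.mapDomain_of_notMem_range _ _ ?_
  rintro ⟨m, hm⟩
  simp at hm
  exact h hm.1.symm

/-- Raises the first entry by one; the empty list is left alone. -/
def incFst : List ℕ → List ℕ
  | a :: l => (a + 1) :: l
  | [] => []

/-- Raises the second entry by one; lists of length at most one are left alone. -/
def incSnd : List ℕ → List ℕ
  | a :: b :: l => a :: (b + 1) :: l
  | l => l

theorem incFst_injective : Function.Injective incFst := by
  intro l m h
  cases l <;> cases m <;> simp_all [incFst]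

theorem incSnd_injective : Function.Injective incSnd := by
  intro l m h
  rcases l with _ | ⟨a, _ | ⟨b, l⟩⟩ <;> rcases m with _ | ⟨c, _ | ⟨d, m⟩⟩ <;> simp_all [incSnd]

/-- Multiplication by `v₁`. -/
def mulFst : Module.End K (List ℕ →₀ K) := Finsupp.lmapDomain K K incFst

/-- Multiplication by `v₂`. -/
def mulSnd : Module.End K (List ℕ →₀ K) := Finsupp.lmapDomain K K incSnd

@[simp] theorem mulFst_single (a : ℕ) (l : List ℕ) (c : K) :
    mulFst K (Finsupp.single (a :: l) c) = Finsupp.single ((a + 1) :: l) c := by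
  simp [mulFst, incFst]

@[simp] theorem mulSnd_single (a b : ℕ) (l : List ℕ) (c : K) :
    mulSnd K (Finsupp.single (a :: b :: l) c) = Finsupp.single (a :: (b + 1) :: l) c := by
  simp [mulSnd, incSnd]

theorem mulFst_pow_single (n a : ℕ) (l : List ℕ) (c : K) :
    (mulFst K ^ n) (Finsupp.single (a :: l) c) = Finsupp.single ((a + n) :: l) c := by
  induction n generalizing a with
  | zero => simp
  | succ n ih => rw [pow_succ, Module.End.mul_apply, mulFst_single, ih]; congr 2; omega

theorem mulSnd_pow_single (n a b : ℕ) (l : List ℕ) (c : K) :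
    (mulSnd K ^ n) (Finsupp.single (a :: b :: l) c) = Finsupp.single (a :: (b + n) :: l) c := by
  induction n generalizing b with
  | zero => simp
  | succ n ih => rw [pow_succ, Module.End.mul_apply, mulSnd_single, ih]; congr 3; omega

theorem mulFst_comm_mulSnd : Commute (mulFst K) (mulSnd K) := by
  refine Finsupp.lhom_ext fun l c => ?_
  rcases l with _ | ⟨a, _ | ⟨b, l⟩⟩ <;> simp [mulFst, mulSnd, incFst, incSnd]

theorem mulFst_apply_succ (F : List ℕ →₀ K) (a : ℕ) (l : List ℕ) :
    mulFst K F ((a + 1) :: l) = F (a :: l) :=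
  Finsupp.mapDomain_apply incFst_injective F (a :: l)

theorem mulFst_apply_zero (F : List ℕ →₀ K) (l : List ℕ) : mulFst K F (0 :: l) = 0 := by
  refine Finsupp.mapDomain_of_notMem_range _ _ ?_
  rintro ⟨_ | ⟨a, m⟩, hm⟩ <;> simp [incFst] at hm

theorem mulSnd_apply_succ (F : List ℕ →₀ K) (a b : ℕ) (l : List ℕ) :
    mulSnd K F (a :: (b + 1) :: l) = F (a :: b :: l) :=
  Finsupp.mapDomain_apply incSnd_injective F (a :: b :: l)

theorem mulSnd_apply_zero (F : List ℕ →₀ K) (a : ℕ) (l : List ℕ) :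
    mulSnd K F (a :: 0 :: l) = 0 := by
  refine Finsupp.mapDomain_of_notMem_range _ _ ?_
  rintro ⟨_ | ⟨a, _ | ⟨b, m⟩⟩, hm⟩ <;> simp [incSnd] at hm

/-- The power sum `x ^ n + y ^ n` as a polynomial in `v₁ = x + y` and `v₂ = x y`, in
characteristic two, times the monomial `l` in the later variables. -/
def lucas (l : List ℕ) : ℕ → (List ℕ →₀ K)
  | 0 => 0
  | 1 => Finsupp.single (1 :: 0 :: l) 1
  | n + 2 => mulFst K (lucas l (n + 1)) + mulSnd K (lucas l n)

/-- The value of `lineSum` on a monomial: for `v₁ = x + y` and `v₂ = x y` it is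
`v₁ ^ b (x ^ a y ^ b + x ^ b y ^ a)` in place of `v₁ ^ a v₂ ^ b`. On lists of length at most one
it is the identity. -/
def lineSumFun : List ℕ → (List ℕ →₀ K)
  | a :: b :: l =>
    if b ≤ a then (mulFst K ^ b) ((mulSnd K ^ b) (lucas K l (a - b)))
    else (mulFst K ^ b) ((mulSnd K ^ a) (lucas K l (b - a)))
  | l => Finsupp.single l 1

/-- Sum over the change of line: the plane `U₂` of a flag contains two lines other than `U₁`, and
a polynomial in the `v_i` is sent to the sum of its values at the two flags obtained by replacing
`U₁` by these lines. In the invariants `v_i` of the given flag this is again a polynomial. -/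
def lineSum : Module.End K (List ℕ →₀ K) := Finsupp.linearCombination K (lineSumFun K)

theorem lineSum_single (l : List ℕ) : lineSum K (Finsupp.single l 1) = lineSumFun K l := by
  simp [lineSum]

variable {K}

/-- The operator `A` applied to the variables `v₂, v₃, …`, treating `v₁` as a scalar. -/
def onTail (A : Module.End K (List ℕ →₀ K)) : Module.End K (List ℕ →₀ K) :=
  Finsupp.linearCombination K fun
    | [] => Finsupp.single [] 1
    | a :: l => consMap K a (A (Finsupp.single l 1))

theorem onTail_single_nil (A : Module.End K (List ℕ →₀ K)) :
    onTail A (Finsupp.single [] 1) = Finsupp.single [] 1 := by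
  simp [onTail]

theorem onTail_consMap (A : Module.End K (List ℕ →₀ K)) (a : ℕ) (F : List ℕ →₀ K) :
    onTail A (consMap K a F) = consMap K a (A F) := by
  revert F
  refine DFunLike.congr_fun (f := onTail A ∘ₗ consMap K a) (g := consMap K a ∘ₗ A)
    (Finsupp.lhom_ext' fun l => LinearMap.ext_ring ?_)
  simp [onTail]

theorem onTail_single_cons (A : Module.End K (List ℕ →₀ K)) (a : ℕ) (l : List ℕ) :
    onTail A (Finsupp.single (a :: l) 1) = consMap K a (A (Finsupp.single l 1)) := by
  rw [← onTail_consMap, consMap_single]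

theorem end_ext {N : Type*} [AddCommGroup N] [Module K N] {A B : (List ℕ →₀ K) →ₗ[K] N}
    (h : ∀ l, A (Finsupp.single l 1) = B (Finsupp.single l 1)) : A = B :=
  Finsupp.lhom_ext' fun l => LinearMap.ext_ring (h l)

theorem onTail_mul (A B : Module.End K (List ℕ →₀ K)) : onTail (A * B) = onTail A * onTail B := by
  refine end_ext fun l => ?_
  cases l with
  | nil => simp [onTail_single_nil]
  | cons a l => simp [onTail_single_cons, onTail_consMap]

theorem onTail_one : onTail (1 : Module.End K (List ℕ →₀ K)) = 1 := by
  refine end_ext fun l => ?_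
  cases l with
  | nil => simp [onTail_single_nil]
  | cons a l => simp [onTail_single_cons]

/-- The coefficient of `v₁ ^ a`, as a polynomial in the other variables. -/
def slice (a : ℕ) : (List ℕ →₀ K) →ₗ[K] (List ℕ →₀ K) :=
  Finsupp.lcomapDomain (List.cons a) List.cons_injective

@[simp] theorem slice_apply (a : ℕ) (F : List ℕ →₀ K) (l : List ℕ) : slice a F l = F (a :: l) := rfl

theorem slice_onTail (A : Module.End K (List ℕ →₀ K)) (a : ℕ) (F : List ℕ →₀ K) :
    slice a (onTail A F) = A (slice a F) := by
  revert F
  refine DFunLike.congr_fun (f := slice a ∘ₗ onTail A) (g := A ∘ₗ slice a) (end_ext fun l => ?_)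
  cases l with
  | nil =>
    have : slice a (Finsupp.single [] (1 : K)) = 0 := by ext l; simp
    simp [onTail_single_nil, this]
  | cons a' l =>
    simp only [LinearMap.comp_apply, onTail_single_cons]
    by_cases h : a = a'
    · subst h
      have : slice a (Finsupp.single (a :: l) (1 : K)) = Finsupp.single l 1 := by
        ext m; simp [Finsupp.single_apply]
      rw [this]; ext m; simp [consMap_apply]
    · have : slice a (Finsupp.single (a' :: l) (1 : K)) = 0 := by
        ext m; simp [Ne.symm h]
      rw [this]; ext m; simp [consMap_apply_ne K h]

/-- Substitution of `y` for `v₁`; the later variables move down by one place. Constants in no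
variables are sent to `0`. -/
def evalFst (y : K) : Module.End K (List ℕ →₀ K) :=
  Finsupp.linearCombination K fun
    | [] => 0
    | a :: l => Finsupp.single l (y ^ a)

@[simp] theorem evalFst_single_nil (y : K) : evalFst y (Finsupp.single [] 1) = 0 := by
  simp [evalFst]

@[simp] theorem evalFst_single_cons (y : K) (a : ℕ) (l : List ℕ) :
    evalFst y (Finsupp.single (a :: l) 1) = Finsupp.single l (y ^ a) := by
  simp [evalFst]

theorem evalFst_onTail (y : K) (A : Module.End K (List ℕ →₀ K)) :
    evalFst y * onTail A = A * evalFst y := by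
  refine end_ext fun l => ?_
  cases l with
  | nil => simp [onTail_single_nil]
  | cons a l =>
    have : evalFst y ∘ₗ consMap K a = y ^ a • (1 : Module.End K (List ℕ →₀ K)) := by
      refine end_ext fun l => ?_
      simp
    have := DFunLike.congr_fun this (A (Finsupp.single l 1))
    simp only [LinearMap.comp_apply] at this
    simp only [Module.End.mul_apply, onTail_single_cons, this, evalFst_single_cons]
    rw [← mul_one (y ^ a), ← smul_eq_mul, ← Finsupp.smul_single, map_smul]
    simp

theorem evalFst_mulFst (y : K) : evalFst y * mulFst K = y • evalFst y := by
  refine end_ext fun l => ?_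
  cases l with
  | nil => simp [mulFst, incFst]
  | cons a l => simp [pow_succ']

theorem evalFst_evalFst_mulFst (y₁ y₂ : K) (F : List ℕ →₀ K) :
    evalFst y₂ (evalFst y₁ (mulFst K F)) = y₁ • evalFst y₂ (evalFst y₁ F) := by
  have := DFunLike.congr_fun (evalFst_mulFst y₁) F
  simp only [Module.End.mul_apply, LinearMap.smul_apply] at this
  rw [this, map_smul]

theorem evalFst_evalFst_mulSnd (y₁ y₂ : K) (F : List ℕ →₀ K) :
    evalFst y₂ (evalFst y₁ (mulSnd K F)) = y₂ • evalFst y₂ (evalFst y₁ F) := by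
  revert F
  refine DFunLike.congr_fun (f := evalFst y₂ * evalFst y₁ * mulSnd K)
    (g := y₂ • (evalFst y₂ * evalFst y₁)) (end_ext fun l => ?_)
  rcases l with _ | ⟨a, _ | ⟨b, l⟩⟩
  · simp [mulSnd, incSnd]
  · have h : (Finsupp.single [] (y₁ ^ a) : List ℕ →₀ K) = y₁ ^ a • Finsupp.single [] 1 := by simp
    simp [mulSnd, incSnd]
    rw [h, map_smul, evalFst_single_nil]; simp
  · have h (l : List ℕ) (c : K) : (Finsupp.single l c : List ℕ →₀ K)
      = c • Finsupp.single l 1 := by simp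
    simp only [Module.End.mul_apply, mulSnd_single, evalFst_single_cons, LinearMap.smul_apply]
    rw [h _ (y₁ ^ a), h _ (y₁ ^ a), map_smul, map_smul, evalFst_single_cons, evalFst_single_cons,
      pow_succ', smul_comm, ← smul_eq_mul, ← Finsupp.smul_single]

theorem evalFst_evalFst_single (y₁ y₂ : K) (a b : ℕ) (l : List ℕ) :
    evalFst y₂ (evalFst y₁ (Finsupp.single (a :: b :: l) 1)) =
      (y₁ ^ a * y₂ ^ b) • Finsupp.single l 1 := by
  have h (l : List ℕ) (c : K) : (Finsupp.single l c : List ℕ →₀ K)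
      = c • Finsupp.single l 1 := by simp
  rw [evalFst_single_cons, h, map_smul, evalFst_single_cons, h _ (y₂ ^ b), smul_smul]

theorem evalFst_evalFst_mulFst_pow (y₁ y₂ : K) (n : ℕ) (F : List ℕ →₀ K) :
    evalFst y₂ (evalFst y₁ ((mulFst K ^ n) F)) = y₁ ^ n • evalFst y₂ (evalFst y₁ F) := by
  induction n with
  | zero => simp
  | succ n ih =>
    rw [pow_succ', Module.End.mul_apply, evalFst_evalFst_mulFst, ih, smul_smul, pow_succ']

theorem evalFst_evalFst_mulSnd_pow (y₁ y₂ : K) (n : ℕ) (F : List ℕ →₀ K) :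
    evalFst y₂ (evalFst y₁ ((mulSnd K ^ n) F)) = y₂ ^ n • evalFst y₂ (evalFst y₁ F) := by
  induction n with
  | zero => simp
  | succ n ih =>
    rw [pow_succ', Module.End.mul_apply, evalFst_evalFst_mulSnd, ih, smul_smul, pow_succ']

section CharTwo

variable [CharP K 2]

theorem evalFst_evalFst_lucas (x x' : K) (l : List ℕ) (n : ℕ) :
    evalFst (x * x') (evalFst (x + x') (lucas K l n)) =
      (x ^ n + x' ^ n) • Finsupp.single l 1 := by
  have h2 : (2 : K) = 0 := CharTwo.two_eq_zero
  induction n using Nat.twoStepInduction with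
  | zero => simp [lucas, CharTwo.add_self_eq_zero]
  | one => rw [lucas, evalFst_evalFst_single]; simp
  | more n ih1 ih2 =>
    rw [lucas, map_add, map_add, evalFst_evalFst_mulFst, evalFst_evalFst_mulSnd, ih1, ih2,
      smul_smul, smul_smul, ← add_smul]
    congr 1
    linear_combination (x * x' * (x ^ n + x' ^ n)) * h2

/-- Evaluation of `lineSum` at the flag whose line is spanned by `x + x'` in the plane spanned by
`x` and `x'`: it is the sum of the evaluations at the lines of `x` and of `x'`. -/
theorem evalFst_evalFst_lineSum (x x' : K) :
    evalFst (x * x') * evalFst (x + x') * lineSum K =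
      evalFst (x' * (x + x')) * evalFst x + evalFst (x * (x + x')) * evalFst x' := by
  refine end_ext fun l => ?_
  have h (l : List ℕ) (c : K) : (Finsupp.single l c : List ℕ →₀ K)
      = c • Finsupp.single l 1 := by simp
  rcases l with _ | ⟨a, _ | ⟨b, l⟩⟩
  · simp [lineSum_single, lineSumFun]
  · simp only [Module.End.mul_apply, lineSum_single, lineSumFun, evalFst_single_cons,
      LinearMap.add_apply]
    rw [h, h [] (x ^ a), h [] (x' ^ a)]
    simp only [map_smul, evalFst_single_nil, smul_zero, add_zero]
  · simp only [Module.End.mul_apply, LinearMap.add_apply]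
    rw [lineSum_single, lineSumFun, evalFst_evalFst_single, evalFst_evalFst_single, ← add_smul]
    split_ifs with hab
    · obtain ⟨c, rfl⟩ := Nat.exists_eq_add_of_le hab
      rw [evalFst_evalFst_mulFst_pow, evalFst_evalFst_mulSnd_pow, evalFst_evalFst_lucas,
        smul_smul, smul_smul]
      congr 1
      rw [Nat.add_sub_cancel_left, mul_pow, mul_pow, mul_pow]
      ring
    · obtain ⟨c, rfl⟩ := Nat.exists_eq_add_of_le (not_le.1 hab).le
      rw [evalFst_evalFst_mulFst_pow, evalFst_evalFst_mulSnd_pow, evalFst_evalFst_lucas,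
        smul_smul, smul_smul]
      congr 1
      rw [Nat.add_sub_cancel_left, mul_pow, mul_pow, mul_pow]
      ring

/-- Evaluation of the first two variables at the flag `⟨a⟩ ⊂ ⟨a, b⟩`. -/
def flagEval (a b : K) : Module.End K (List ℕ →₀ K) := evalFst (b * (a + b)) * evalFst a

omit [CharP K 2] in
theorem flagEval_congr {a b b' : K} (h : b * (a + b) = b' * (a + b')) :
    flagEval a b = flagEval a b' := by
  rw [flagEval, flagEval, h]

theorem flagEval_lineSum (a b : K) :
    flagEval a b * lineSum K = flagEval b a + flagEval (a + b) a := by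
  have h2 : (2 : K) = 0 := CharTwo.two_eq_zero
  have h := evalFst_evalFst_lineSum b (a + b)
  rw [show b + (a + b) = a by linear_combination b * h2] at h
  rw [flagEval, flagEval, flagEval, h]
  congr 3
  · ring
  · linear_combination (-a ^ 2) * h2

/-- Evaluation of the first three variables at the flag `⟨a⟩ ⊂ ⟨a, b⟩ ⊂ ⟨a, b, c⟩`. -/
def flagEval₃ (a b c : K) : Module.End K (List ℕ →₀ K) :=
  evalFst (c * (a + c) * (b + c) * (a + b + c)) * flagEval a b

theorem flagEval₃_lineSum (a b c : K) :
    flagEval₃ a b c * lineSum K = flagEval₃ b a c + flagEval₃ (a + b) a c := by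
  have h2 : (2 : K) = 0 := CharTwo.two_eq_zero
  rw [flagEval₃, mul_assoc, flagEval_lineSum, mul_add, flagEval₃, flagEval₃]
  congr 3
  · ring
  · linear_combination (-c * (a + c) * (a + b + c) * a) * h2

theorem flagEval₃_onTail_lineSum (a b c : K) :
    flagEval₃ a b c * onTail (lineSum K) = flagEval₃ a c b + flagEval₃ a (b + c) b := by
  have h2 : (2 : K) = 0 := CharTwo.two_eq_zero
  have h := evalFst_evalFst_lineSum (c * (a + c)) ((b + c) * (a + b + c))
  rw [show c * (a + c) + (b + c) * (a + b + c) = b * (a + b) by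
      linear_combination (c * (a + b + c)) * h2,
    show c * (a + c) * ((b + c) * (a + b + c)) = c * (a + c) * (b + c) * (a + b + c) by ring] at h
  rw [flagEval₃, flagEval, ← mul_assoc, mul_assoc _ (evalFst a), evalFst_onTail, ← mul_assoc, h,
    add_mul, flagEval₃, flagEval₃, flagEval, flagEval, ← mul_assoc (evalFst _) (evalFst _),
    ← mul_assoc (evalFst _) (evalFst _)]
  congr 4
  · ring
  · linear_combination (-(b * (a + b)) * (b * (a + c) + b * c + 2 * b ^ 2)) * h2
  · ring

end CharTwo

variable (K) in
/-- Polynomials in exactly `k` variables. -/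
def ofLength (k : ℕ) : Submodule K (List ℕ →₀ K) := Finsupp.supported K K {l | l.length = k}

theorem single_mem_ofLength {l : List ℕ} {k : ℕ} (h : l.length = k) :
    Finsupp.single l 1 ∈ ofLength K k :=
  Finsupp.single_mem_supported K _ h

theorem map_mem_of_single {N : Type*} [AddCommGroup N] [Module K N] {s : Set (List ℕ)}
    {p : Submodule K N}
    {A : (List ℕ →₀ K) →ₗ[K] N} (h : ∀ l ∈ s, A (Finsupp.single l 1) ∈ p)
    {F : List ℕ →₀ K} (hF : F ∈ Finsupp.supported K K s) : A F ∈ p := by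
  rw [Finsupp.supported_eq_span_single] at hF
  have : Submodule.span K ((fun l => Finsupp.single l (1 : K)) '' s) ≤ p.comap A := by
    rw [Submodule.span_le]
    rintro _ ⟨l, hl, rfl⟩
    exact h l hl
  exact this hF

theorem mulFst_mem_ofLength {k : ℕ} {F : List ℕ →₀ K} (hF : F ∈ ofLength K k) :
    mulFst K F ∈ ofLength K k := by
  refine map_mem_of_single (fun l hl => ?_) hF
  cases l with
  | nil => simpa [mulFst, incFst] using single_mem_ofLength hl
  | cons a l => rw [mulFst_single]; exact single_mem_ofLength hl

theorem mulSnd_mem_ofLength {k : ℕ} {F : List ℕ →₀ K} (hF : F ∈ ofLength K k) :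
    mulSnd K F ∈ ofLength K k := by
  refine map_mem_of_single (fun l hl => ?_) hF
  rcases l with _ | ⟨a, _ | ⟨b, l⟩⟩
  · simpa [mulSnd, incSnd] using single_mem_ofLength hl
  · simpa [mulSnd, incSnd] using single_mem_ofLength hl
  · rw [mulSnd_single]; exact single_mem_ofLength hl

theorem pow_mem {A : Module.End K (List ℕ →₀ K)} {p : Submodule K (List ℕ →₀ K)}
    (h : ∀ F ∈ p, A F ∈ p) (n : ℕ) {F : List ℕ →₀ K} (hF : F ∈ p) : (A ^ n) F ∈ p := by
  induction n with
  | zero => simpa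
  | succ n ih => rw [pow_succ', Module.End.mul_apply]; exact h _ ih

theorem lucas_mem_ofLength (l : List ℕ) (n : ℕ) : lucas K l n ∈ ofLength K (l.length + 2) := by
  induction n using Nat.twoStepInduction with
  | zero => simp [lucas]
  | one => exact single_mem_ofLength (by simp)
  | more n ih1 ih2 =>
    exact add_mem (mulFst_mem_ofLength ih2) (mulSnd_mem_ofLength ih1)

theorem lineSum_mem_ofLength {k : ℕ} {F : List ℕ →₀ K} (hF : F ∈ ofLength K k) :
    lineSum K F ∈ ofLength K k := by
  refine map_mem_of_single (fun l hl => ?_) hF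
  rw [lineSum_single]
  rcases l with _ | ⟨a, _ | ⟨b, l⟩⟩
  · exact single_mem_ofLength hl
  · exact single_mem_ofLength hl
  · obtain rfl : l.length + 2 = k := by simpa using hl
    rw [lineSumFun]
    split_ifs
    all_goals
      exact pow_mem (fun F => mulFst_mem_ofLength) _
        (pow_mem (fun F => mulSnd_mem_ofLength) _ (lucas_mem_ofLength _ _))

theorem consMap_mem_ofLength {k a : ℕ} {F : List ℕ →₀ K} (hF : F ∈ ofLength K k) :
    consMap K a F ∈ ofLength K (k + 1) := by
  refine map_mem_of_single (fun l hl => ?_) hF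
  rw [consMap_single]
  exact single_mem_ofLength (by simpa using hl)

theorem onTail_mem_ofLength {A : Module.End K (List ℕ →₀ K)}
    (hA : ∀ k, ∀ F ∈ ofLength K k, A F ∈ ofLength K k) (k : ℕ) (F : List ℕ →₀ K)
    (hF : F ∈ ofLength K k) : onTail A F ∈ ofLength K k := by
  refine map_mem_of_single (fun l hl => ?_) hF
  cases l with
  | nil => rw [onTail_single_nil]; exact single_mem_ofLength hl
  | cons a l =>
    obtain rfl : l.length + 1 = k := by simpa using hl
    rw [onTail_single_cons]
    exact consMap_mem_ofLength (hA _ _ (single_mem_ofLength rfl))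

theorem eqOn_ofLength {k : ℕ} {A B : Module.End K (List ℕ →₀ K)}
    (h : ∀ l : List ℕ, l.length = k → A (Finsupp.single l 1) = B (Finsupp.single l 1))
    {F : List ℕ →₀ K} (hF : F ∈ ofLength K k) : A F = B F := by
  have : (A - B) F ∈ (⊥ : Submodule K (List ℕ →₀ K)) :=
    map_mem_of_single (fun l hl => by simp [h l hl]) hF
  simpa [sub_eq_zero] using this

end Flags

/-! ### The operators `lineSum` satisfy the relations of a Hecke algebra at zero -/

section Braid

variable {K : Type*} [Field K]

theorem apply_cons_eq_zero_of_evalFst [Infinite K] {F : List ℕ →₀ K} (h : ∀ y, evalFst y F = 0)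
    (a : ℕ) (l : List ℕ) : F (a :: l) = 0 := by
  classical
  let p : Polynomial K := ∑ l' ∈ F.support, match l' with
    | [] => 0
    | a :: m => if m = l then Polynomial.monomial a (F (a :: m)) else 0
  have hp : p = 0 := by
    refine Polynomial.funext fun y => ?_
    have := DFunLike.congr_fun (h y) l
    rw [evalFst, Finsupp.linearCombination_apply, Finsupp.sum, Finsupp.finsetSum_apply] at this
    rw [Polynomial.eval_zero, ← Finsupp.zero_apply (a := l), ← this, Polynomial.eval_finsetSum]
    refine Finset.sum_congr rfl fun l' _ => ?_
    cases l' with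
    | nil => simp
    | cons b m =>
      by_cases hm : m = l
      · simp [hm]
      · simp [hm]
  have := congrArg (fun q => Polynomial.coeff q a) hp
  simp only [p, Polynomial.finsetSum_coeff, Polynomial.coeff_zero] at this
  rw [Finset.sum_eq_single (a :: l)] at this
  · simpa using this
  · intro l' _ hl'
    cases l' with
    | nil => simp
    | cons b m =>
      by_cases hm : m = l
      · subst hm
        have : b ≠ a := fun h => hl' (by rw [h])
        simp [Polynomial.coeff_monomial, this]
      · simp [hm]
  · intro hn
    simp [Finsupp.notMem_support_iff.1 hn]

theorem evalFst_mem_ofLength {K : Type*} [CommRing K] {k : ℕ} {F : List ℕ →₀ K} (y : K)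
    (hF : F ∈ ofLength K (k + 1)) : evalFst y F ∈ ofLength K k := by
  refine map_mem_of_single (fun l hl => ?_) hF
  cases l with
  | nil => simp at hl
  | cons a l =>
    rw [evalFst_single_cons]
    exact Finsupp.single_mem_supported K _ (by simpa using hl)

theorem eq_zero_of_evalFst [Infinite K] {k : ℕ} {F : List ℕ →₀ K} (hF : F ∈ ofLength K (k + 1))
    (h : ∀ y, evalFst y F = 0) : F = 0 := by
  ext l
  cases l with
  | nil => exact (Finsupp.mem_supported' K _).1 hF _ (by simp)
  | cons a l => exact apply_cons_eq_zero_of_evalFst h a l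

/-- Over an algebraically closed field every pair of values of `v₁, v₂` comes from a pair
`x, y`. -/
theorem exists_split [IsAlgClosed K] [CharP K 2] (y₁ y₂ : K) :
    ∃ x x' : K, x + x' = y₁ ∧ x * x' = y₂ := by
  obtain ⟨x, hx⟩ := IsAlgClosed.exists_root
    (Polynomial.X ^ 2 + (Polynomial.C y₁ * Polynomial.X + Polynomial.C y₂) : Polynomial K) (by
      have : (Polynomial.X ^ 2 + (Polynomial.C y₁ * Polynomial.X + Polynomial.C y₂) :
        Polynomial K).degree = 2 := by compute_degree!
      rw [this]; simp)
  simp [Polynomial.IsRoot] at hx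
  have h2 : (2 : K) = 0 := CharTwo.two_eq_zero
  refine ⟨x, x + y₁, by linear_combination x * h2, by linear_combination hx - y₂ * h2⟩

variable [IsAlgClosed K] [CharP K 2]

/-- Every pair of values of `v₁, v₂` comes from a flag. -/
theorem exists_flag (y₁ y₂ : K) : ∃ b : K, y₂ = b * (y₁ + b) := by
  obtain ⟨x, x', rfl, rfl⟩ := exists_split y₁ y₂
  have h2 : (2 : K) = 0 := CharTwo.two_eq_zero
  exact ⟨x, by linear_combination -x ^ 2 * h2⟩

/-- Evaluations at flags separate polynomials, because every point is the point of a flag. -/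
theorem eq_of_flagEval {k : ℕ} {F G : List ℕ →₀ K} (hF : F ∈ ofLength K (k + 2))
    (hG : G ∈ ofLength K (k + 2)) (h : ∀ a b, flagEval a b F = flagEval a b G) : F = G := by
  have : Infinite K := IsAlgClosed.instInfinite
  rw [← sub_eq_zero]
  refine eq_zero_of_evalFst (sub_mem hF hG) fun a => ?_
  refine eq_zero_of_evalFst (evalFst_mem_ofLength a (sub_mem hF hG)) fun y => ?_
  obtain ⟨b, rfl⟩ := exists_flag a y
  have := h a b
  simp only [flagEval, Module.End.mul_apply] at this
  rw [map_sub, map_sub, this, sub_self]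

theorem eq_of_flagEval₃ {k : ℕ} {F G : List ℕ →₀ K} (hF : F ∈ ofLength K (k + 3))
    (hG : G ∈ ofLength K (k + 3)) (h : ∀ a b c, flagEval₃ a b c F = flagEval₃ a b c G) :
    F = G := by
  have : Infinite K := IsAlgClosed.instInfinite
  rw [← sub_eq_zero]
  refine eq_zero_of_evalFst (sub_mem hF hG) fun a => ?_
  refine eq_zero_of_evalFst (evalFst_mem_ofLength a (sub_mem hF hG)) fun y => ?_
  obtain ⟨b, rfl⟩ := exists_flag a y
  refine eq_zero_of_evalFst (evalFst_mem_ofLength _ (evalFst_mem_ofLength a (sub_mem hF hG)))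
    fun y => ?_
  obtain ⟨d, rfl⟩ := exists_flag (b * (a + b)) y
  obtain ⟨c, rfl⟩ := exists_flag a d
  have := h a b c
  have h2 : (2 : K) = 0 := CharTwo.two_eq_zero
  rw [flagEval₃, show c * (a + c) * (b + c) * (a + b + c) =
    c * (a + c) * (b * (a + b) + c * (a + c)) by linear_combination (c * (a + c) * b * c) * h2]
    at this
  simp only [flagEval, Module.End.mul_apply] at this
  rw [map_sub, map_sub, map_sub, this, sub_self]

/-- Idempotence: summing twice over the two other lines gives twice the original line and once
each of the other two. -/
theorem lineSum_lineSum_single (l : List ℕ) :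
    lineSum K (lineSum K (Finsupp.single l 1)) = lineSum K (Finsupp.single l 1) := by
  have h2 : (2 : K) = 0 := CharTwo.two_eq_zero
  rcases l with _ | ⟨a, _ | ⟨b, l⟩⟩
  · simp [lineSum_single, lineSumFun]
  · simp [lineSum_single, lineSumFun]
  have hF : Finsupp.single (a :: b :: l) (1 : K) ∈ ofLength K (l.length + 2) :=
    single_mem_ofLength (by simp)
  refine eq_of_flagEval (lineSum_mem_ofLength (lineSum_mem_ofLength hF))
    (lineSum_mem_ofLength hF) fun x y => ?_
  have key : flagEval x y * lineSum K * lineSum K = flagEval x y * lineSum K := by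
    rw [flagEval_lineSum, add_mul, flagEval_lineSum, flagEval_lineSum, add_comm y x,
      show x + y + x = y by linear_combination x * h2,
      flagEval_congr (a := x) (b := x + y) (b' := y) (by linear_combination (x ^ 2 + x * y) * h2),
      flagEval_congr (a := y) (b := x + y) (b' := x) (by linear_combination (y ^ 2 + x * y) * h2),
      flagEval_congr (a := x + y) (b := y) (b' := x) (by linear_combination (y ^ 2 - x ^ 2) * h2)]
    have h0 : flagEval x y + flagEval x y = 0 := by
      rw [← two_smul K, h2, zero_smul]
    calc _ = flagEval x y + flagEval x y + (flagEval y x + flagEval (x + y) x) := by abel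
      _ = _ := by rw [h0, zero_add]
  exact DFunLike.congr_fun key _

/-- Both sides are sums of the evaluations at the flags of a three-dimensional space reached by
changing the line, the plane and the line again, and these agree modulo two. -/
theorem lineSum_braid :
    lineSum K * onTail (lineSum K) * lineSum K =
      onTail (lineSum K) * lineSum K * onTail (lineSum K) := by
  have h2 : (2 : K) = 0 := CharTwo.two_eq_zero
  refine end_ext fun l => ?_
  have hT : ∀ k, ∀ F ∈ ofLength K k, lineSum K F ∈ ofLength K k := fun k F => lineSum_mem_ofLength
  have hT' := onTail_mem_ofLength hT
  rcases l with _ | ⟨a, _ | ⟨b, _ | ⟨c, l⟩⟩⟩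
  · simp [lineSum_single, lineSumFun, onTail_single_nil]
  · simp [lineSum_single, lineSumFun, onTail_single_cons]
  · have h1 : ∀ F ∈ ofLength K 2, onTail (lineSum K) F = F := by
      intro F hF
      refine eqOn_ofLength (B := 1) (fun l hl => ?_) hF
      obtain ⟨x, y, rfl⟩ := List.length_eq_two.1 hl
      simp [onTail_single_cons, lineSum_single, lineSumFun]
    have hF : Finsupp.single [a, b] (1 : K) ∈ ofLength K 2 := single_mem_ofLength rfl
    simp only [Module.End.mul_apply]
    rw [h1 _ hF, h1 _ (hT _ _ hF), lineSum_lineSum_single]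
  · have hF : Finsupp.single (a :: b :: c :: l) (1 : K) ∈ ofLength K (l.length + 3) :=
      single_mem_ofLength (by simp)
    refine eq_of_flagEval₃ (hT _ _ (hT' _ _ (hT _ _ hF))) (hT' _ _ (hT _ _ (hT' _ _ hF)))
      fun x y z => ?_
    have key : flagEval₃ x y z * lineSum K * onTail (lineSum K) * lineSum K =
        flagEval₃ x y z * onTail (lineSum K) * lineSum K * onTail (lineSum K) := by
      simp only [flagEval₃_lineSum, flagEval₃_onTail_lineSum, add_mul]
      rw [show y + (x + z) = x + y + z by ring, show x + (y + z) = x + y + z by ring,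
        show x + y + (x + z) = y + z by linear_combination x * h2]
      abel
    exact DFunLike.congr_fun key _

theorem onTail_comm_mulFst {K : Type*} [CommRing K] (A : Module.End K (List ℕ →₀ K)) :
    onTail A * mulFst K = mulFst K * onTail A := by
  refine end_ext fun l => ?_
  have h (a : ℕ) : mulFst K ∘ₗ consMap K a = consMap K (a + 1) :=
    end_ext fun l => by simp
  rcases l with _ | ⟨a, l⟩
  · simp [mulFst, incFst, onTail_single_nil]
  · have := DFunLike.congr_fun (h a) (A (Finsupp.single l 1))
    simp only [LinearMap.comp_apply] at this
    simp [onTail_single_cons, this]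

theorem mulSnd_eq_onTail {K : Type*} [CommRing K] : mulSnd K = onTail (mulFst K) := by
  refine end_ext fun l => ?_
  rcases l with _ | ⟨a, _ | ⟨b, l⟩⟩
  · simp [mulSnd, incSnd, onTail_single_nil]
  · simp [mulSnd, incSnd, onTail_single_cons, mulFst, incFst]
  · simp [onTail_single_cons]

theorem onTail_onTail_comm_mulSnd {K : Type*} [CommRing K] (A : Module.End K (List ℕ →₀ K)) :
    onTail (onTail A) * mulSnd K = mulSnd K * onTail (onTail A) := by
  rw [mulSnd_eq_onTail, ← onTail_mul, onTail_comm_mulFst, onTail_mul]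

theorem onTail_onTail_lucas {K : Type*} [CommRing K] (A : Module.End K (List ℕ →₀ K)) (l : List ℕ)
    (n : ℕ) : onTail (onTail A) (lucas K l n) =
      Finsupp.linearCombination K (fun m => lucas K m n) (A (Finsupp.single l 1)) := by
  induction n using Nat.twoStepInduction with
  | zero => simp [lucas, Finsupp.linearCombination_apply]
  | one =>
    have h : Finsupp.linearCombination K (fun m => lucas K m 1) = consMap K 1 ∘ₗ consMap K 0 :=
      end_ext fun m => by simp [lucas]
    rw [h]
    simp [lucas, onTail_single_cons]
  | more n ih1 ih2 =>
    have h : Finsupp.linearCombination K (fun m => lucas K m (n + 2)) =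
        mulFst K ∘ₗ Finsupp.linearCombination K (fun m => lucas K m (n + 1)) +
          mulSnd K ∘ₗ Finsupp.linearCombination K (fun m => lucas K m n) :=
      end_ext fun m => by simp [lucas]
    have e1 := DFunLike.congr_fun (onTail_comm_mulFst (onTail A)) (lucas K l (n + 1))
    have e2 := DFunLike.congr_fun (onTail_onTail_comm_mulSnd A) (lucas K l n)
    simp only [Module.End.mul_apply] at e1 e2
    rw [h, lucas, map_add, e1, e2, ih1, ih2]
    rfl

/-- `lineSum` involves only `v₁, v₂`, and so commutes with operators on the variables from `v₃`
on. -/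
theorem commute_lineSum_onTail_onTail {K : Type*} [CommRing K] (A : Module.End K (List ℕ →₀ K)) :
    lineSum K * onTail (onTail A) = onTail (onTail A) * lineSum K := by
  refine end_ext fun l => ?_
  rcases l with _ | ⟨a, _ | ⟨b, l⟩⟩
  · simp [lineSum_single, lineSumFun, onTail_single_nil]
  · simp [lineSum_single, lineSumFun, onTail_single_cons, onTail_single_nil]
  · have e1 (n : ℕ) (F) := DFunLike.congr_fun
      (Commute.pow_right (show Commute _ _ from onTail_comm_mulFst (onTail A)) n) F
    have e2 (n : ℕ) (F) := DFunLike.congr_fun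
      (Commute.pow_right (show Commute _ _ from onTail_onTail_comm_mulSnd A) n) F
    simp only [Module.End.mul_apply] at e1 e2
    simp only [Module.End.mul_apply, onTail_single_cons]
    rw [lineSum_single, lineSumFun]
    split_ifs with hab
    · have h : lineSum K ∘ₗ consMap K a ∘ₗ consMap K b = ((mulFst K ^ b) * (mulSnd K ^ b)) ∘ₗ
          Finsupp.linearCombination K (fun m => lucas K m (a - b)) :=
        end_ext fun m => by simp [lineSum_single, lineSumFun, hab]
      rw [e1, e2, onTail_onTail_lucas]
      exact DFunLike.congr_fun h (A (Finsupp.single l 1))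
    · have h : lineSum K ∘ₗ consMap K a ∘ₗ consMap K b = ((mulFst K ^ b) * (mulSnd K ^ a)) ∘ₗ
          Finsupp.linearCombination K (fun m => lucas K m (b - a)) :=
        end_ext fun m => by simp [lineSum_single, lineSumFun, hab]
      rw [e1, e2, onTail_onTail_lucas]
      exact DFunLike.congr_fun h (A (Finsupp.single l 1))

end Braid

/-! ### The relations of `R̄` in terms of exponents -/

section RBarRelations

variable {K : Type*} [CommRing K]

/-- The relations of `R̄` read on the exponents of monomials. If `σ` is the sum of `|x|` and the
later indices, then `Q̄^r Q̄^s ⋯ x` has exponents `a = r - s - σ` and `b = s - σ`; the condition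
`s < r ≤ 2 s` becomes `a ≤ b`, and terms with a negative exponent vanish by allowability. -/
def SatisfiesRBarRel (f : ℕ → ℕ → K) : Prop :=
  (∀ b, f 0 b = 0) ∧ ∀ a b, 0 < a → a ≤ b →
    f a b = ∑ k ∈ Finset.range a,
      (Nat.choose (b - a + 1 + 2 * k) k : K) * f (2 * b - a + 2 + 2 * k) (a - 1 - k)

theorem SatisfiesRBarRel.zero : SatisfiesRBarRel (fun _ _ => (0 : K)) := by
  simp [SatisfiesRBarRel]

theorem SatisfiesRBarRel.add {f g : ℕ → ℕ → K} (hf : SatisfiesRBarRel f) (hg : SatisfiesRBarRel g) :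
    SatisfiesRBarRel (fun a b => f a b + g a b) := by
  refine ⟨fun b => by simp [hf.1, hg.1], fun a b ha hab => ?_⟩
  simp only [mul_add, Finset.sum_add_distrib]
  rw [hf.2 a b ha hab, hg.2 a b ha hab]

theorem SatisfiesRBarRel.smul {f : ℕ → ℕ → K} (hf : SatisfiesRBarRel f) (c : K) :
    SatisfiesRBarRel (fun a b => c * f a b) := by
  refine ⟨fun b => by simp [hf.1], fun a b ha hab => ?_⟩
  show c * f a b = ∑ k ∈ Finset.range a, _ * (c * f _ _)
  rw [hf.2 a b ha hab, Finset.mul_sum]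
  exact Finset.sum_congr rfl fun k _ => by ring

/-- The relations persist under multiplication by `v₁ v₂`. -/
theorem SatisfiesRBarRel.euler {f g : ℕ → ℕ → K} (hf : SatisfiesRBarRel f)
    (hg : ∀ a b, g (a + 1) (b + 1) = f a b) (h0 : ∀ b, g 0 b = 0) (h0' : ∀ a, g a 0 = 0) :
    SatisfiesRBarRel g := by
  refine ⟨h0, fun a b ha hab => ?_⟩
  obtain ⟨a, rfl⟩ : ∃ a', a = a' + 1 := ⟨a - 1, by omega⟩
  obtain ⟨b, rfl⟩ : ∃ b', b = b' + 1 := ⟨b - 1, by omega⟩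
  rw [hg, Finset.sum_range_succ]
  have : a + 1 - 1 - a = 0 := by omega
  rw [this, h0', mul_zero, add_zero]
  rcases Nat.eq_zero_or_pos a with rfl | ha'
  · simp [hf.1]
  · rw [hf.2 a b ha' (by omega)]
    refine Finset.sum_congr rfl fun k hk => ?_
    rw [Finset.mem_range] at hk
    rw [show b + 1 - (a + 1) = b - a by omega,
      show 2 * (b + 1) - (a + 1) + 2 + 2 * k = (2 * b - a + 2 + 2 * k) + 1 by omega,
      show a + 1 - 1 - k = (a - 1 - k) + 1 by omega, hg]

theorem SatisfiesRBarRel.pred_right [CharP K 2] {f : ℕ → ℕ → K} (hf : SatisfiesRBarRel f)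
    {a b : ℕ} (ha : 0 < a) (hab : a ≤ b) : f a (b - 1) = ∑ k ∈ Finset.range a,
      (Nat.choose (b - a + 2 * k) k : K) * f (2 * b - a + 2 * k) (a - 1 - k) := by
  rcases hab.eq_or_lt with rfl | hab
  · rw [Finset.sum_eq_single 0]
    · simp [show 2 * a - a = a by omega]
    · intro k _ hk
      have : 2 ∣ Nat.choose (a - a + 2 * k) k := by
        rw [Nat.sub_self, zero_add]
        exact Nat.two_dvd_centralBinom_of_one_le (Nat.pos_of_ne_zero hk)
      rw [(CharP.cast_eq_zero_iff K 2 _).2 this, zero_mul]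
    · simp; omega
  · rw [hf.2 a (b - 1) ha (by omega)]
    refine Finset.sum_congr rfl fun k hk => ?_
    rw [show b - 1 - a + 1 + 2 * k = b - a + 2 * k by omega,
      show 2 * (b - 1) - a + 2 + 2 * k = 2 * b - a + 2 * k by omega]

theorem choose_identity [CharP K 2] (m k : ℕ) :
    (Nat.choose (m + 2) (k + 2) : K) + Nat.choose m (k + 1) =
      Nat.choose m k + Nat.choose (m + 1) (k + 2) := by
  have h2 : (2 : K) = 0 := CharTwo.two_eq_zero
  rw [Nat.choose_succ_succ (m + 1) (k + 1), Nat.choose_succ_succ m k]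
  push_cast
  linear_combination (Nat.choose m (k + 1) : K) * h2

/-- The relations persist under multiplication by `v₁ ^ 2 + v₂`. -/
theorem SatisfiesRBarRel.dickson [CharP K 2] {f g : ℕ → ℕ → K} (hf : SatisfiesRBarRel f)
    (hg : ∀ a b, g a b = (if 2 ≤ a then f (a - 2) b else 0) + (if 1 ≤ b then f a (b - 1) else 0)) :
    SatisfiesRBarRel g := by
  have h2 : (2 : K) = 0 := CharTwo.two_eq_zero
  refine ⟨fun b => by simp [hg, hf.1], fun a b ha hab => ?_⟩
  have hR : ∀ k, g (2 * b - a + 2 + 2 * k) (a - 1 - k) = f (2 * b - a + 2 * k) (a - 1 - k) +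
      (if 1 ≤ a - 1 - k then f (2 * b - a + 2 * (k + 1)) (a - 1 - (k + 1)) else 0) := by
    intro k
    rw [hg, if_pos (by omega), show 2 * b - a + 2 + 2 * k - 2 = 2 * b - a + 2 * k by omega,
      show 2 * b - a + 2 + 2 * k = 2 * b - a + 2 * (k + 1) by omega,
      show a - 1 - k - 1 = a - 1 - (k + 1) by omega]
  simp only [hR]
  rw [hg, if_pos (show 1 ≤ b by omega), hf.pred_right ha hab]
  obtain rfl | ⟨n, rfl⟩ : a = 1 ∨ ∃ n, a = n + 2 := by
    rcases Nat.lt_or_ge a 2 with h | h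
    · left; omega
    · right; exact ⟨a - 2, by omega⟩
  · simp
  · have h3 : f n b = ∑ k ∈ Finset.range n, (Nat.choose (b - (n + 2) + 3 + 2 * k) k : K) *
        f (2 * b - (n + 2) + 2 * (k + 2)) (n + 2 - 1 - (k + 2)) := by
      rcases Nat.eq_zero_or_pos n with rfl | hn
      · simp [hf.1]
      · rw [hf.2 n b hn (by omega)]
        refine Finset.sum_congr rfl fun k hk => ?_
        rw [show b - n + 1 + 2 * k = b - (n + 2) + 3 + 2 * k by omega,
          show 2 * b - n + 2 + 2 * k = 2 * b - (n + 2) + 2 * (k + 2) by omega,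
          show n + 2 - 1 - (k + 2) = n - 1 - k by omega]
    rw [if_pos (by omega), show n + 2 - 2 = n by omega, h3]
    generalize b - (n + 2) = t
    generalize hφ : (fun k => f (2 * b - (n + 2) + 2 * k) (n + 2 - 1 - k)) = φ
    have hφ' : ∀ k, f (2 * b - (n + 2) + 2 * k) (n + 2 - 1 - k) = φ k := fun k => by rw [← hφ]
    simp only [hφ']
    simp only [mul_add, Finset.sum_add_distrib]
    have hS2 : ∑ k ∈ Finset.range (n + 2), (Nat.choose (t + 1 + 2 * k) k : K) *
        (if 1 ≤ n + 2 - 1 - k then φ (k + 1) else 0) =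
        ∑ k ∈ Finset.range (n + 1), (Nat.choose (t + 1 + 2 * k) k : K) * φ (k + 1) := by
      rw [Finset.sum_range_succ, if_neg (by omega), mul_zero, add_zero]
      refine Finset.sum_congr rfl fun k hk => ?_
      rw [Finset.mem_range] at hk
      rw [if_pos (by omega)]
    rw [hS2, Finset.sum_range_succ' _ (n + 1), Finset.sum_range_succ' _ n,
      Finset.sum_range_succ' (fun k => (Nat.choose (t + 1 + 2 * k) k : K) * φ k) (n + 1),
      Finset.sum_range_succ' _ n,
      Finset.sum_range_succ' (fun k => (Nat.choose (t + 1 + 2 * k) k : K) * φ (k + 1)) n]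
    have hsum : ∑ k ∈ Finset.range n, (Nat.choose (t + 3 + 2 * k) k : K) * φ (k + 2) +
        ∑ k ∈ Finset.range n, (Nat.choose (t + 2 * (k + 1 + 1)) (k + 1 + 1) : K) * φ (k + 1 + 1) =
        ∑ k ∈ Finset.range n, (Nat.choose (t + 1 + 2 * (k + 1 + 1)) (k + 1 + 1) : K) * φ (k + 1 + 1)
        + ∑ k ∈ Finset.range n, (Nat.choose (t + 1 + 2 * (k + 1)) (k + 1) : K) * φ (k + 1 + 1) := by
      rw [← Finset.sum_add_distrib, ← Finset.sum_add_distrib]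
      refine Finset.sum_congr rfl fun k _ => ?_
      have := choose_identity (K := K) (t + 3 + 2 * k) k
      rw [show t + 2 * (k + 1 + 1) = t + 3 + 2 * k + 1 by ring,
        show t + 1 + 2 * (k + 1 + 1) = t + 3 + 2 * k + 2 by ring,
        show t + 1 + 2 * (k + 1) = t + 3 + 2 * k by ring]
      linear_combination (-φ (k + 2)) * this
    simp only [zero_add, Nat.choose_one_right, Nat.choose_zero_right]
    push_cast
    linear_combination hsum - φ 1 * h2

/-- Polynomials whose coefficients satisfy the relations of `R̄` in the first two exponents. -/
def rbarRelSubmodule (K : Type*) [CommRing K] : Submodule K (List ℕ →₀ K) where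
  carrier := {F | ∀ l, SatisfiesRBarRel fun a b => F (a :: b :: l)}
  zero_mem' l := by simpa using SatisfiesRBarRel.zero
  add_mem' hF hG l := by simpa using (hF l).add (hG l)
  smul_mem' c F hF l := by simpa using (hF l).smul c

theorem mulFst_mulSnd_mem_rbarRelSubmodule {F : List ℕ →₀ K} (hF : F ∈ rbarRelSubmodule K) :
    mulFst K (mulSnd K F) ∈ rbarRelSubmodule K := by
  intro l
  refine (hF l).euler (fun a b => ?_) (fun b => ?_) (fun a => ?_)
  · rw [mulFst_apply_succ, mulSnd_apply_succ]
  · rw [mulFst_apply_zero]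
  · cases a with
    | zero => rw [mulFst_apply_zero]
    | succ a => rw [mulFst_apply_succ, mulSnd_apply_zero]

theorem dickson_mem_rbarRelSubmodule [CharP K 2] {F : List ℕ →₀ K} (hF : F ∈ rbarRelSubmodule K) :
    mulFst K (mulFst K F) + mulSnd K F ∈ rbarRelSubmodule K := by
  intro l
  refine (hF l).dickson (fun a b => ?_)
  rw [Finsupp.add_apply]
  congr 1
  · rcases a with _ | _ | a
    · simp [mulFst_apply_zero]
    · simp [mulFst_apply_zero, mulFst_apply_succ]
    · simp [mulFst_apply_succ]
  · cases b with
    | zero => simp [mulSnd_apply_zero]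
    | succ b => simp [mulSnd_apply_succ]

theorem single_mem_rbarRelSubmodule {c : ℕ} (hc : c = 1 ∨ c = 2) (l : List ℕ) :
    Finsupp.single (c :: 0 :: l) 1 ∈ rbarRelSubmodule K := by
  intro m
  refine ⟨fun b => ?_, fun a b ha hab => ?_⟩
  · exact Finsupp.single_eq_of_ne (by simp; omega)
  · refine (Finsupp.single_eq_of_ne (by simp; omega)).trans (Finset.sum_eq_zero fun k _ => ?_).symm
    exact mul_eq_zero_of_right _ (Finsupp.single_eq_of_ne (by simp; omega))

/-- The invariants `v₁ v₂` and `v₁ ^ 2 + v₂` of the whole plane are the coefficients of the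
recursion `L (n + 3) = (v₁ ^ 2 + v₂) L (n + 1) + v₁ v₂ L n`, so that the first three values
suffice. -/
theorem lucas_mem_rbarRelSubmodule [CharP K 2] (l : List ℕ) (n : ℕ) :
    lucas K l n ∈ rbarRelSubmodule K := by
  induction n using Nat.strong_induction_on with
  | _ n ih =>
    rcases n with _ | _ | _ | n
    · simp [lucas]
    · exact single_mem_rbarRelSubmodule (Or.inl rfl) l
    · have : lucas K l 2 = Finsupp.single (2 :: 0 :: l) 1 := by simp [lucas]
      rw [this]; exact single_mem_rbarRelSubmodule (Or.inr rfl) l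
    · have hc := DFunLike.congr_fun (mulFst_comm_mulSnd K) (lucas K l n)
      simp only [Module.End.mul_apply] at hc
      have : lucas K l (n + 3) = (mulFst K (mulFst K (lucas K l (n + 1))) +
          mulSnd K (lucas K l (n + 1))) + mulFst K (mulSnd K (lucas K l n)) := by
        rw [lucas, lucas, map_add]; abel
      rw [this]
      exact add_mem (dickson_mem_rbarRelSubmodule (ih _ (by omega)))
        (mulFst_mulSnd_mem_rbarRelSubmodule (ih _ (by omega)))

/-- The recursion is
`v₁ ^ (n + 3) L (n + 3) = (v₁ ^ 2 + v₂) v₁ ^ (n + 2) L (n + 2) + (v₁ v₂) ^ 2 v₁ ^ n L n`, again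
with coefficients invariant under the change of line. -/
theorem mulFst_pow_lucas_mem_rbarRelSubmodule [CharP K 2] (l : List ℕ) (n : ℕ) :
    (mulFst K ^ n) (lucas K l n) ∈ rbarRelSubmodule K := by
  have hZP := DFunLike.congr_fun (mulFst_comm_mulSnd K)
  have hpow (n) := DFunLike.congr_fun ((mulFst_comm_mulSnd K).pow_left n)
  have hchar (F : List ℕ →₀ K) : F + F = 0 := by
    rw [← two_smul K, CharTwo.two_eq_zero, zero_smul]
  induction n using Nat.strong_induction_on with
  | _ n ih =>
    rcases n with _ | _ | _ | n
    · simp [lucas]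
    · simpa [lucas] using single_mem_rbarRelSubmodule (Or.inr rfl) l
    · have h1 : Finsupp.single (1 :: 0 :: l) (1 : K) ∈ rbarRelSubmodule K :=
        single_mem_rbarRelSubmodule (Or.inl rfl) l
      have h2 : Finsupp.single (2 :: 0 :: l) (1 : K) ∈ rbarRelSubmodule K :=
        single_mem_rbarRelSubmodule (Or.inr rfl) l
      have h := add_mem (dickson_mem_rbarRelSubmodule h2) (mulFst_mulSnd_mem_rbarRelSubmodule h1)
      have e : (mulFst K ^ 2) (lucas K l 2) = mulFst K (mulFst K (Finsupp.single (2 :: 0 :: l) 1)) +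
          mulSnd K (Finsupp.single (2 :: 0 :: l) 1) +
            mulFst K (mulSnd K (Finsupp.single (1 :: 0 :: l) 1)) := by
        simp only [lucas, pow_two, Module.End.mul_apply, map_zero, add_zero, mulFst_single,
          mulSnd_single]
        refine Eq.trans ?_ (add_assoc (Finsupp.single (4 :: 0 :: l) (1 : K))
          (Finsupp.single (2 :: 1 :: l) 1) (Finsupp.single (2 :: 1 :: l) 1)).symm
        rw [hchar, add_zero]
      rw [e]; exact h
    · have h1 := dickson_mem_rbarRelSubmodule (ih (n + 2) (by omega))
      have h2 := mulFst_mulSnd_mem_rbarRelSubmodule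
        (mulFst_mulSnd_mem_rbarRelSubmodule (ih n (by omega)))
      have e : (mulFst K ^ (n + 3)) (lucas K l (n + 3)) =
          mulFst K (mulFst K ((mulFst K ^ (n + 2)) (lucas K l (n + 2)))) +
          mulSnd K ((mulFst K ^ (n + 2)) (lucas K l (n + 2))) +
          mulFst K (mulSnd K (mulFst K (mulSnd K ((mulFst K ^ n) (lucas K l n))))) := by
        simp only [Module.End.mul_apply] at hZP hpow
        have hcomm (n F) : (mulFst K ^ n) (mulFst K F) = mulFst K ((mulFst K ^ n) F) := by
          rw [← Module.End.mul_apply, ← pow_succ, pow_succ', Module.End.mul_apply]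
        simp only [lucas, pow_succ', Module.End.mul_apply, map_add, ← hpow, ← hZP, hcomm]
        have := hchar (mulFst K (mulFst K ((mulFst K ^ n) (mulSnd K (mulSnd K (lucas K l n))))))
        rw [← add_zero (_ + _ + mulFst K _), ← this]
        abel
      rw [e]; exact add_mem h1 h2

theorem pow_apply_mem_rbarRelSubmodule {b m : ℕ} (hmb : m ≤ b) {F : List ℕ →₀ K}
    (hF : (mulFst K ^ (b - m)) F ∈ rbarRelSubmodule K) :
    (mulFst K ^ b) ((mulSnd K ^ m) F) ∈ rbarRelSubmodule K := by
  induction m generalizing b with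
  | zero => simpa using hF
  | succ m ih =>
    obtain ⟨b, rfl⟩ : ∃ b', b = b' + 1 := ⟨b - 1, by omega⟩
    have h := mulFst_mulSnd_mem_rbarRelSubmodule (ih (b := b) (by omega) (by
      rwa [show b + 1 - (m + 1) = b - m by omega] at hF))
    have hpow (n) := DFunLike.congr_fun ((mulFst_comm_mulSnd K).pow_left n)
    simp only [Module.End.mul_apply] at hpow
    rw [pow_succ', pow_succ', Module.End.mul_apply, Module.End.mul_apply, hpow]
    exact h

/-- The polynomials in the image of `lineSum` satisfy the relations of `R̄`. -/
theorem lineSum_mem_rbarRelSubmodule [CharP K 2] {k : ℕ} {F : List ℕ →₀ K}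
    (hF : F ∈ ofLength K (k + 2)) :
    lineSum K F ∈ rbarRelSubmodule K := by
  refine map_mem_of_single (fun l hl => ?_) hF
  rw [lineSum_single]
  rcases l with _ | ⟨a, _ | ⟨b, l⟩⟩
  · simp at hl
  · simp at hl
  · rw [lineSumFun]
    split_ifs with hab
    · exact pow_apply_mem_rbarRelSubmodule le_rfl (by simpa using lucas_mem_rbarRelSubmodule l _)
    · exact pow_apply_mem_rbarRelSubmodule (by omega) (mulFst_pow_lucas_mem_rbarRelSubmodule l _)

end RBarRelations

/-! ### Steinberg invariants and their leading terms -/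

section Steinberg

variable {K : Type*} [CommRing K]

variable (K) in
/-- The operator `lineSum` in the variables `v_{i+1}, v_{i+2}` (counted from `v₁`): the member
`U_{i+1}` of the flag is replaced by the two other subspaces between `U_i` and `U_{i+2}`. -/
def lineSumAt : ℕ → Module.End K (List ℕ →₀ K)
  | 0 => lineSum K
  | i + 1 => onTail (lineSumAt i)

variable (K) in
/-- The product of the operators `lineSumAt K i` for `i < k`, where `i = 0` acts first. On
polynomials in `k` variables the last factor is the identity. -/
def sweep : ℕ → Module.End K (List ℕ →₀ K)
  | 0 => 1
  | k + 1 => onTail (sweep k) * lineSum K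

theorem sweep_mem_ofLength (i : ℕ) : ∀ k, ∀ F ∈ ofLength K k, sweep K i F ∈ ofLength K k := by
  induction i with
  | zero => exact fun k F hF => hF
  | succ i ih =>
    exact fun k F hF => onTail_mem_ofLength ih _ _ (lineSum_mem_ofLength hF)

/-- There is no change of flag at the position `i` if there are at most `i + 1` variables. -/
theorem lineSumAt_apply_of_length {i k : ℕ} (hk : k ≤ i + 1) {F : List ℕ →₀ K}
    (hF : F ∈ ofLength K k) : lineSumAt K i F = F := by
  refine eqOn_ofLength (B := 1) (fun l hl => ?_) hF
  clear hF
  induction i generalizing k l with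
  | zero =>
    rcases l with _ | ⟨a, _ | ⟨b, l⟩⟩
    · simp [lineSumAt, lineSum_single, lineSumFun]
    · simp [lineSumAt, lineSum_single, lineSumFun]
    · simp at hl; omega
  | succ i ih =>
    cases l with
    | nil => simp [lineSumAt, onTail_single_nil]
    | cons a l =>
      rw [lineSumAt, onTail_single_cons, ih (k := l.length) (by simp at hl; omega) l rfl]
      simp

/-- Consequence of the braid relation: a full sweep shifts the positions by one. -/
theorem lineSumAt_sweep {K : Type*} [Field K] [IsAlgClosed K] [CharP K 2] {i k : ℕ}
    (h : i + 2 ≤ k) : lineSumAt K i * sweep K k = sweep K k * lineSumAt K (i + 1) := by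
  induction k generalizing i with
  | zero => omega
  | succ k ih =>
    cases i with
    | zero =>
      obtain ⟨k, rfl⟩ : ∃ k', k = k' + 1 := ⟨k - 1, by omega⟩
      simp only [lineSumAt, sweep, onTail_mul]
      have h1 := commute_lineSum_onTail_onTail (sweep K k)
      have h2 := lineSum_braid (K := K)
      calc lineSum K * (onTail (onTail (sweep K k)) * onTail (lineSum K) * lineSum K)
          = (lineSum K * onTail (onTail (sweep K k))) * (onTail (lineSum K) * lineSum K) := by
            simp only [mul_assoc]
        _ = onTail (onTail (sweep K k)) * (lineSum K * onTail (lineSum K) * lineSum K) := by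
            rw [h1]; simp only [mul_assoc]
        _ = _ := by rw [h2]; simp only [mul_assoc]
    | succ i =>
      have h1 := commute_lineSum_onTail_onTail (lineSumAt K i)
      calc lineSumAt K (i + 1) * sweep K (k + 1)
          = onTail (lineSumAt K i * sweep K k) * lineSum K := by
            rw [onTail_mul, mul_assoc]; rfl
        _ = onTail (sweep K k) * (onTail (onTail (lineSumAt K i)) * lineSum K) := by
            rw [ih (by omega), onTail_mul, mul_assoc]; rfl
        _ = _ := by rw [← h1, ← mul_assoc]; rfl

/-- Polynomials fixed by all changes of flag, that is, those whose sum over the three flags which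
differ in one place is zero. They form the Steinberg summand of the invariants of the Borel
subgroup. -/
def IsSteinberg (F : List ℕ →₀ K) : Prop := ∀ i, lineSumAt K i F = F

theorem IsSteinberg.map_slice {F : List ℕ →₀ K} (hF : IsSteinberg F) (a : ℕ) :
    IsSteinberg (slice a F) := by
  intro i
  conv_rhs => rw [← hF (i + 1), lineSumAt, slice_onTail]

theorem IsSteinberg.sweep_eq {F : List ℕ →₀ K} (hF : IsSteinberg F) (k : ℕ) :
    sweep K k F = F := by
  have key : ∀ k j, (onTail^[j] (sweep K k)) F = F := by
    intro k
    induction k with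
    | zero =>
      intro j
      have : onTail^[j] (1 : Module.End K (List ℕ →₀ K)) = 1 := by
        induction j with
        | zero => rfl
        | succ j ih => rw [Function.iterate_succ_apply', ih, onTail_one]
      rw [sweep, this]; rfl
    | succ k ih =>
      intro j
      have h1 : ∀ j, ∀ A B : Module.End K (List ℕ →₀ K),
          onTail^[j] (A * B) = onTail^[j] A * onTail^[j] B := by
        intro j
        induction j with
        | zero => intro A B; rfl
        | succ j ih => intro A B; rw [Function.iterate_succ_apply, onTail_mul, ih]; rfl
      have h2 : ∀ j, onTail^[j] (lineSum K) = lineSumAt K j := by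
        intro j
        induction j with
        | zero => rfl
        | succ j ih => rw [Function.iterate_succ_apply', ih]; rfl
      rw [sweep, h1, h2, Module.End.mul_apply, hF j, ← Function.iterate_succ_apply]
      exact ih (j + 1)
  exact key k 0

/-- Prepending a power of `v₁` to a Steinberg invariant in the other variables and sweeping gives
a Steinberg invariant: `lineSumAt i` passes through the sweep as `lineSumAt (i + 1)`, which acts
on the tail only. -/
theorem IsSteinberg.sweep_consMap {K : Type*} [Field K] [IsAlgClosed K] [CharP K 2] {k : ℕ}
    {F : List ℕ →₀ K} (hF : IsSteinberg F) (hk : F ∈ ofLength K k) (a : ℕ) :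
    IsSteinberg (sweep K (k + 1) (consMap K a F)) := by
  have hlen : sweep K (k + 1) (consMap K a F) ∈ ofLength K (k + 1) :=
    sweep_mem_ofLength _ _ _ (consMap_mem_ofLength hk)
  intro i
  rcases Nat.lt_or_ge (k + 1) (i + 2) with h | h
  · exact lineSumAt_apply_of_length (by omega) hlen
  · have := DFunLike.congr_fun (lineSumAt_sweep (K := K) h) (consMap K a F)
    simp only [Module.End.mul_apply] at this
    rw [this, lineSumAt, onTail_consMap, hF i]

variable (K) in
/-- Polynomials of degree less than `a` in `v₁`. -/
def fstLT (a : ℕ) : Submodule K (List ℕ →₀ K) :=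
  Finsupp.supported K K {l | ∃ c m, l = c :: m ∧ c < a}

theorem single_mem_fstLT {a c : ℕ} (h : c < a) (m : List ℕ) :
    Finsupp.single (c :: m) 1 ∈ fstLT K a :=
  Finsupp.single_mem_supported K _ ⟨c, m, rfl, h⟩

theorem fstLT_mono {a a' : ℕ} (h : a ≤ a') : fstLT K a ≤ fstLT K a' :=
  Finsupp.supported_mono (by rintro _ ⟨c, m, rfl, hc⟩; exact ⟨c, m, rfl, by omega⟩)

theorem mulFst_mem_fstLT {a : ℕ} {F : List ℕ →₀ K} (hF : F ∈ fstLT K a) :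
    mulFst K F ∈ fstLT K (a + 1) := by
  refine map_mem_of_single (fun l hl => ?_) hF
  obtain ⟨c, m, rfl, hc⟩ := hl
  rw [mulFst_single]; exact single_mem_fstLT (by omega) _

theorem mulFst_pow_mem_fstLT {a : ℕ} (n : ℕ) {F : List ℕ →₀ K} (hF : F ∈ fstLT K a) :
    (mulFst K ^ n) F ∈ fstLT K (a + n) := by
  induction n with
  | zero => simpa
  | succ n ih => rw [pow_succ', Module.End.mul_apply]; exact mulFst_mem_fstLT ih

theorem consMap_mem_fstLT {a c : ℕ} (hc : c < a) (F : List ℕ →₀ K) :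
    consMap K c F ∈ fstLT K a := by
  refine map_mem_of_single (s := Set.univ) (fun l _ => ?_) (by simp)
  rw [consMap_single]
  exact single_mem_fstLT hc l

theorem onTail_mem_fstLT {a : ℕ} (A : Module.End K (List ℕ →₀ K)) {F : List ℕ →₀ K}
    (hF : F ∈ fstLT K a) : onTail A F ∈ fstLT K a := by
  refine map_mem_of_single (fun l hl => ?_) hF
  obtain ⟨c, m, rfl, hc⟩ := hl
  rw [onTail_single_cons]
  exact consMap_mem_fstLT hc _

theorem mulSnd_pow_mem_fstLT {a : ℕ} (n : ℕ) {F : List ℕ →₀ K} (hF : F ∈ fstLT K a) :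
    (mulSnd K ^ n) F ∈ fstLT K a :=
  pow_mem (fun F hF => by rw [mulSnd_eq_onTail]; exact onTail_mem_fstLT _ hF) n hF

theorem lucas_mem_fstLT (l : List ℕ) (n : ℕ) : lucas K l n ∈ fstLT K (n + 1) := by
  induction n using Nat.twoStepInduction with
  | zero => simp [lucas]
  | one => exact single_mem_fstLT (by omega) _
  | more n ih1 ih2 =>
    refine add_mem (mulFst_mem_fstLT ih2) ?_
    rw [mulSnd_eq_onTail]
    exact onTail_mem_fstLT _ (fstLT_mono (by omega) ih1)

theorem lucas_sub_single_mem_fstLT (l : List ℕ) (n : ℕ) :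
    lucas K l (n + 1) - Finsupp.single ((n + 1) :: 0 :: l) 1 ∈ fstLT K (n + 1) := by
  induction n with
  | zero => simp [lucas]
  | succ n ih =>
    have : lucas K l (n + 1 + 1) - Finsupp.single ((n + 1 + 1) :: 0 :: l) 1 =
      mulFst K (lucas K l (n + 1) - Finsupp.single ((n + 1) :: 0 :: l) 1) +
        mulSnd K (lucas K l n) := by
      rw [lucas, map_sub, mulFst_single]; abel
    rw [this]
    refine add_mem (mulFst_mem_fstLT ih) ?_
    rw [mulSnd_eq_onTail]
    exact onTail_mem_fstLT _ (fstLT_mono (by omega) (lucas_mem_fstLT l n))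

/-- For `b < a` the monomial `v₁ ^ a v₂ ^ b` is the leading term of its image. -/
theorem lineSum_single_sub_mem_fstLT {a b : ℕ} (h : b < a) (l : List ℕ) :
    lineSum K (Finsupp.single (a :: b :: l) 1) - Finsupp.single (a :: b :: l) 1 ∈ fstLT K a := by
  obtain ⟨n, rfl⟩ : ∃ n, a = n + 1 + b := ⟨a - b - 1, by omega⟩
  have := mulFst_pow_mem_fstLT b (mulSnd_pow_mem_fstLT b (lucas_sub_single_mem_fstLT (K := K) l n))
  rw [map_sub, map_sub, mulSnd_pow_single, mulFst_pow_single, Nat.zero_add] at this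
  rwa [lineSum_single, lineSumFun, if_pos (by omega), Nat.add_sub_cancel]

theorem lineSum_consMap_sub_mem_fstLT {a : ℕ} {F : List ℕ →₀ K}
    (h : ∀ b l, F (b :: l) ≠ 0 → b < a) :
    lineSum K (consMap K a F) - consMap K a F ∈ fstLT K a := by
  have : ∀ G ∈ Finsupp.supported K K {m : List ℕ | ∀ b l, m = b :: l → b < a},
      (lineSum K ∘ₗ consMap K a - consMap K a) G ∈ fstLT K a := by
    intro G hG
    refine map_mem_of_single (fun l hl => ?_) hG
    cases l with
    | nil => simp [lineSum_single, lineSumFun]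
    | cons b l => simpa using lineSum_single_sub_mem_fstLT (hl b l rfl) l
  refine this F fun m hm b l hml => ?_
  subst hml
  exact h b l (by simpa using hm)

theorem IsSteinberg.sweep_consMap_sub_mem {a : ℕ} {F : List ℕ →₀ K} (hF : IsSteinberg F)
    (h : ∀ b l, F (b :: l) ≠ 0 → b < a) (k : ℕ) :
    sweep K (k + 1) (consMap K a F) - consMap K a F ∈ fstLT K a := by
  have h1 := onTail_mem_fstLT (sweep K k) (lineSum_consMap_sub_mem_fstLT h)
  rw [map_sub, onTail_consMap, hF.sweep_eq] at h1
  exact h1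

end Steinberg

/-! ### Functionals on words in the `Q̄^j` -/

section Functionals

/-- The exponents attached to a word `Q̄^J` on a generator of degree `n`: the place of `j` in
`j :: J` receives the excess `j - ΣJ - n`. The truncation of negative excesses to zero is
harmless, as only sequences with `IsAllowableSeq n J` are used. -/
def flagExponents (n : ℤ) : List ℕ → List ℕ
  | [] => []
  | j :: J => ((j : ℤ) - J.sum - n).toNat :: flagExponents n J

/-- All excesses `j - ΣJ - n` of the sequence are non-negative. -/
def IsAllowableSeq (n : ℤ) : List ℕ → Prop
  | [] => True
  | j :: J => (J.sum : ℤ) + n ≤ j ∧ IsAllowableSeq n J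

theorem flagExponents_injOn {n : ℤ} {I J : List ℕ} (hI : IsAllowableSeq n I)
    (hJ : IsAllowableSeq n J) (h : flagExponents n I = flagExponents n J) : I = J := by
  induction I generalizing J with
  | nil => cases J with
    | nil => rfl
    | cons j J => simp [flagExponents] at h
  | cons i I ih =>
    cases J with
    | nil => simp [flagExponents] at h
    | cons j J =>
      simp only [flagExponents, List.cons.injEq] at h
      obtain rfl := ih hI.2 hJ.2 h.2
      have h1 := hI.1
      have h2 := hJ.1
      congr 1
      omega

open Classical in
/-- The functional on words `Q̄^J` (on a generator of degree `n`) given by the coefficients of a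
polynomial; it vanishes on words with a negative excess. -/
def wordCoeff {K : Type*} [CommRing K] (n : ℤ) (F : List ℕ →₀ K) (J : List ℕ) : K :=
  if IsAllowableSeq n J then F (flagExponents n J) else 0

variable (K : Type*) [CommRing K]

/-- Functions on words which satisfy the relations of `R̄` and of allowability at every place of
the word. These are the linear functionals on the free allowable module on a generator of degree
`n`. -/
structure IsWordFunctional (n : ℤ) (c : List ℕ → K) : Prop where
  rel : ∀ (P : List ℕ) (r s : ℕ) (S : List ℕ), s < r → r ≤ 2 * s →
    c (P ++ r :: s :: S) = ∑ k ∈ Finset.range (r - s),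
      (Nat.choose (2 * s - r + 1 + 2 * k) k : K) * c (P ++ (2 * s + 1 + k) :: (r - s - 1 - k) :: S)
  vanish : ∀ (P : List ℕ) (j : ℕ) (S : List ℕ), (j : ℤ) < S.sum + n → c (P ++ j :: S) = 0

variable {K}

theorem wordCoeff_cons {n : ℤ} (F : List ℕ →₀ K) (j : ℕ) (J : List ℕ)
    (h : (J.sum : ℤ) + n ≤ j) :
    wordCoeff n F (j :: J) = wordCoeff n (slice ((j : ℤ) - J.sum - n).toNat F) J := by
  by_cases hJ : IsAllowableSeq n J
  · rw [wordCoeff, if_pos ⟨h, hJ⟩, wordCoeff, if_pos hJ, flagExponents, slice_apply]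
  · rw [wordCoeff, if_neg (fun h => hJ h.2), wordCoeff, if_neg hJ]

theorem wordCoeff_eq_zero {n : ℤ} (F : List ℕ →₀ K) (j : ℕ) (J : List ℕ)
    (h : (j : ℤ) < J.sum + n) : wordCoeff n F (j :: J) = 0 := by
  rw [wordCoeff, if_neg]
  intro h'
  have := h'.1
  omega

/-- A relation of `R̄` at the head of the word is a relation of `rbarRelSubmodule`; the terms
which differ have a negative excess. -/
theorem wordCoeff_rel [CharP K 2] {n : ℤ} (hn : 0 ≤ n) {F : List ℕ →₀ K}
    (hF : F ∈ rbarRelSubmodule K)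
    {r s : ℕ} (S : List ℕ) (hsr : s < r) (hrs : r ≤ 2 * s) :
    wordCoeff n F (r :: s :: S) = ∑ k ∈ Finset.range (r - s),
      (Nat.choose (2 * s - r + 1 + 2 * k) k : K) *
        wordCoeff n F ((2 * s + 1 + k) :: (r - s - 1 - k) :: S) := by
  obtain ⟨σ, hσ⟩ : ∃ σ : ℕ, (σ : ℤ) = S.sum + n := ⟨(S.sum + n).toNat, by omega⟩
  by_cases hS : IsAllowableSeq n S
  swap
  · rw [wordCoeff, if_neg (fun h => hS h.2.2), eq_comm]
    refine Finset.sum_eq_zero fun k _ => ?_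
    rw [wordCoeff, if_neg (fun h => hS h.2.2), mul_zero]
  -- reduction of words to exponents
  have key : ∀ p q : ℕ, wordCoeff n F (p :: q :: S) =
      if σ ≤ q ∧ q + σ ≤ p then F ((p - q - σ) :: (q - σ) :: flagExponents n S) else 0 := by
    intro p q
    rw [wordCoeff]
    have h : IsAllowableSeq n (p :: q :: S) ↔ σ ≤ q ∧ q + σ ≤ p := by
      simp only [IsAllowableSeq, hS, and_true, List.sum_cons]
      omega
    simp only [h, flagExponents, List.sum_cons]
    split_ifs with h
    · congr 3
      · omega
      · omega
    · rfl
  have hz : ∀ b, F (0 :: b :: flagExponents n S) = 0 := (hF (flagExponents n S)).1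
  have hrel : ∀ a b, 0 < a → a ≤ b → F (a :: b :: flagExponents n S) = ∑ k ∈ Finset.range a,
      (Nat.choose (b - a + 1 + 2 * k) k : K) *
        F ((2 * b - a + 2 + 2 * k) :: (a - 1 - k) :: flagExponents n S) :=
    (hF (flagExponents n S)).2
  by_cases hpos : s + σ < r
  · rw [key, if_pos (by omega), hrel _ _ (by omega) (by omega)]
    have hsub : Finset.range (r - s - σ) ⊆ Finset.range (r - s) := by
      simp
    rw [← Finset.sum_subset hsub]
    · refine Finset.sum_congr rfl fun k hk => ?_
      rw [Finset.mem_range] at hk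
      rw [key, if_pos (by omega)]
      congr 3
      · congr 1; omega
      · omega
      · congr 1; omega
    · intro k hk hk'
      rw [Finset.mem_range] at hk hk'
      rw [key, if_neg (by omega), mul_zero]
  · have h0 : wordCoeff n F (r :: s :: S) = 0 := by
      rw [key]
      split_ifs with h
      · rw [show r - s - σ = 0 by omega, hz]
      · rfl
    rw [h0, eq_comm]
    refine Finset.sum_eq_zero fun k hk => ?_
    rw [key, if_neg (by omega), mul_zero]

/-- The coefficients of a Steinberg invariant form a functional on the free allowable module:
being fixed by `lineSumAt K i`, the invariant satisfies the relation at place `i`. -/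
theorem IsSteinberg.isWordFunctional [CharP K 2] {n : ℤ} (hn : 0 ≤ n) {k : ℕ} {F : List ℕ →₀ K}
    (hF : IsSteinberg F) (hk : F ∈ ofLength K k) : IsWordFunctional K n (wordCoeff n F) where
  rel P r s S hsr hrs := by
    induction P generalizing F k with
    | nil =>
      rcases Nat.lt_or_ge k 2 with h | h
      · have : ∀ p q : ℕ, wordCoeff n F (p :: q :: S) = 0 := by
          intro p q
          rw [wordCoeff]
          split_ifs
          · exact (Finsupp.mem_supported' K _).1 hk _ (by simp [flagExponents]; omega)
          · rfl
        simp [this]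
      · obtain ⟨k, rfl⟩ := Nat.exists_eq_add_of_le' h
        refine wordCoeff_rel hn ?_ S hsr hrs
        rw [← hF 0]
        exact lineSum_mem_rbarRelSubmodule hk
    | cons j P ih =>
      have hsum : ∀ k ∈ Finset.range (r - s),
          (P ++ (2 * s + 1 + k) :: (r - s - 1 - k) :: S).sum = (P ++ r :: s :: S).sum := by
        intro k hk
        rw [Finset.mem_range] at hk
        simp only [List.sum_append, List.sum_cons]
        omega
      simp only [List.cons_append]
      by_cases h : ((P ++ r :: s :: S).sum : ℤ) + n ≤ j
      · rw [wordCoeff_cons _ _ _ h]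
        have hsl : ∃ k', slice (K := K) ((j : ℤ) - (P ++ r :: s :: S).sum - n).toNat F ∈
            ofLength K k' := by
          refine ⟨k - 1, fun l hl => ?_⟩
          have hl' : F (((j : ℤ) - (P ++ r :: s :: S).sum - n).toNat :: l) ≠ 0 := by
            rw [← slice_apply]; exact Finsupp.mem_support_iff.1 hl
          have := (Finsupp.mem_supported K F).1 hk (Finsupp.mem_support_iff.2 hl')
          simp at this ⊢
          omega
        obtain ⟨k', hk'⟩ := hsl
        rw [ih (hF.map_slice _) hk']
        refine Finset.sum_congr rfl fun k hk => ?_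
        rw [wordCoeff_cons _ _ _ (by rw [hsum k hk]; exact h), hsum k hk]
      · rw [wordCoeff_eq_zero _ _ _ (not_le.1 h), eq_comm]
        refine Finset.sum_eq_zero fun k hk => ?_
        rw [wordCoeff_eq_zero _ _ _ (by rw [hsum k hk]; exact not_le.1 h), mul_zero]
  vanish P j S hj := by
    rw [wordCoeff, if_neg]
    intro h
    induction P with
    | nil => have := h.1; omega
    | cons p P ih => exact ih h.2

/-- Completely unadmissible sequences with last term at least `n` have non-negative excesses,
since `J.sum + n` is at most twice the head of `J`. -/
theorem isAllowableSeq_of_isCU {n : ℤ} {J : List ℕ} (hJ : IsCU J)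
    (hlast : ∀ j ∈ J.getLast?, n ≤ (j : ℤ)) :
    IsAllowableSeq n J ∧ ∀ j ∈ J.head?, (J.sum : ℤ) + n ≤ 2 * j := by
  induction J with
  | nil => simp [IsAllowableSeq]
  | cons j J ih =>
    cases J with
    | nil =>
      simp only [List.getLast?_singleton, Option.mem_def, Option.some.injEq, forall_eq'] at hlast
      simp [IsAllowableSeq]
      omega
    | cons s J =>
      have hc := List.isChain_cons_cons.1 hJ
      obtain ⟨h1, h2⟩ := ih hc.2 (by simpa using hlast)
      have h3 := h2 s (by simp)
      have := hc.1
      refine ⟨⟨by omega, h1⟩, ?_⟩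
      simp only [List.head?_cons, Option.mem_def, Option.some.injEq, forall_eq',
        List.sum_cons] at h3 ⊢
      omega

theorem cons_le_cons_iff' {c a : ℕ} {l m : List ℕ} :
    c :: l ≤ a :: m ↔ c < a ∨ c = a ∧ l ≤ m := by
  rw [le_iff_lt_or_eq, le_iff_lt_or_eq]
  constructor
  · rintro (h | h)
    · cases h with
      | cons h => exact Or.inr ⟨rfl, Or.inl h⟩
      | rel h => exact Or.inl h
    · simp at h; exact Or.inr ⟨h.1, Or.inr h.2⟩
  · rintro (h | ⟨rfl, h | rfl⟩)
    · exact Or.inl (List.Lex.rel h)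
    · exact Or.inl (List.Lex.cons h)
    · exact Or.inr rfl

/-- For every completely unadmissible `J` there is a Steinberg invariant whose lexicographically
leading exponent is that of `J`. It is built by sweeps: at `j :: J` the inequality `2 j₂ < j` says
that the new exponent exceeds the next one, so that the sweep does not change the leading term. -/
theorem exists_steinberg {K : Type*} [Field K] [IsAlgClosed K] [CharP K 2] {n : ℤ}
    {J : List ℕ} (hJ : IsCU J) (hlast : ∀ j ∈ J.getLast?, n ≤ (j : ℤ)) :
    ∃ F : List ℕ →₀ K, IsSteinberg F ∧ F ∈ ofLength K J.length ∧ F (flagExponents n J) = 1 ∧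
      ∀ l, F l ≠ 0 → l ≤ flagExponents n J := by
  induction J with
  | nil =>
    refine ⟨Finsupp.single [] 1, fun i => lineSumAt_apply_of_length (k := 0) (by omega)
      (single_mem_ofLength rfl), single_mem_ofLength rfl, by simp [flagExponents], fun l hl => ?_⟩
    rw [Finsupp.single_apply] at hl
    simp only [ne_eq, ite_eq_right_iff, one_ne_zero, imp_false, not_not] at hl
    rw [← hl]; simp [flagExponents]
  | cons j J ih =>
    have hc : IsCU J := hJ.tail
    have hlast' : ∀ j ∈ J.getLast?, n ≤ (j : ℤ) := by
      cases J with
      | nil => simp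
      | cons s J => simpa using hlast
    obtain ⟨F, hF, hlen, hlead, hle⟩ := ih hc hlast'
    set a := ((j : ℤ) - J.sum - n).toNat with ha
    have hall := (isAllowableSeq_of_isCU hJ hlast).1.1
    have hlt : ∀ b l, F (b :: l) ≠ 0 → b < a := by
      intro b l hbl
      have h := hle _ hbl
      cases J with
      | nil => exact absurd h (not_le.2 List.Lex.nil)
      | cons s J =>
        have hb : b ≤ ((s : ℤ) - J.sum - n).toNat := by
          have := cons_le_cons_iff'.1 h
          omega
        have h1 := (List.isChain_cons_cons.1 hJ).1
        have h2 := (isAllowableSeq_of_isCU hc hlast').1.1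
        simp only [List.sum_cons] at ha
        omega
    have hsub := hF.sweep_consMap_sub_mem hlt J.length
    set G := sweep K (J.length + 1) (consMap K a F) with hG
    have hcoef : ∀ c l, a ≤ c → G (c :: l) = consMap K a F (c :: l) := by
      intro c l hac
      have := (Finsupp.mem_supported' K _).1 hsub (c :: l) (by
        rintro ⟨c', m, h, hc'⟩
        simp at h
        omega)
      rw [Finsupp.sub_apply, sub_eq_zero] at this
      exact this
    refine ⟨G, hF.sweep_consMap hlen a,
      sweep_mem_ofLength _ _ _ (consMap_mem_ofLength hlen), ?_, ?_⟩
    · rw [flagExponents, ← ha, hcoef _ _ le_rfl, consMap_apply, hlead]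
    · intro l hl
      rw [flagExponents, ← ha]
      cases l with
      | nil => exact le_of_lt List.Lex.nil
      | cons c l =>
        rw [cons_le_cons_iff']
        rcases lt_or_ge c a with h | h
        · exact Or.inl h
        · rw [hcoef _ _ h] at hl
          by_cases hca : c = a
          · subst hca
            rw [consMap_apply] at hl
            exact Or.inr ⟨rfl, hle _ hl⟩
          · exact absurd (consMap_apply_ne K hca F l) hl

end Functionals

/-! ### Gradings and homogeneous bases -/

section Gradings

variable {M : Type*} [AddCommGroup M] [Module (ZMod 2) M]

theorem isInternal_of_basis {ι : Type*} (e : Module.Basis ι (ZMod 2) M) (deg : ι → ℤ)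
    {𝓜 : ℤ → Submodule (ZMod 2) M}
    (h : ∀ n, 𝓜 n = Submodule.span (ZMod 2) (e '' {i | deg i = n})) : DirectSum.IsInternal 𝓜 := by
  refine DirectSum.isInternal_submodule_of_iSupIndep_of_iSup_eq_top ?_ ?_
  · intro n
    have hle : (⨆ (m : ℤ) (_ : m ≠ n), 𝓜 m) ≤ Submodule.span (ZMod 2) (e '' {i | deg i ≠ n}) := by
      refine iSup₂_le fun m hm => ?_
      rw [h]
      refine Submodule.span_mono (Set.image_mono fun i hi => ?_)
      simp only [Set.mem_ofPred_eq] at hi ⊢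
      rwa [hi]
    refine Disjoint.mono_right hle ?_
    rw [h]
    refine e.linearIndependent.disjoint_span_image ?_
    rw [Set.disjoint_left]
    intro i hi hi'
    exact hi' hi
  · rw [eq_top_iff, ← e.span_eq, Submodule.span_le]
    rintro _ ⟨i, rfl⟩
    refine Submodule.mem_iSup_of_mem (deg i) ?_
    rw [h]
    exact Submodule.subset_span ⟨i, rfl, rfl⟩

theorem nonneg_eq_top {𝓜 : ℤ → Submodule (ZMod 2) M} (hint : DirectSum.IsInternal 𝓜)
    (h : ∀ n < 0, 𝓜 n = ⊥) : nonneg 𝓜 = ⊤ := by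
  rw [eq_top_iff, ← hint.submodule_iSup_eq_top]
  refine iSup_le fun n => ?_
  rcases lt_or_ge n 0 with hn | hn
  · rw [h n hn]; exact bot_le
  · exact le_iSup (fun n : {n : ℤ // 0 ≤ n} => 𝓜 n) ⟨n, hn⟩

theorem nonnegGrading_isInternal {ι : Type*} (e : Module.Basis ι (ZMod 2) M) (deg : ι → ℤ)
    {𝓜 : ℤ → Submodule (ZMod 2) M}
    (h : ∀ n, 𝓜 n = Submodule.span (ZMod 2) (e '' {i | deg i = n})) (htop : nonneg 𝓜 = ⊤) :
    DirectSum.IsInternal (nonnegGrading 𝓜) := by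
  let E := (LinearEquiv.ofTop (nonneg 𝓜) htop).symm
  refine isInternal_of_basis (e.map E) deg fun n => ?_
  have h1 : nonnegGrading 𝓜 n = (𝓜 n).map (E : M →ₗ[ZMod 2] nonneg 𝓜) := by
    rw [Submodule.map_equiv_eq_comap_symm]
    rfl
  rw [h1, h, Submodule.map_span, Set.image_image]
  rfl

/-- A basis of homogeneous elements restricts to a basis of each homogeneous part. -/
theorem mem_of_homogeneous_basis {ι : Type*} (e : Module.Basis ι (ZMod 2) M) (deg : ι → ℤ)
    {𝓜 : ℤ → Submodule (ZMod 2) M} (hint : DirectSum.IsInternal 𝓜) (he : ∀ i, e i ∈ 𝓜 (deg i))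
    (n : ℤ) : 𝓜 n = Submodule.span (ZMod 2) (e '' {i | deg i = n}) := by
  let 𝓝 : ℤ → Submodule (ZMod 2) M := fun n => Submodule.span (ZMod 2) (e '' {i | deg i = n})
  have hle : ∀ n, 𝓝 n ≤ 𝓜 n := by
    intro n
    refine Submodule.span_le.2 ?_
    rintro _ ⟨i, rfl, rfl⟩
    exact he i
  refine le_antisymm (fun x hx => ?_) (hle n)
  have hx' : x ∈ 𝓝 n ⊔ Submodule.span (ZMod 2) (e '' {i | deg i ≠ n}) := by
    rw [← Submodule.span_union, ← Set.image_union]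
    have : {i | deg i = n} ∪ {i | deg i ≠ n} = Set.univ := by ext; simp [em]
    rw [this, Set.image_univ, e.span_eq]
    trivial
  obtain ⟨y, hy, z, hz, rfl⟩ := Submodule.mem_sup.1 hx'
  have hz1 : z ∈ 𝓜 n := by
    have := sub_mem hx (hle n hy)
    rwa [add_sub_cancel_left] at this
  have hz2 : z ∈ ⨆ (m : ℤ) (_ : m ≠ n), 𝓜 m := by
    have : Submodule.span (ZMod 2) (e '' {i | deg i ≠ n}) ≤ ⨆ (m : ℤ) (_ : m ≠ n), 𝓜 m := by
      refine Submodule.span_le.2 ?_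
      rintro _ ⟨i, hi, rfl⟩
      exact Submodule.mem_iSup_of_mem (deg i) (Submodule.mem_iSup_of_mem hi (he i))
    exact this hz
  have hz0 : z = 0 := Submodule.disjoint_def.1 (hint.submodule_iSupIndep n) z hz1 hz2
  rwa [hz0, add_zero]

theorem isGradedMap_of_basis {ι : Type*} {e : ι → M} {deg : ι → ℤ}
    {𝓜 : ℤ → Submodule (ZMod 2) M}
    (h : ∀ n, 𝓜 n = Submodule.span (ZMod 2) (e '' {i | deg i = n}))
    {N : Type*} [AddCommGroup N] [Module (ZMod 2) N] {𝓝 : ℤ → Submodule (ZMod 2) N}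
    {f : M →ₗ[ZMod 2] N} (hf : ∀ i, f (e i) ∈ 𝓝 (deg i)) : IsGradedMap 𝓜 𝓝 f := by
  intro n x hx
  have : 𝓜 n ≤ (𝓝 n).comap f := by
    rw [h, Submodule.span_le]
    rintro _ ⟨i, rfl, rfl⟩
    exact hf i
  exact this hx

end Gradings

/-! ### Modules over `R̄`: completely unadmissible monomials span -/

section RBarModules

variable {N : Type*} [AddCommGroup N] [Module (ZMod 2) N] [Module RBar N]

/-- The two `𝔽₂`-structures agree on every `R̄`-module; no compatibility has to be assumed, since
a scalar is `0` or `1`. -/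
theorem zmod_smul_rbar_smul (c : ZMod 2) (r : RBar) (x : N) : (c • r) • x = c • (r • x) := by
  fin_cases c
  · show ((0 : ZMod 2) • r) • x = (0 : ZMod 2) • (r • x)
    simp
  · show ((1 : ZMod 2) • r) • x = (1 : ZMod 2) • (r • x)
    simp

variable (N) in
/-- The action of `r` as an `𝔽₂`-linear map. -/
def rbarSMul (r : RBar) : N →ₗ[ZMod 2] N :=
  (DistribSMul.toAddMonoidHom N r).toZModLinearMap 2

@[simp] theorem rbarSMul_apply (r : RBar) (x : N) : rbarSMul N r x = r • x := rfl

@[simp] theorem QbarSeq_nil : QbarSeq [] = 1 := rfl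

theorem QbarSeq_cons (j : ℕ) (J : List ℕ) : QbarSeq (j :: J) = Qbar j * QbarSeq J := by
  simp [QbarSeq]

theorem QbarSeq_append (I J : List ℕ) : QbarSeq (I ++ J) = QbarSeq I * QbarSeq J := by
  simp [QbarSeq]

theorem QbarSeq_singleton (j : ℕ) : QbarSeq [j] = Qbar j := by
  simp [QbarSeq]

theorem seqDeg_cons (j : ℕ) (J : List ℕ) : seqDeg (j :: J) = (j : ℤ) - 1 + seqDeg J := by
  simp [seqDeg]

theorem seqDeg_eq (J : List ℕ) : seqDeg J = (J.sum : ℤ) - J.length := by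
  induction J with
  | nil => simp [seqDeg]
  | cons j J ih => rw [seqDeg_cons, ih]; simp; ring

theorem Qbar_mul_Qbar {r s : ℕ} (hsr : s < r) (hrs : r ≤ 2 * s) :
    Qbar r * Qbar s = ∑ k ∈ Finset.range (r - s), (Nat.choose (2 * s - r + 1 + 2 * k) k : ZMod 2) •
      (Qbar (2 * s + 1 + k) * Qbar (r - s - 1 - k)) := by
  have := RingQuot.mkAlgHom_rel (ZMod 2) (RBarRel.rel r s hsr hrs)
  change RBar.mk _ = RBar.mk _ at this
  rw [map_mul, map_sum] at this
  simp only [map_smul, map_mul] at this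
  exact this

theorem span_QbarSeq : Submodule.span (ZMod 2) (Set.range QbarSeq) = ⊤ := by
  have hmul : ∀ x ∈ Submodule.span (ZMod 2) (Set.range QbarSeq),
      ∀ y ∈ Submodule.span (ZMod 2) (Set.range QbarSeq),
        x * y ∈ Submodule.span (ZMod 2) (Set.range QbarSeq) := by
    intro x hx y hy
    refine Submodule.span_induction₂ (p := fun x y _ _ => x * y ∈ _) ?_ ?_ ?_ ?_ ?_ ?_ ?_ hx hy
    · rintro _ _ ⟨I, rfl⟩ ⟨J, rfl⟩
      rw [← QbarSeq_append]
      exact Submodule.subset_span ⟨_, rfl⟩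
    · intro x _; rw [zero_mul]; exact zero_mem _
    · intro x _; rw [mul_zero]; exact zero_mem _
    · intro x y z _ _ _ h1 h2; rw [add_mul]; exact add_mem h1 h2
    · intro x y z _ _ _ h1 h2; rw [mul_add]; exact add_mem h1 h2
    · intro c x y _ _ h; rw [smul_mul_assoc]; exact Submodule.smul_mem _ _ h
    · intro c x y _ _ h; rw [mul_smul_comm]; exact Submodule.smul_mem _ _ h
  rw [eq_top_iff]
  rintro x -
  obtain ⟨x, rfl⟩ := RingQuot.mkAlgHom_surjective (ZMod 2) RBarRel x
  change RBar.mk x ∈ _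
  induction x using FreeAlgebra.induction with
  | grade0 c =>
    rw [AlgHom.commutes, Algebra.algebraMap_eq_smul_one]
    exact Submodule.smul_mem _ _ (Submodule.subset_span ⟨[], rfl⟩)
  | grade1 j => exact Submodule.subset_span ⟨[j], QbarSeq_singleton j⟩
  | mul a b ha hb => rw [map_mul]; exact hmul _ ha _ hb
  | add a b ha hb => rw [map_add]; exact add_mem ha hb

/-- Completely unadmissible sequences whose last term is at least `n`. They index the basis of the
free allowable module on a generator of degree `n`. -/
def IsCUFor (n : ℤ) (J : List ℕ) : Prop := IsCU J ∧ ∀ j ∈ J.getLast?, n ≤ (j : ℤ)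

/-- The span of the elements `Q̄^I x` with `I` completely unadmissible for `n`, of length `k` and
sum `s`. -/
def cuSpan (x : N) (n : ℤ) (k s : ℕ) : Submodule (ZMod 2) N :=
  Submodule.span (ZMod 2) {y | ∃ I, IsCUFor n I ∧ I.length = k ∧ I.sum = s ∧ y = QbarSeq I • x}

/-- Rewriting of `Q̄^j Q̄^I x`: if `j ≤ i` for the head `i` of `I`, it vanishes by allowability
(as `n` is positive), and if `i < j ≤ 2 i`, the relations express it by words whose tails have a
smaller sum. Length and sum of the sequence are preserved. -/
theorem Qbar_smul_mem_cuSpan {x : N} {n : ℤ} (hn : 1 ≤ n)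
    (hv : ∀ (j : ℕ) (J : List ℕ), (j : ℤ) < J.sum + n → QbarSeq (j :: J) • x = 0) (k : ℕ) :
    ∀ (s j : ℕ), ∀ y ∈ cuSpan x n k s, Qbar j • y ∈ cuSpan x n (k + 1) (j + s) := by
  induction k with
  | zero =>
    intro s j y hy
    have : cuSpan x n 0 s ≤ (cuSpan x n 1 (j + s)).comap (rbarSMul N (Qbar j)) := by
      refine Submodule.span_le.2 ?_
      rintro _ ⟨I, hI, hlen, rfl, rfl⟩
      obtain rfl := List.length_eq_zero_iff.1 hlen
      show Qbar j • QbarSeq [] • x ∈ cuSpan x n (0 + 1) (j + ([] : List ℕ).sum)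
      rw [smul_smul, ← QbarSeq_cons]
      by_cases hj : (j : ℤ) < n
      · rw [hv j [] (by simpa using hj)]; exact zero_mem _
      · refine Submodule.subset_span ⟨[j], ⟨?_, ?_⟩, rfl, by simp, rfl⟩
        · simp [IsCU]
        · simpa using hj
    exact this hy
  | succ k ih =>
    intro s
    induction s using Nat.strong_induction_on with
    | _ s ihs =>
      intro j y hy
      have : cuSpan x n (k + 1) s ≤
          (cuSpan x n (k + 1 + 1) (j + s)).comap (rbarSMul N (Qbar j)) := by
        refine Submodule.span_le.2 ?_
        rintro _ ⟨I, hI, hlen, rfl, rfl⟩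
        obtain ⟨i, I, rfl⟩ : ∃ i I', I = i :: I' := by
          cases I with
          | nil => simp at hlen
          | cons i I => exact ⟨i, I, rfl⟩
        show Qbar j • QbarSeq (i :: I) • x ∈ cuSpan x n (k + 1 + 1) (j + (i :: I).sum)
        rcases lt_or_ge (2 * i) j with h | h
        · rw [smul_smul, ← QbarSeq_cons]
          refine Submodule.subset_span ⟨j :: i :: I, ⟨?_, ?_⟩, by simpa using hlen, by simp, rfl⟩
          · exact List.isChain_cons_cons.2 ⟨h, hI.1⟩
          · simpa using hI.2
        rcases le_or_gt j i with h' | h'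
        · rw [smul_smul, ← QbarSeq_cons, hv]
          · exact zero_mem _
          · simp only [List.sum_cons]; omega
        rw [QbarSeq_cons, smul_smul, ← mul_assoc, Qbar_mul_Qbar h' h, Finset.sum_mul,
          Finset.sum_smul]
        refine sum_mem fun m hm => ?_
        rw [Finset.mem_range] at hm
        rw [smul_mul_assoc, zmod_smul_rbar_smul, mul_assoc, mul_smul, mul_smul]
        refine Submodule.smul_mem _ _ ?_
        have hI' : IsCUFor n I := ⟨hI.1.tail, by
          have := hI.2
          cases I with
          | nil => simp
          | cons a I => simpa using this⟩
        have h1 := ih I.sum (j - i - 1 - m) (QbarSeq I • x)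
          (Submodule.subset_span ⟨I, hI', by simpa using hlen, rfl, rfl⟩)
        have h2 := ihs (j - i - 1 - m + I.sum) (by simp; omega) (2 * i + 1 + m) _ h1
        have e : 2 * i + 1 + m + (j - i - 1 - m + I.sum) = j + (i :: I).sum := by
          simp; omega
        rwa [e] at h2
      exact this hy

theorem QbarSeq_smul_mem_cuSpan {x : N} {n : ℤ} (hn : 1 ≤ n)
    (hv : ∀ (j : ℕ) (J : List ℕ), (j : ℤ) < J.sum + n → QbarSeq (j :: J) • x = 0) (J : List ℕ) :
    QbarSeq J • x ∈ cuSpan x n J.length J.sum := by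
  induction J with
  | nil => exact Submodule.subset_span ⟨[], ⟨by simp [IsCU], by simp⟩, rfl, rfl, rfl⟩
  | cons j J ih =>
    rw [QbarSeq_cons, mul_smul]
    exact Qbar_smul_mem_cuSpan hn hv _ _ _ _ ih

end RBarModules

/-! ### The action of `R̄` on functionals -/

section Pairing

variable (K : Type*) [CommRing K] [Algebra (ZMod 2) K]

/-- The `𝔽₂`-space of functionals of `IsWordFunctional`. -/
def wordFunctionals (n : ℤ) : Submodule (ZMod 2) (List ℕ → K) where
  carrier := {c | IsWordFunctional K n c}
  zero_mem' := ⟨fun _ _ _ _ _ _ => by simp, fun _ _ _ _ => rfl⟩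
  add_mem' {c c'} hc hc' := ⟨fun P r s S h1 h2 => by
      simp only [Pi.add_apply, mul_add, Finset.sum_add_distrib]
      rw [hc.rel P r s S h1 h2, hc'.rel P r s S h1 h2],
    fun P j S h => by simp [hc.vanish P j S h, hc'.vanish P j S h]⟩
  smul_mem' a c hc := ⟨fun P r s S h1 h2 => by
      simp only [Pi.smul_apply, mul_smul_comm]
      rw [hc.rel P r s S h1 h2, Finset.smul_sum],
    fun P j S h => by simp [hc.vanish P j S h]⟩

variable {K}

/-- The right action of `Q̄^j` on functionals: evaluation at the words which begin with `j`. -/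
def consFunctional (n : ℤ) (j : ℕ) : Module.End (ZMod 2) (wordFunctionals K n) where
  toFun c := ⟨fun J => c.1 (j :: J), fun P => c.2.rel (j :: P), fun P => c.2.vanish (j :: P)⟩
  map_add' _ _ := rfl
  map_smul' _ _ := rfl

@[simp] theorem consFunctional_apply (n : ℤ) (j : ℕ) (c : wordFunctionals K n) (J : List ℕ) :
    (consFunctional (K := K) n j c : List ℕ → K) J = (c : List ℕ → K) (j :: J) := rfl

variable (K) in
/-- The right action of `R̄` on functionals. It exists because a functional satisfies the
relations at the head of a word, and what remains satisfies them at the later places. -/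
def rbarActRight (n : ℤ) : RBar →ₐ[ZMod 2] (Module.End (ZMod 2) (wordFunctionals K n))ᵐᵒᵖ :=
  RingQuot.liftAlgHom (ZMod 2)
    ⟨FreeAlgebra.lift (ZMod 2) fun j => MulOpposite.op (consFunctional n j), by
      rintro _ _ ⟨r, s, hsr, hrs⟩
      rw [map_sum, map_mul]
      simp only [map_smul, map_mul, FreeAlgebra.lift_ι_apply]
      simp only [← MulOpposite.op_mul, ← MulOpposite.op_smul, ← Finset.op_sum]
      congr 1
      ext c J
      have := c.2.rel [] r s J hsr hrs
      simp only [List.nil_append] at this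
      simp only [Module.End.mul_apply, consFunctional_apply, LinearMap.sum_apply,
        LinearMap.smul_apply, Submodule.coe_sum, Finset.sum_apply, Submodule.coe_smul,
        Pi.smul_apply]
      rw [this]
      refine Finset.sum_congr rfl fun k _ => ?_
      rw [Algebra.smul_def, map_natCast]⟩

theorem rbarActRight_QbarSeq (n : ℤ) (I J : List ℕ) (c : wordFunctionals K n) :
    ((rbarActRight K n (QbarSeq I)).unop c).1 J = c.1 (I ++ J) := by
  induction I generalizing c with
  | nil => simp
  | cons i I ih =>
    have h : rbarActRight K n (Qbar i) = MulOpposite.op (consFunctional n i) := by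
      have := RingQuot.liftAlgHom_mkAlgHom_apply (ZMod 2) (A := FreeAlgebra (ZMod 2) ℕ)
        (s := RBarRel) (B := (Module.End (ZMod 2) (wordFunctionals K n))ᵐᵒᵖ)
      exact (this _ _ (FreeAlgebra.ι (ZMod 2) i)).trans (FreeAlgebra.lift_ι_apply _ _)
    rw [QbarSeq_cons, map_mul, MulOpposite.unop_mul, Module.End.mul_apply, ih, h]
    rfl

/-- The value of a functional at `r` applied to the generator. -/
def rbarPairing (n : ℤ) (c : wordFunctionals K n) : RBar →ₗ[ZMod 2] K where
  toFun r := ((rbarActRight K n r).unop c).1 []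
  map_add' _ _ := by simp
  map_smul' _ _ := by simp

theorem rbarPairing_mul_QbarSeq (n : ℤ) (c : wordFunctionals K n) (r : RBar) (J : List ℕ) :
    rbarPairing n c (r * QbarSeq J) = ((rbarActRight K n r).unop c).1 J := by
  have := rbarActRight_QbarSeq n J [] ((rbarActRight K n r).unop c)
  rw [List.append_nil] at this
  rw [← this]
  simp [rbarPairing]

end Pairing

/-! ### The free allowable module -/

section FreeAllowableBasis

variable {W : Type*} [AddCommGroup W] [Module (ZMod 2) W] {𝓦 : ℤ → Submodule (ZMod 2) W}

theorem mkQ_tmul (r : RBar) (x : W) :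
    (allowRel 𝓦).mkQ (r ⊗ₜ[ZMod 2] x) = r • allowIncl 𝓦 x := by
  have : r ⊗ₜ[ZMod 2] x = r • ((1 : RBar) ⊗ₜ[ZMod 2] x) := by
    rw [TensorProduct.smul_tmul', smul_eq_mul, mul_one]
  rw [this, map_smul]
  rfl

theorem QbarSeq_smul_allowIncl_eq_zero {n : ℤ} {x : W} (hx : x ∈ 𝓦 n) (j : ℕ) (J : List ℕ)
    (h : (j : ℤ) < J.sum + n) : QbarSeq (j :: J) • allowIncl 𝓦 x = 0 := by
  rw [← mkQ_tmul, Submodule.mkQ_apply, Submodule.Quotient.mk_eq_zero]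
  exact Submodule.subset_span ⟨j, J, n, x, hx, h, rfl⟩

theorem freeAllowable_induction {p : FreeAllowable 𝓦 → Prop}
    (h : ∀ (r : RBar) (x : W), p (r • allowIncl 𝓦 x)) (hadd : ∀ a b, p a → p b → p (a + b))
    (t : FreeAllowable 𝓦) : p t := by
  obtain ⟨t, rfl⟩ := Submodule.mkQ_surjective _ t
  induction t using TensorProduct.induction_on with
  | zero =>
    rw [map_zero]
    have := h 0 0
    rwa [zero_smul] at this
  | tmul r x => rw [mkQ_tmul]; exact h r x
  | add a b ha hb => rw [map_add]; exact hadd _ _ ha hb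

/-- A functional `c` on words over a generator of degree `n` and a functional on `W` supported in
degree `n` together give a functional on the free allowable module. -/
theorem exists_freeAllowable_functional {K : Type*} [CommRing K] [Algebra (ZMod 2) K] {n : ℤ}
    (c : wordFunctionals K n) (lam : W →ₗ[ZMod 2] ZMod 2)
    (hlam : ∀ m, m ≠ n → ∀ x ∈ 𝓦 m, lam x = 0) :
    ∃ Ψ : FreeAllowable 𝓦 →ₗ[ZMod 2] K, ∀ (J : List ℕ) (x : W),
      Ψ (QbarSeq J • allowIncl 𝓦 x) = lam x • c.1 J := by
  let Φ : RBar ⊗[ZMod 2] W →ₗ[ZMod 2] K :=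
    TensorProduct.lift ((LinearMap.lsmul (ZMod 2) K ∘ₗ lam).flip ∘ₗ rbarPairing n c)
  have hΦ : ∀ r x, Φ (r ⊗ₜ x) = lam x • rbarPairing n c r := fun r x => rfl
  have hker : ∀ t ∈ allowRel 𝓦, ∀ r : RBar, Φ (r • t) = 0 := by
    intro t ht
    refine Submodule.span_induction (p := fun t _ => ∀ r : RBar, Φ (r • t) = 0) ?_ ?_ ?_ ?_ ht
    · rintro _ ⟨j, J, m, x, hx, hj, rfl⟩ r
      rw [TensorProduct.smul_tmul', hΦ, smul_eq_mul, rbarPairing_mul_QbarSeq]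
      by_cases hm : m = n
      · subst hm
        have := ((rbarActRight K m r).unop c).2.vanish [] j J hj
        rw [List.nil_append] at this
        rw [this, smul_zero]
      · rw [hlam m hm x hx, zero_smul]
    · intro r; rw [smul_zero, map_zero]
    · intro a b _ _ ha hb r; rw [smul_add, map_add, ha, hb, add_zero]
    · intro s a _ ha r; rw [smul_smul]; exact ha _
  refine ⟨(Submodule.liftQ ((allowRel 𝓦).restrictScalars (ZMod 2)) Φ fun t ht => ?_).comp
    (Submodule.Quotient.restrictScalarsEquiv (ZMod 2) (allowRel 𝓦)).symm.toLinearMap,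
    fun J x => ?_⟩
  · have := hker t ht 1
    rwa [one_smul] at this
  · rw [← mkQ_tmul]
    change Φ (QbarSeq J ⊗ₜ x) = _
    have := rbarPairing_mul_QbarSeq n c 1 J
    rw [one_mul, map_one] at this
    rw [hΦ, this]
    rfl

variable {ι : Type*} (e : Module.Basis ι (ZMod 2) W) (deg : ι → ℤ)

/-- In a linear relation, choose the term with a given generator whose exponent sequence is least.
The functional of the Steinberg invariant with this leading exponent vanishes on all other terms
of the relation. -/
theorem freeAllowable_linearIndependent
    (h𝓦 : ∀ n, 𝓦 n = Submodule.span (ZMod 2) (e '' {i | deg i = n})) (hpos : ∀ i, 1 ≤ deg i) :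
    LinearIndependent (ZMod 2) fun p : {p : List ℕ × ι // IsCUFor (deg p.2) p.1} =>
      QbarSeq p.1.1 • allowIncl 𝓦 (e p.1.2) := by
  classical
  rw [linearIndependent_iff]
  intro l hl
  by_contra hne
  obtain ⟨p, hp⟩ := Finsupp.support_nonempty_iff.2 hne
  -- among the terms with the generator `e i`, the one with the least exponent sequence
  obtain ⟨q, hq, hmin⟩ := (l.support.filter fun q => q.1.2 = p.1.2).exists_min_image
    (fun q => flagExponents (deg p.1.2) q.1.1) ⟨p, by simpa using hp⟩
  rw [Finset.mem_filter] at hq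
  obtain ⟨hq, hqp⟩ := hq
  set i := p.1.2 with hi
  have hq2 := q.2
  rw [hqp] at hq2
  obtain ⟨F, hF, hFl, hF1, hFle⟩ := exists_steinberg (K := AlgebraicClosure (ZMod 2)) hq2.1 hq2.2
  have hc := hF.isWordFunctional (n := deg i) (by have := hpos i; omega) hFl
  obtain ⟨Ψ, hΨ⟩ := exists_freeAllowable_functional (𝓦 := 𝓦) (n := deg i)
    (⟨_, hc⟩ : wordFunctionals (AlgebraicClosure (ZMod 2)) (deg i)) (e.coord i) (by
      intro m hm x hx
      rw [h𝓦] at hx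
      have : Submodule.span (ZMod 2) (e '' {i | deg i = m}) ≤ LinearMap.ker (e.coord i) := by
        refine Submodule.span_le.2 ?_
        rintro _ ⟨k, hk, rfl⟩
        have : k ≠ i := by rintro rfl; exact hm hk.symm
        simp [this]
      exact this hx)
  have := congrArg Ψ hl
  rw [Finsupp.linearCombination_apply, map_finsuppSum, map_zero, Finsupp.sum,
    Finset.sum_eq_single q] at this
  · rw [map_smul, hΨ, hqp] at this
    simp only [Module.Basis.coord_apply, Module.Basis.repr_self, Finsupp.single_eq_same, wordCoeff,
      if_pos (isAllowableSeq_of_isCU hq2.1 hq2.2).1, hF1, one_smul] at this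
    have h1 := Finsupp.mem_support_iff.1 hq
    rw [Algebra.smul_def, mul_one, map_eq_zero] at this
    exact h1 this
  · intro s hs hsq
    rw [map_smul, hΨ]
    by_cases hsi : s.1.2 = i
    · have hs2 := s.2
      rw [hsi] at hs2
      have hal := (isAllowableSeq_of_isCU hs2.1 hs2.2).1
      have : wordCoeff (deg i) F s.1.1 = 0 := by
        rw [wordCoeff, if_pos hal]
        by_contra h0
        have h1 := hFle _ h0
        have h2 := hmin s (Finset.mem_filter.2 ⟨hs, hsi⟩)
        have h3 := flagExponents_injOn hal (isAllowableSeq_of_isCU hq2.1 hq2.2).1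
          (le_antisymm h1 h2)
        exact hsq (Subtype.ext (Prod.ext h3 (hsi.trans hqp.symm)))
      simp [this]
    · simp [hsi]
  · intro h; exact absurd hq h

variable {e deg}

theorem QbarSeq_smul_allowIncl_mem_span
    (h𝓦 : ∀ n, 𝓦 n = Submodule.span (ZMod 2) (e '' {i | deg i = n})) (hpos : ∀ i, 1 ≤ deg i)
    (J : List ℕ) (i : ι) :
    QbarSeq J • allowIncl 𝓦 (e i) ∈ Submodule.span (ZMod 2)
      ((fun p : {p : List ℕ × ι // IsCUFor (deg p.2) p.1} =>
        QbarSeq p.1.1 • allowIncl 𝓦 (e p.1.2)) ''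
          {p | deg p.1.2 + seqDeg p.1.1 = deg i + seqDeg J}) := by
  have hei : e i ∈ 𝓦 (deg i) := by
    rw [h𝓦]; exact Submodule.subset_span ⟨i, rfl, rfl⟩
  have h := QbarSeq_smul_mem_cuSpan (x := allowIncl 𝓦 (e i)) (hpos i)
    (QbarSeq_smul_allowIncl_eq_zero hei) J
  refine Submodule.span_mono ?_ h
  rintro _ ⟨I, hI, hlen, hsum, rfl⟩
  refine ⟨⟨(I, i), hI⟩, ?_, rfl⟩
  show deg i + seqDeg I = deg i + seqDeg J
  rw [seqDeg_eq, seqDeg_eq, hlen, hsum]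

theorem allowGrading_eq_span
    (h𝓦 : ∀ n, 𝓦 n = Submodule.span (ZMod 2) (e '' {i | deg i = n})) (hpos : ∀ i, 1 ≤ deg i)
    (d : ℤ) : allowGrading 𝓦 d = Submodule.span (ZMod 2)
      ((fun p : {p : List ℕ × ι // IsCUFor (deg p.2) p.1} =>
        QbarSeq p.1.1 • allowIncl 𝓦 (e p.1.2)) '' {p | deg p.1.2 + seqDeg p.1.1 = d}) := by
  apply le_antisymm
  · refine Submodule.span_le.2 ?_
    rintro _ ⟨J, n, x, hx, rfl, rfl⟩
    have : 𝓦 n ≤ (Submodule.span (ZMod 2)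
      ((fun p : {p : List ℕ × ι // IsCUFor (deg p.2) p.1} =>
        QbarSeq p.1.1 • allowIncl 𝓦 (e p.1.2)) ''
          {p | deg p.1.2 + seqDeg p.1.1 = n + seqDeg J})).comap
          (rbarSMul _ (QbarSeq J) ∘ₗ allowIncl 𝓦) := by
      rw [h𝓦, Submodule.span_le]
      rintro _ ⟨i, rfl, rfl⟩
      exact QbarSeq_smul_allowIncl_mem_span h𝓦 hpos J i
    exact this hx
  · refine Submodule.span_mono ?_
    rintro _ ⟨⟨⟨J, i⟩, h⟩, hd, rfl⟩
    refine ⟨J, deg i, e i, ?_, hd, rfl⟩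
    rw [h𝓦]; exact Submodule.subset_span ⟨i, rfl, rfl⟩

theorem freeAllowable_span
    (h𝓦 : ∀ n, 𝓦 n = Submodule.span (ZMod 2) (e '' {i | deg i = n})) (hpos : ∀ i, 1 ≤ deg i) :
    ⊤ ≤ Submodule.span (ZMod 2)
      (Set.range fun p : {p : List ℕ × ι // IsCUFor (deg p.2) p.1} =>
        QbarSeq p.1.1 • allowIncl 𝓦 (e p.1.2)) := by
  rintro t -
  set S := Submodule.span (ZMod 2)
      (Set.range fun p : {p : List ℕ × ι // IsCUFor (deg p.2) p.1} =>
        QbarSeq p.1.1 • allowIncl 𝓦 (e p.1.2))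
  refine freeAllowable_induction (p := fun t => t ∈ S) ?_ (fun a b ha hb => add_mem ha hb) t
  have h1 : ∀ (J : List ℕ) (x : W), QbarSeq J • allowIncl 𝓦 x ∈ S := by
    intro J x
    have : Submodule.span (ZMod 2) (Set.range e) ≤
        S.comap (rbarSMul _ (QbarSeq J) ∘ₗ allowIncl 𝓦) := by
      rw [Submodule.span_le]
      rintro _ ⟨i, rfl⟩
      exact Submodule.span_mono (Set.image_subset_range _ _)
        (QbarSeq_smul_allowIncl_mem_span h𝓦 hpos J i)
    rw [e.span_eq] at this
    exact this trivial
  intro r x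
  have hr : r ∈ Submodule.span (ZMod 2) (Set.range QbarSeq) := by rw [span_QbarSeq]; trivial
  induction hr using Submodule.span_induction with
  | mem r hr => obtain ⟨J, rfl⟩ := hr; exact h1 J x
  | zero => rw [zero_smul]; exact zero_mem _
  | add a b _ _ ha hb => rw [add_smul]; exact add_mem ha hb
  | smul c a _ ha => rw [zmod_smul_rbar_smul]; exact Submodule.smul_mem _ _ ha

variable (e deg) in
/-- The basis of the free allowable module on `W` attached to a homogeneous basis of `W`: the
elements `Q̄^J e_i` with `J` completely unadmissible and last term at least the degree of
`e_i`. -/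
def freeAllowableBasis
    (h𝓦 : ∀ n, 𝓦 n = Submodule.span (ZMod 2) (e '' {i | deg i = n})) (hpos : ∀ i, 1 ≤ deg i) :
    Module.Basis {p : List ℕ × ι // IsCUFor (deg p.2) p.1} (ZMod 2) (FreeAllowable 𝓦) :=
  Module.Basis.mk (freeAllowable_linearIndependent e deg h𝓦 hpos) (freeAllowable_span h𝓦 hpos)

theorem freeAllowableBasis_apply
    (h𝓦 : ∀ n, 𝓦 n = Submodule.span (ZMod 2) (e '' {i | deg i = n})) (hpos : ∀ i, 1 ≤ deg i)
    (p : {p : List ℕ × ι // IsCUFor (deg p.2) p.1}) :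
    freeAllowableBasis e deg h𝓦 hpos p = QbarSeq p.1.1 • allowIncl 𝓦 (e p.1.2) :=
  Module.Basis.mk_apply _ _ _

theorem one_le_of_isCUFor {n : ℤ} (hn : 1 ≤ n) {J : List ℕ} (h : IsCUFor n J) :
    ∀ j ∈ J, 1 ≤ j := by
  induction J with
  | nil => simp
  | cons j J ih =>
    cases J with
    | nil =>
      have := h.2
      simp at this ⊢
      omega
    | cons i J =>
      have h1 := ih ⟨h.1.tail, by simpa using h.2⟩
      have h2 : 2 * i < j := (List.isChain_cons_cons.1 h.1).1
      have h3 := h1 i (by simp)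
      intro k hk
      rcases List.mem_cons.1 hk with rfl | hk
      · omega
      · exact h1 k hk

theorem seqDeg_nonneg {J : List ℕ} (h : ∀ j ∈ J, 1 ≤ j) : 0 ≤ seqDeg J := by
  induction J with
  | nil => simp [seqDeg]
  | cons j J ih =>
    have h1 := h j (by simp)
    have h2 := ih fun i hi => h i (List.mem_cons_of_mem _ hi)
    rw [seqDeg_cons]
    omega

theorem allowGrading_eq_bot
    (h𝓦 : ∀ n, 𝓦 n = Submodule.span (ZMod 2) (e '' {i | deg i = n})) (hpos : ∀ i, 1 ≤ deg i)
    {d : ℤ} (hd : d < 1) : allowGrading 𝓦 d = ⊥ := by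
  rw [allowGrading_eq_span h𝓦 hpos, Submodule.span_eq_bot]
  rintro _ ⟨p, hp, rfl⟩
  have h1 := seqDeg_nonneg (one_le_of_isCUFor (hpos p.1.2) p.2)
  have h2 := hpos p.1.2
  simp only [Set.mem_ofPred_eq] at hp
  omega

theorem allowGrading_eq_span_basis
    (h𝓦 : ∀ n, 𝓦 n = Submodule.span (ZMod 2) (e '' {i | deg i = n})) (hpos : ∀ i, 1 ≤ deg i)
    (d : ℤ) : allowGrading 𝓦 d = Submodule.span (ZMod 2)
      (freeAllowableBasis e deg h𝓦 hpos '' {p | deg p.1.2 + seqDeg p.1.1 = d}) := by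
  rw [allowGrading_eq_span h𝓦 hpos]
  congr 2
  ext p
  rw [freeAllowableBasis_apply]

theorem isAllowable_freeAllowable
    (h𝓦 : ∀ n, 𝓦 n = Submodule.span (ZMod 2) (e '' {i | deg i = n})) (hpos : ∀ i, 1 ≤ deg i) :
    IsAllowable (allowGrading 𝓦) where
  internal := isInternal_of_basis (freeAllowableBasis e deg h𝓦 hpos)
    (fun p => deg p.1.2 + seqDeg p.1.1) (allowGrading_eq_span_basis h𝓦 hpos)
  nonneg n hn := allowGrading_eq_bot h𝓦 hpos (by omega)
  degree j n x hx := by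
    have : allowGrading 𝓦 n ≤ (allowGrading 𝓦 (n + j - 1)).comap (rbarSMul _ (Qbar j)) := by
      refine Submodule.span_le.2 ?_
      rintro _ ⟨J, m, y, hy, rfl, rfl⟩
      refine Submodule.subset_span ⟨j :: J, m, y, hy, ?_, ?_⟩
      · rw [seqDeg_cons]; ring
      · rw [rbarSMul_apply, smul_smul, QbarSeq_cons]
    exact this hx
  vanish j J n x hx hj := by
    have : allowGrading 𝓦 n ≤ LinearMap.ker (rbarSMul _ (QbarSeq (j :: J))) := by
      refine Submodule.span_le.2 ?_
      rintro _ ⟨I, m, y, hy, rfl, rfl⟩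
      rw [SetLike.mem_coe, LinearMap.mem_ker, rbarSMul_apply, smul_smul, ← QbarSeq_append,
        List.cons_append]
      refine QbarSeq_smul_allowIncl_eq_zero hy _ _ ?_
      rw [seqDeg_eq] at hj
      rw [List.sum_append, Nat.cast_add]
      omega
    exact this hx

theorem isFreeAllowable_freeAllowable.{t}
    (h𝓦 : ∀ n, 𝓦 n = Submodule.span (ZMod 2) (e '' {i | deg i = n})) (hpos : ∀ i, 1 ≤ deg i) :
    IsFreeAllowable.{t} 𝓦 (allowGrading 𝓦) (allowIncl 𝓦) where
  isAllowable := isAllowable_freeAllowable h𝓦 hpos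
  graded n x hx := Submodule.subset_span
    ⟨[], n, x, hx, by simp [seqDeg], by rw [QbarSeq_nil, one_smul]⟩
  universal E _ _ _ 𝓔 hE f hf := by
    have : IsScalarTower (ZMod 2) RBar E := ⟨fun c r x => zmod_smul_rbar_smul c r x⟩
    let Φ : RBar ⊗[ZMod 2] W →ₗ[RBar] E :=
      TensorProduct.AlgebraTensorModule.lift
        { toFun := fun r => rbarSMul E r ∘ₗ f
          map_add' := fun r s => by ext x; simp [add_smul]
          map_smul' := fun r s => by ext x; simp [mul_smul] }
    have hΦ : ∀ r x, Φ (r ⊗ₜ x) = r • f x := fun r x => rfl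
    let F : FreeAllowable 𝓦 →ₗ[RBar] E := (allowRel 𝓦).liftQ Φ (Submodule.span_le.2 (by
      rintro _ ⟨j, J, n, x, hx, hj, rfl⟩
      rw [SetLike.mem_coe, LinearMap.mem_ker, hΦ]
      exact hE.vanish j J n _ (hf n x hx) hj))
    have hF : ∀ x, F (allowIncl 𝓦 x) = f x := by
      intro x
      have : F (allowIncl 𝓦 x) = Φ (1 ⊗ₜ x) := rfl
      rw [this, hΦ, one_smul]
    have hgr : ∀ (J : List ℕ) (n : ℤ), ∀ y ∈ 𝓔 n, QbarSeq J • y ∈ 𝓔 (n + seqDeg J) := by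
      intro J n y hy
      induction J with
      | nil => simpa [seqDeg] using hy
      | cons j J ih =>
        have := hE.degree j _ _ ih
        rw [QbarSeq_cons, mul_smul, seqDeg_cons]
        convert this using 2
        ring
    refine ⟨F.toAddMonoidHom.toZModLinearMap 2, ⟨?_, fun r x => F.map_smul r x, hF⟩, ?_⟩
    · intro d x hx
      have : allowGrading 𝓦 d ≤ (𝓔 d).comap (F.toAddMonoidHom.toZModLinearMap 2) := by
        refine Submodule.span_le.2 ?_
        rintro _ ⟨J, n, y, hy, rfl, rfl⟩
        show F (QbarSeq J • allowIncl 𝓦 y) ∈ 𝓔 (n + seqDeg J)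
        rw [map_smul, hF]
        exact hgr J n _ (hf n y hy)
      exact this hx
    · rintro G ⟨-, hG, hGf⟩
      refine LinearMap.ext fun t => ?_
      show G t = F t
      refine freeAllowable_induction (p := fun t => G t = F t) ?_ ?_ t
      · intro r x
        rw [hG, hGf, map_smul, hF]
      · intro a b ha hb
        rw [map_add, map_add, ha, hb]

end FreeAllowableBasis

/-! ### Words and basic products -/

section Words

variable {β : Type*}

/-- The multiset of letters of a word. -/
def letters : FreeMagma β → Multiset β
  | .of x => {x}
  | .mul u v => letters u + letters v

@[simp] theorem letters_of (x : β) : letters (.of x) = {x} := rfl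

@[simp] theorem letters_mul (u v : FreeMagma β) : letters (u * v) = letters u + letters v := rfl

theorem card_letters (w : FreeMagma β) : Multiset.card (letters w) = w.length := by
  induction w with
  | ih1 x => rfl
  | ih2 u v hu hv => rw [letters_mul, Multiset.card_add, hu, hv]; rfl

theorem wordDeg_mul (d : β → ℤ) (u v : FreeMagma β) :
    wordDeg d (u * v) = wordDeg d u + wordDeg d v - 1 := rfl

theorem wordDeg_eq (d : β → ℤ) (w : FreeMagma β) :
    wordDeg d w = ((letters w).map d).sum - (letters w).card + 1 := by
  induction w with
  | ih1 x => simp [wordDeg]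
  | ih2 u v hu hv =>
    rw [wordDeg_mul, hu, hv, letters_mul, Multiset.map_add, Multiset.sum_add, Multiset.card_add]
    push_cast
    ring

theorem wordDeg_of_letters_eq {d : β → ℤ} {u v w : FreeMagma β}
    (h : letters w = letters u + letters v) : wordDeg d w = wordDeg d u + wordDeg d v - 1 := by
  rw [wordDeg_eq, h, ← letters_mul, ← wordDeg_eq, wordDeg_mul]

theorem one_le_wordDeg {d : β → ℤ} (hd : ∀ x, 1 ≤ d x) (w : FreeMagma β) : 1 ≤ wordDeg d w := by
  induction w with
  | ih1 x => exact hd x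
  | ih2 u v hu hv => rw [wordDeg_mul]; omega

theorem finite_letters_eq (m : Multiset β) : {w : FreeMagma β | letters w = m}.Finite := by
  classical
  induction hn : Multiset.card m using Nat.strong_induction_on generalizing m with
  | _ n ih =>
    subst hn
    have h1 : ((fun x : β => FreeMagma.of x) '' {x | x ∈ m}).Finite :=
      (Multiset.finite_toSet m).image _
    have h2 : (⋃ p ∈ {p : Multiset β × Multiset β | p ∈ Multiset.antidiagonal m ∧
        Multiset.card p.1 < Multiset.card m ∧ Multiset.card p.2 < Multiset.card m},
        Set.image2 (fun u v : FreeMagma β => u * v) {w | letters w = p.1}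
          {w | letters w = p.2}).Finite := by
      refine Set.Finite.biUnion ((Multiset.finite_toSet _).subset fun p hp => hp.1) ?_
      rintro ⟨p, q⟩ ⟨-, hp, hq⟩
      exact (ih _ hp p rfl).image2 _ (ih _ hq q rfl)
    refine (h1.union h2).subset ?_
    intro w hw
    simp only [Set.mem_ofPred_eq] at hw
    cases w with
    | of x => exact Or.inl ⟨x, by simp [← hw], rfl⟩
    | mul u v =>
      right
      have hw' : letters u + letters v = m := hw
      refine Set.mem_biUnion (x := (letters u, letters v)) ⟨Multiset.mem_antidiagonal.2 hw', ?_, ?_⟩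
        ⟨u, rfl, v, rfl, rfl⟩
      · show Multiset.card (letters u) < _
        rw [← hw', Multiset.card_add, card_letters v]
        have := v.length_pos
        omega
      · show Multiset.card (letters v) < _
        rw [← hw', Multiset.card_add, card_letters u]
        have := u.length_pos
        omega

theorem finite_letters_le (m : Multiset β) : {w : FreeMagma β | letters w ≤ m}.Finite := by
  classical
  have : {w : FreeMagma β | letters w ≤ m} =
      ⋃ p ∈ {p | p ∈ Multiset.powerset m}, {w : FreeMagma β | letters w = p} := by
    ext w
    simp
  rw [this]
  exact (Multiset.finite_toSet _).biUnion fun p _ => finite_letters_eq p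

variable [LinearOrder (FreeMagma β)]

/-- The number of words greater than `h` with letters in the multiset `m`. It is finite, and
decreases as `h` increases; this makes inductions upwards along the order possible, although the
letters may be ordered arbitrarily. -/
def wordRank (m : Multiset β) (h : FreeMagma β) : ℕ := {w | letters w ≤ m ∧ h < w}.ncard

theorem wordRank_lt {m : Multiset β} {h h' : FreeMagma β} (hlt : h < h') (hm : letters h' ≤ m) :
    wordRank m h' < wordRank m h := by
  refine Set.ncard_lt_ncard ?_ ((finite_letters_le m).subset fun w hw => hw.1)
  refine ⟨fun w hw => ⟨hw.1, hlt.trans hw.2⟩, fun hs => ?_⟩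
  exact lt_irrefl _ (hs (show h' ∈ {w | letters w ≤ m ∧ h < w} from ⟨hm, hlt⟩)).2

theorem isBasic_mul_mul {h u v : FreeMagma β} :
    IsBasic (h * (u * v)) ↔ IsBasic h ∧ IsBasic (u * v) ∧ h < u * v ∧ u ≤ h := Iff.rfl

theorem IsBasic.of_mul {u v : FreeMagma β} (h : IsBasic (u * v)) :
    IsBasic u ∧ IsBasic v ∧ u < v := by
  cases v with
  | of y => exact ⟨h.1, trivial, h.2⟩
  | mul a b => exact ⟨h.1, h.2.1, h.2.2.1⟩

/-- If `a < w` are basic, then either `a * w` is basic, or `w = u * v` with `a < u` and the Jacobi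
identity applies. -/
theorem isBasic_mul_or {a w : FreeMagma β} (ha : IsBasic a) (hw : IsBasic w) (h : a < w) :
    IsBasic (a * w) ∨ ∃ u v, w = u * v ∧ a < u := by
  cases w with
  | of y => exact Or.inl ⟨ha, h⟩
  | mul u v =>
    rcases le_or_gt u a with h' | h'
    · exact Or.inl ⟨ha, hw, h, h'⟩
    · exact Or.inr ⟨u, v, rfl, h'⟩

end Words

/-! ### Collection of basic products -/

section HallBracket

variable {β : Type*} [LinearOrder (FreeMagma β)]
variable {E : Type*} [AddCommGroup E] [Module (ZMod 2) E]

/-- A bracket `B` on `E` and elements `e w` which obey the rules of Hall collection, up to central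
error terms: `N n` is a space of elements of degree `n` annihilated by the `e w` and containing
their squares. The only properties of `B` required are those on basic products, so that the notion
covers Lie algebras, their extensions by squares, and brackets given by a recursion alone. -/
structure IsHallPattern (d : β → ℤ) (N : ℤ → Submodule (ZMod 2) E)
    (B : E →ₗ[ZMod 2] E →ₗ[ZMod 2] E) (e : FreeMagma β → E) : Prop where
  basic : ∀ a b, IsBasic (a * b) → B (e a) (e b) = e (a * b)
  square : ∀ a, IsBasic a → B (e a) (e a) ∈ N (wordDeg d a + wordDeg d a - 1)
  swap : ∀ a b, IsBasic a → IsBasic b → b < a → B (e a) (e b) = B (e b) (e a)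
  jacobi : ∀ a u v, IsBasic a → IsBasic (u * v) → a < u →
    B (e a) (e (u * v)) = B (e u) (B (e v) (e a)) + B (e v) (B (e a) (e u))
  vanish : ∀ a, IsBasic a → ∀ n, ∀ x ∈ N n, B (e a) x = 0

variable {d : β → ℤ} {N : ℤ → Submodule (ZMod 2) E} {B : E →ₗ[ZMod 2] E →ₗ[ZMod 2] E}
  {e : FreeMagma β → E}

/-- The span of the elements `e c`, where `c` is a basic product with the multiset `m` of
letters. -/
def hallSpan (e : FreeMagma β → E) (m : Multiset β) : Submodule (ZMod 2) E :=
  Submodule.span (ZMod 2) (e '' {c | IsBasic c ∧ letters c = m})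

/-- Collection: the bracket of two basic products is a combination of basic products with the same
letters, up to the error terms. The proof is by induction on the total length and on the number of
words above the smaller factor `a`: if `a * (u * v)` is not basic, then `a < u`, and the Jacobi
identity leads to brackets both of whose factors are greater than `a`. -/
theorem IsHallPattern.bracket_mem (h : IsHallPattern d N B e)
    (hord : ∀ w₁ w₂ : FreeMagma β, w₁.length < w₂.length → w₁ < w₂) (a b : FreeMagma β)
    (ha : IsBasic a) (hb : IsBasic b) :
    B (e a) (e b) ∈ hallSpan e (letters a + letters b) ⊔ N (wordDeg d a + wordDeg d b - 1) := by
  induction hn : a.length + b.length using Nat.strong_induction_on generalizing a b with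
  | _ n ihn =>
  induction hr : wordRank (letters a + letters b) (min a b) using Nat.strong_induction_on
    generalizing a b with
  | _ r ihr =>
  subst hr
  -- by symmetry it suffices to treat `a < b`
  wlog hab : a < b generalizing a b
  · rcases eq_or_lt_of_le (not_lt.1 hab) with rfl | hlt
    · exact Submodule.mem_sup_right (h.square _ ha)
    · rw [h.swap a b ha hb hlt, add_comm (letters a), add_comm (wordDeg d a)]
      refine this b a hb ha (by omega) ?_ hlt
      intro r' hr' a' b' ha' hb' h1 h2
      rw [min_comm, add_comm (letters b)] at hr'
      exact ihr r' hr' a' b' ha' hb' h1 h2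
  rcases isBasic_mul_or ha hb hab with hbas | ⟨u, v, rfl, hau⟩
  · rw [h.basic a b hbas]
    exact Submodule.mem_sup_left (Submodule.subset_span ⟨_, ⟨hbas, rfl⟩, rfl⟩)
  obtain ⟨hu, hv, huv⟩ := hb.of_mul
  rw [h.jacobi a u v ha hb hau]
  have hlen : (u * v).length = u.length + v.length := rfl
  have hapos := a.length_pos
  -- `B (e x) (B (e y) (e z))` for `{x, y, z} = {a, u, v}` and `x ≠ a`
  have key : ∀ x y z : FreeMagma β, IsBasic x → IsBasic y → IsBasic z → a < x →
      a.length < y.length + z.length →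
      letters x + (letters y + letters z) = letters a + letters (u * v) →
      B (e x) (B (e y) (e z)) ∈ hallSpan e (letters a + letters (u * v)) ⊔
        N (wordDeg d a + wordDeg d (u * v) - 1) := by
    intro x y z hx hy hz hax hlt hl
    have hl' := congrArg Multiset.card hl
    simp only [Multiset.card_add, card_letters] at hl'
    have h1 := ihn (y.length + z.length) (by have := x.length_pos; omega) y z hy hz rfl
    have hle : hallSpan e (letters y + letters z) ⊔ N (wordDeg d y + wordDeg d z - 1) ≤
        (hallSpan e (letters a + letters (u * v)) ⊔
          N (wordDeg d a + wordDeg d (u * v) - 1)).comap (B (e x)) := by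
      refine sup_le (Submodule.span_le.2 ?_) fun t ht => ?_
      · rintro _ ⟨c, ⟨hc, hcl⟩, rfl⟩
        have hcl' := congrArg Multiset.card hcl
        simp only [Multiset.card_add, card_letters] at hcl'
        have hac : a < c := hord _ _ (by omega)
        have hxc : letters x + letters c = letters a + letters (u * v) := by rw [hcl, hl]
        have hdeg : wordDeg d x + wordDeg d c - 1 = wordDeg d a + wordDeg d (u * v) - 1 := by
          rw [← wordDeg_mul, ← wordDeg_mul, wordDeg_eq, wordDeg_eq, letters_mul, letters_mul, hxc]
        have hmin : a < min x c := lt_min hax hac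
        have h2 := ihr (wordRank (letters x + letters c) (min x c)) (by
          rw [hxc, min_eq_left hab.le]
          refine wordRank_lt hmin ?_
          rw [← hxc]
          rcases min_choice x c with h | h <;> rw [h]
          · exact Multiset.le_add_right _ _
          · exact Multiset.le_add_left _ _) x c hx hc (by omega) rfl
        rw [hxc, hdeg] at h2
        exact h2
      · rw [Submodule.mem_comap, h.vanish x hx _ t ht]
        exact zero_mem _
    exact hle h1
  refine add_mem (key u v a hu hv ha hau ?_ ?_) (key v a u hv ha hu (hau.trans huv) ?_ ?_)
  · have := v.length_pos; omega
  · rw [letters_mul]; abel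
  · have := u.length_pos; omega
  · rw [letters_mul]; abel

end HallBracket

/-! ### Basic products acting on nondecreasing lists of basic products -/

section HallAction

open Filter

variable {β : Type*}

/-- The multiset of all letters in a list of words. -/
def listLetters (m : List (FreeMagma β)) : Multiset β := (m.map letters).sum

@[simp] theorem listLetters_cons (w : FreeMagma β) (m : List (FreeMagma β)) :
    listLetters (w :: m) = letters w + listLetters m := by
  simp [listLetters]

/-- Prepending the word `h` to lists, extended linearly. -/
def consWord (h : FreeMagma β) :
    (List (FreeMagma β) →₀ ZMod 2) →ₗ[ZMod 2] (List (FreeMagma β) →₀ ZMod 2) :=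
  Finsupp.lmapDomain _ _ (h :: ·)

/-- The linear extension of a function on lists. -/
def extendLists (f : List (FreeMagma β) → (List (FreeMagma β) →₀ ZMod 2)) :
    (List (FreeMagma β) →₀ ZMod 2) →ₗ[ZMod 2] (List (FreeMagma β) →₀ ZMod 2) :=
  Finsupp.linearCombination (ZMod 2) f

theorem extendLists_mem {f : List (FreeMagma β) → (List (FreeMagma β) →₀ ZMod 2)}
    {s t : Set (List (FreeMagma β))} {x : List (FreeMagma β) →₀ ZMod 2}
    (hx : x ∈ Finsupp.supported (ZMod 2) (ZMod 2) s)
    (h : ∀ m ∈ s, f m ∈ Finsupp.supported (ZMod 2) (ZMod 2) t) :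
    extendLists f x ∈ Finsupp.supported (ZMod 2) (ZMod 2) t := by
  rw [extendLists, Finsupp.linearCombination_apply]
  exact sum_mem fun m hm => Submodule.smul_mem _ _ (h m (hx hm))

theorem extendLists_congr {f g : List (FreeMagma β) → (List (FreeMagma β) →₀ ZMod 2)}
    {x : List (FreeMagma β) →₀ ZMod 2} (h : ∀ m ∈ x.support, f m = g m) :
    extendLists f x = extendLists g x := by
  rw [extendLists, extendLists, Finsupp.linearCombination_apply, Finsupp.linearCombination_apply]
  exact Finsupp.sum_congr fun m hm => by rw [h m hm]

theorem extendLists_single (f : List (FreeMagma β) → (List (FreeMagma β) →₀ ZMod 2))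
    (m : List (FreeMagma β)) : extendLists f (Finsupp.single m 1) = f m := by
  rw [extendLists, Finsupp.linearCombination_single, one_smul]

/-- The action of `u * v` as the commutator of the actions `f` of its factors. -/
def actFactors (f : FreeMagma β → List (FreeMagma β) → (List (FreeMagma β) →₀ ZMod 2))
    (m : List (FreeMagma β)) : FreeMagma β → (List (FreeMagma β) →₀ ZMod 2)
  | .of _ => 0
  | .mul u v => extendLists (f u) (f v m) + extendLists (f v) (f u m)

variable [LinearOrder (FreeMagma β)]

open Classical in
/-- The action of a word on lists, with recursion depth bounded by the first argument. A list
stands for the product of its entries in the associative algebra. The word `w` is prepended if the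
list stays nondecreasing; otherwise it is moved past the head `h`, at the cost of the commutator
`h * w` if this is basic, and is replaced by the commutator of its two factors if it is not. -/
def actFuel : ℕ → FreeMagma β → List (FreeMagma β) → (List (FreeMagma β) →₀ ZMod 2)
  | 0, _, _ => 0
  | _ + 1, w, [] => Finsupp.single [w] 1
  | k + 1, w, h :: m =>
    if w ≤ h then Finsupp.single (w :: h :: m) 1
    else if IsBasic (h * w) then consWord h (actFuel k w m) + actFuel k (h * w) m
    else actFactors (actFuel k) (h :: m) w

/-- The eventual value of `actFuel` as the bound on the depth grows (arbitrary if there is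
none). -/
def hallAct (w : FreeMagma β) (m : List (FreeMagma β)) : List (FreeMagma β) →₀ ZMod 2 :=
  Classical.epsilon fun x => ∀ᶠ k in atTop, actFuel k w m = x

/-- The recursion for the action of `w` on `m` terminates. -/
def IsStable (w : FreeMagma β) (m : List (FreeMagma β)) : Prop :=
  ∀ᶠ k in atTop, actFuel k w m = hallAct w m

theorem eventually_eq_of_stable {w : FreeMagma β} {m : List (FreeMagma β)}
    {x : List (FreeMagma β) →₀ ZMod 2} (h : ∀ᶠ k in atTop, actFuel k w m = x) :
    IsStable w m ∧ hallAct w m = x := by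
  have h1 : IsStable w m :=
    Classical.epsilon_spec (p := fun x => ∀ᶠ k in atTop, actFuel k w m = x) ⟨x, h⟩
  refine ⟨h1, ?_⟩
  obtain ⟨k, hk1, hk2⟩ := (h.and h1).exists
  rw [← hk1, ← hk2]

/-- Nondecreasing lists of basic products; as products in the associative algebra these are the
monomials of the Poincaré-Birkhoff-Witt basis. -/
def IsHallList (m : List (FreeMagma β)) : Prop :=
  m.Pairwise (· ≤ ·) ∧ ∀ w ∈ m, IsBasic w

open Classical in
/-- Conditions on the lists `m'` which may occur in the action of `w` on `m`. The bounds on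
entries and on multiplicities of small words are what makes the recursion terminate. -/
structure IsActSupport (w : FreeMagma β) (m m' : List (FreeMagma β)) : Prop where
  hall : IsHallList m'
  letters_eq : listLetters m' = letters w + listLetters m
  le : ∀ h, h ≤ w → (∀ y ∈ m, h ≤ y) → ∀ y ∈ m', h ≤ y
  count : ∀ h, h < w → (∀ y ∈ m, h ≤ y) → m'.count h ≤ m.count h

variable (hord : ∀ w₁ w₂ : FreeMagma β, w₁.length < w₂.length → w₁ < w₂)

theorem isActSupport_cons {w : FreeMagma β} {m : List (FreeMagma β)} (hw : IsBasic w)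
    (hm : IsHallList m) (hle : ∀ y ∈ m, w ≤ y) : IsActSupport w m (w :: m) where
  hall := ⟨List.pairwise_cons.2 ⟨hle, hm.1⟩, by
    intro y hy
    rcases List.mem_cons.1 hy with rfl | hy
    exacts [hw, hm.2 y hy]⟩
  letters_eq := listLetters_cons w m
  le h hh hhm y hy := by
    rcases List.mem_cons.1 hy with rfl | hy
    exacts [hh, hhm y hy]
  count h hh hhm := by
    classical
    rw [List.count_cons_of_ne hh.ne']

theorem IsActSupport.cons {w h : FreeMagma β} {m m' : List (FreeMagma β)}
    (hm : IsHallList (h :: m)) (hw : h < w) (hs : IsActSupport w m m') :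
    IsActSupport w (h :: m) (h :: m') where
  hall := ⟨List.pairwise_cons.2 ⟨hs.le h hw.le (List.pairwise_cons.1 hm.1).1, hs.hall.1⟩, by
    intro y hy
    rcases List.mem_cons.1 hy with rfl | hy
    exacts [hm.2 _ List.mem_cons_self, hs.hall.2 y hy]⟩
  letters_eq := by
    rw [listLetters_cons, listLetters_cons, hs.letters_eq]; abel
  le g hg hgm y hy := by
    rcases List.mem_cons.1 hy with rfl | hy
    · exact hgm _ List.mem_cons_self
    · exact hs.le g hg (fun z hz => hgm z (List.mem_cons_of_mem _ hz)) y hy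
  count g hg hgm := by
    classical
    have := hs.count g hg (fun z hz => hgm z (List.mem_cons_of_mem _ hz))
    rw [List.count_cons, List.count_cons]
    omega

include hord in
theorem lt_mul_left (u v : FreeMagma β) : u < u * v :=
  hord _ _ (by show _ < u.length + v.length; have := v.length_pos; omega)

include hord in
theorem lt_mul_right (u v : FreeMagma β) : v < u * v :=
  hord _ _ (by show _ < u.length + v.length; have := u.length_pos; omega)

include hord in
/-- The terms in the action of the commutator `h * w` on `m` may occur in the action of `w` on
`h :: m`. -/
theorem IsActSupport.absorb {w h : FreeMagma β} {m m' : List (FreeMagma β)}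
    (hs : IsActSupport (h * w) m m') : IsActSupport w (h :: m) m' where
  hall := hs.hall
  letters_eq := by rw [hs.letters_eq, listLetters_cons, letters_mul]; abel
  le g hg hgm := hs.le g (hg.trans (lt_mul_right hord h w).le)
    fun z hz => hgm z (List.mem_cons_of_mem _ hz)
  count g hg hgm := by
    classical
    have := hs.count g (hg.trans (lt_mul_right hord h w))
      (fun z hz => hgm z (List.mem_cons_of_mem _ hz))
    rw [List.count_cons]
    omega

theorem IsActSupport.comp {u v h : FreeMagma β} {m m' m'' : List (FreeMagma β)}
    (hu : h < u) (hv : h < v) (h1 : IsActSupport v (h :: m) m') (h2 : IsActSupport u m' m'') :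
    IsActSupport (u * v) (h :: m) m'' where
  hall := h2.hall
  letters_eq := by rw [h2.letters_eq, h1.letters_eq, letters_mul]; abel
  le g _ hgm := by
    have hgh := hgm h List.mem_cons_self
    exact h2.le g (hgh.trans hu.le) (h1.le g (hgh.trans hv.le) hgm)
  count g _ hgm := by
    have hgh := hgm h List.mem_cons_self
    exact (h2.count g (hgh.trans_lt hu) (h1.le g (hgh.trans hv.le) hgm)).trans
      (h1.count g (hgh.trans_lt hv) hgm)

/-- The number of words above the head of the list, within the multiset `L` of letters. -/
def headRank (L : Multiset β) : List (FreeMagma β) → ℕ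
  | [] => 0
  | h :: _ => wordRank L h

open Classical in
/-- The multiplicity of the head in the list. -/
def headCount : List (FreeMagma β) → ℕ
  | [] => 0
  | h :: m => (h :: m).count h

/-- The measure for termination, in lexicographic order: the total number of letters, the number
of words above the head of the list, the multiplicity of the head, and the length of the acting
word. -/
def actMeasure (w : FreeMagma β) (m : List (FreeMagma β)) : ℕ ×ₗ ℕ ×ₗ ℕ ×ₗ ℕ :=
  toLex (Multiset.card (letters w + listLetters m), toLex (headRank (letters w + listLetters m) m,
    toLex (headCount m, w.length)))

open Classical in
theorem actMeasure_lt {w w' h : FreeMagma β} {m m' : List (FreeMagma β)}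
    (hL : letters w' + listLetters m' = letters w + listLetters (h :: m))
    (hle : ∀ y ∈ m', h ≤ y) (hc : m'.count h < (h :: m).count h ∨
      m'.count h ≤ (h :: m).count h ∧ w'.length < w.length) :
    actMeasure w' m' < actMeasure w (h :: m) := by
  rw [actMeasure, actMeasure, hL]
  refine Prod.Lex.toLex_lt_toLex.2 (Or.inr ⟨rfl, Prod.Lex.toLex_lt_toLex.2 ?_⟩)
  have hcase : ∀ c : ℕ, (c < (h :: m).count h ∨ c ≤ (h :: m).count h ∧ w'.length < w.length) →
      toLex (c, w'.length) < toLex (headCount (h :: m), w.length) := by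
    intro c hc
    rw [Prod.Lex.toLex_lt_toLex]
    simp only [headCount]
    omega
  cases m' with
  | nil =>
    rcases Nat.eq_zero_or_pos (headRank (letters w + listLetters (h :: m)) (h :: m)) with h0 | h0
    · exact Or.inr ⟨h0.symm, hcase 0 (by simp)⟩
    · exact Or.inl h0
  | cons g m' =>
    rcases eq_or_lt_of_le (hle g List.mem_cons_self) with rfl | hlt
    · exact Or.inr ⟨rfl, hcase _ hc⟩
    · refine Or.inl (wordRank_lt hlt ?_)
      show letters g ≤ letters w + listLetters (h :: m)
      rw [← hL, listLetters_cons]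
      exact (Multiset.le_add_right _ _).trans (Multiset.le_add_left _ _)

theorem actMeasure_lt_of_card {w w' : FreeMagma β} {m m' : List (FreeMagma β)}
    (h : Multiset.card (letters w' + listLetters m') < Multiset.card (letters w + listLetters m)) :
    actMeasure w' m' < actMeasure w m :=
  Prod.Lex.toLex_lt_toLex.2 (Or.inl h)

theorem hallAct_nil (w : FreeMagma β) :
    IsStable w [] ∧ hallAct w [] = Finsupp.single [w] 1 := by
  refine eventually_eq_of_stable ?_
  filter_upwards [eventually_ge_atTop 1] with k hk
  obtain ⟨k, rfl⟩ : ∃ l, k = l + 1 := ⟨k - 1, by omega⟩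
  rw [actFuel]

theorem hallAct_cons_of_le {w h : FreeMagma β} (hwh : w ≤ h) (m : List (FreeMagma β)) :
    IsStable w (h :: m) ∧ hallAct w (h :: m) = Finsupp.single (w :: h :: m) 1 := by
  refine eventually_eq_of_stable ?_
  filter_upwards [eventually_ge_atTop 1] with k hk
  obtain ⟨k, rfl⟩ : ∃ l, k = l + 1 := ⟨k - 1, by omega⟩
  rw [actFuel, if_pos hwh]

theorem hallAct_cons_of_isBasic {w h : FreeMagma β} (hb : IsBasic (h * w))
    {m : List (FreeMagma β)} (h1 : IsStable w m) (h2 : IsStable (h * w) m) :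
    IsStable w (h :: m) ∧ hallAct w (h :: m) = consWord h (hallAct w m) + hallAct (h * w) m := by
  refine eventually_eq_of_stable ?_
  have h1' := (tendsto_sub_atTop_nat 1).eventually h1
  have h2' := (tendsto_sub_atTop_nat 1).eventually h2
  filter_upwards [eventually_ge_atTop 1, h1', h2'] with k hk hk1 hk2
  obtain ⟨k, rfl⟩ : ∃ l, k = l + 1 := ⟨k - 1, by omega⟩
  rw [Nat.add_sub_cancel] at hk1 hk2
  rw [actFuel, if_neg (not_le.2 hb.of_mul.2.2), if_pos hb, hk1, hk2]

theorem hallAct_cons_of_lt {u v h : FreeMagma β} (hlt : h < u * v) (hb : ¬ IsBasic (h * (u * v)))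
    {m : List (FreeMagma β)} (h1 : IsStable v (h :: m)) (h2 : IsStable u (h :: m))
    (h3 : ∀ m' ∈ (hallAct v (h :: m)).support, IsStable u m')
    (h4 : ∀ m' ∈ (hallAct u (h :: m)).support, IsStable v m') :
    IsStable (u * v) (h :: m) ∧ hallAct (u * v) (h :: m) =
      extendLists (hallAct u) (hallAct v (h :: m)) +
        extendLists (hallAct v) (hallAct u (h :: m)) := by
  refine eventually_eq_of_stable ?_
  have h1' := (tendsto_sub_atTop_nat 1).eventually h1
  have h2' := (tendsto_sub_atTop_nat 1).eventually h2
  have h3' := (tendsto_sub_atTop_nat 1).eventually ((Filter.eventually_all_finset _).2 h3)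
  have h4' := (tendsto_sub_atTop_nat 1).eventually ((Filter.eventually_all_finset _).2 h4)
  filter_upwards [eventually_ge_atTop 1, h1', h2', h3', h4'] with k hk hk1 hk2 hk3 hk4
  obtain ⟨k, rfl⟩ : ∃ l, k = l + 1 := ⟨k - 1, by omega⟩
  rw [Nat.add_sub_cancel] at hk1 hk2 hk3 hk4
  rw [actFuel, if_neg (not_le.2 hlt), if_neg hb]
  show extendLists (actFuel k u) (actFuel k v (h :: m)) +
          extendLists (actFuel k v) (actFuel k u (h :: m)) = _
  rw [hk1, hk2, extendLists_congr hk3, extendLists_congr hk4]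

include hord in
/-- The recursion terminates on nondecreasing lists of basic products, and yields such lists
again. -/
theorem hallAct_spec (w : FreeMagma β) (m : List (FreeMagma β)) (hw : IsBasic w)
    (hm : IsHallList m) : IsStable w m ∧
      hallAct w m ∈ Finsupp.supported (ZMod 2) (ZMod 2) {m' | IsActSupport w m m'} := by
  classical
  induction hμ : actMeasure w m using WellFoundedLT.induction generalizing w m with
  | _ μ ih =>
  subst hμ
  cases m with
  | nil =>
    obtain ⟨h1, h2⟩ := hallAct_nil w
    refine ⟨h1, ?_⟩
    rw [h2]
    exact Finsupp.single_mem_supported _ _ (isActSupport_cons hw hm (by simp))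
  | cons h m =>
    have hm' : IsHallList m :=
      ⟨(List.pairwise_cons.1 hm.1).2, fun y hy => hm.2 y (List.mem_cons_of_mem _ hy)⟩
    have hhm := (List.pairwise_cons.1 hm.1).1
    have hhm' : ∀ y ∈ h :: m, h ≤ y := by
      intro y hy
      rcases List.mem_cons.1 hy with rfl | hy
      exacts [le_rfl, hhm y hy]
    have hh : IsBasic h := hm.2 h List.mem_cons_self
    rcases le_or_gt w h with hwh | hwh
    · obtain ⟨h1, h2⟩ := hallAct_cons_of_le hwh m
      refine ⟨h1, ?_⟩
      rw [h2]
      exact Finsupp.single_mem_supported _ _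
        (isActSupport_cons hw hm fun y hy => hwh.trans (hhm' y hy))
    by_cases hb : IsBasic (h * w)
    · obtain ⟨s1, t1⟩ := ih _ (actMeasure_lt_of_card (by
        simp only [listLetters_cons, Multiset.card_add, card_letters]
        have := h.length_pos
        omega)) w m hw hm' rfl
      obtain ⟨s2, t2⟩ := ih _ (actMeasure_lt (w := w) (h := h) (m := m) (w' := h * w) (m' := m)
        (by rw [listLetters_cons, letters_mul]; abel) hhm (Or.inl (by simp))) (h * w) m hb hm' rfl
      obtain ⟨h1, h2⟩ := hallAct_cons_of_isBasic hb s1 s2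
      refine ⟨h1, ?_⟩
      rw [h2]
      refine add_mem ?_ (Finsupp.supported_mono (fun m' h' => h'.absorb hord) t2)
      have : hallAct w m ∈ (Finsupp.supported (ZMod 2) (ZMod 2)
          {m' | IsActSupport w (h :: m) m'}).comap (consWord h) := by
        rw [Finsupp.supported_eq_span_single] at t1
        refine Submodule.span_le.2 ?_ t1
        rintro _ ⟨m', h', rfl⟩
        show consWord h (Finsupp.single m' 1) ∈ Finsupp.supported (ZMod 2) (ZMod 2)
          {m' | IsActSupport w (h :: m) m'}
        rw [consWord, Finsupp.lmapDomain_apply, Finsupp.mapDomain_single]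
        exact Finsupp.single_mem_supported _ _ (IsActSupport.cons hm hwh h')
      exact this
    · rcases isBasic_mul_or hh hw hwh with h' | ⟨u, v, rfl, hu⟩
      · exact absurd h' hb
      obtain ⟨bu, bv, huv⟩ := hw.of_mul
      have hv := hu.trans huv
      have hul := u.length_pos
      have hvl := v.length_pos
      obtain ⟨s1, t1⟩ := ih _ (actMeasure_lt_of_card (by
        simp only [listLetters_cons, Multiset.card_add, card_letters, letters_mul]
        omega)) v (h :: m) bv hm rfl
      obtain ⟨s2, t2⟩ := ih _ (actMeasure_lt_of_card (by
        simp only [listLetters_cons, Multiset.card_add, card_letters, letters_mul]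
        omega)) u (h :: m) bu hm rfl
      have r1 : ∀ m' ∈ {m' | IsActSupport v (h :: m) m'}, IsStable u m' ∧
          hallAct u m' ∈ Finsupp.supported (ZMod 2) (ZMod 2)
            {m' | IsActSupport (u * v) (h :: m) m'} := by
        intro m' h'
        obtain ⟨s, t⟩ := ih _ (actMeasure_lt (w := u * v) (h := h) (m := m) (w' := u) (m' := m')
          (by rw [h'.letters_eq, letters_mul]; abel) (h'.le h hv.le hhm')
          (Or.inr ⟨h'.count h hv hhm', by
            show _ < u.length + v.length
            omega⟩)) u m' bu h'.hall rfl
        exact ⟨s, Finsupp.supported_mono (fun m'' h'' => IsActSupport.comp hu hv h' h'') t⟩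
      have r2 : ∀ m' ∈ {m' | IsActSupport u (h :: m) m'}, IsStable v m' ∧
          hallAct v m' ∈ Finsupp.supported (ZMod 2) (ZMod 2)
            {m' | IsActSupport (u * v) (h :: m) m'} := by
        intro m' h'
        obtain ⟨s, t⟩ := ih _ (actMeasure_lt (w := u * v) (h := h) (m := m) (w' := v) (m' := m')
          (by rw [h'.letters_eq, letters_mul]; abel) (h'.le h hu.le hhm')
          (Or.inr ⟨h'.count h hu hhm', by
            show _ < u.length + v.length
            omega⟩)) v m' bv h'.hall rfl
        refine ⟨s, Finsupp.supported_mono (fun m'' h'' => ?_) t⟩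
        have := IsActSupport.comp hv hu h' h''
        exact ⟨this.hall, by rw [this.letters_eq, letters_mul, letters_mul]; abel,
          fun g _ hgm => this.le g ((hgm h List.mem_cons_self).trans
            (hu.trans (lt_mul_right hord v u)).le) hgm,
          fun g _ hgm => this.count g ((hgm h List.mem_cons_self).trans_lt
            (hu.trans (lt_mul_right hord v u))) hgm⟩
      obtain ⟨h1, h2⟩ := hallAct_cons_of_lt hwh hb s1 s2 (fun m' h' => (r1 m' (t1 h')).1)
        (fun m' h' => (r2 m' (t2 h')).1)
      refine ⟨h1, ?_⟩
      rw [h2]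
      exact add_mem (extendLists_mem t1 fun m' h' => (r1 m' h').2)
        (extendLists_mem t2 fun m' h' => (r2 m' h').2)

/-- The action of a word as a linear operator. -/
def hallOp (w : FreeMagma β) :
    (List (FreeMagma β) →₀ ZMod 2) →ₗ[ZMod 2] (List (FreeMagma β) →₀ ZMod 2) :=
  extendLists (hallAct w)

theorem hallOp_single (w : FreeMagma β) (m : List (FreeMagma β)) :
    hallOp w (Finsupp.single m 1) = hallAct w m := extendLists_single _ _

include hord in
theorem hallOp_mem {w : FreeMagma β} (hw : IsBasic w) {x : List (FreeMagma β) →₀ ZMod 2}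
    (hx : x ∈ Finsupp.supported (ZMod 2) (ZMod 2) {m | IsHallList m}) :
    hallOp w x ∈ Finsupp.supported (ZMod 2) (ZMod 2) {m | IsHallList m} :=
  extendLists_mem hx fun m hm =>
    Finsupp.supported_mono (fun _ h => h.hall) (hallAct_spec hord w m hw hm).2

theorem consWord_eq_hallOp {u : FreeMagma β} {x : List (FreeMagma β) →₀ ZMod 2}
    (hx : x ∈ Finsupp.supported (ZMod 2) (ZMod 2) {m | ∀ y ∈ m, u ≤ y}) :
    hallOp u x = consWord u x := by
  rw [Finsupp.supported_eq_span_single] at hx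
  have : Submodule.span (ZMod 2) ((fun i => Finsupp.single i (1 : ZMod 2)) ''
      {m : List (FreeMagma β) | ∀ y ∈ m, u ≤ y}) ≤ LinearMap.eqLocus (hallOp u) (consWord u) := by
    refine Submodule.span_le.2 ?_
    rintro _ ⟨m, hm, rfl⟩
    show hallOp u (Finsupp.single m 1) = consWord u (Finsupp.single m 1)
    rw [hallOp_single, consWord, Finsupp.lmapDomain_apply, Finsupp.mapDomain_single]
    cases m with
    | nil => exact (hallAct_nil u).2
    | cons h m => exact (hallAct_cons_of_le (hm h List.mem_cons_self) m).2
  exact this hx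

include hord in
/-- The operator of a basic product `u * v` is the commutator of those of `u` and `v`. On a list
whose head is at least `u` this is the rule for moving `v` past `u`, and on other lists it is the
last rule of the recursion. -/
theorem hallOp_mul {u v : FreeMagma β} (huv : IsBasic (u * v))
    {x : List (FreeMagma β) →₀ ZMod 2}
    (hx : x ∈ Finsupp.supported (ZMod 2) (ZMod 2) {m | IsHallList m}) :
    hallOp (u * v) x = hallOp u (hallOp v x) + hallOp v (hallOp u x) := by
  obtain ⟨hu, hv, hlt⟩ := huv.of_mul
  have hsing : ∀ m, IsHallList m → hallAct (u * v) m =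
      hallOp u (hallAct v m) + hallOp v (hallAct u m) := by
    intro m hm
    by_cases hcase : ∀ y ∈ m, u ≤ y
    · have e1 : hallAct u m = Finsupp.single (u :: m) 1 := by
        rw [← hallOp_single, consWord_eq_hallOp (Finsupp.single_mem_supported _ _ hcase), consWord,
          Finsupp.lmapDomain_apply, Finsupp.mapDomain_single]
      have e2 : hallAct v (u :: m) = consWord u (hallAct v m) + hallAct (u * v) m :=
        (hallAct_cons_of_isBasic huv (hallAct_spec hord v m hv hm).1
          (hallAct_spec hord (u * v) m huv hm).1).2
      have e3 : hallOp u (hallAct v m) = consWord u (hallAct v m) :=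
        consWord_eq_hallOp (Finsupp.supported_mono (fun m' h' => h'.le u hlt.le hcase)
          (hallAct_spec hord v m hv hm).2)
      rw [e1, hallOp_single, e2, e3, ← add_assoc, ZModModule.add_self, zero_add]
    · cases m with
      | nil => simp at hcase
      | cons h m =>
        have hh : h < u := by
          by_contra hle
          refine hcase fun y hy => ?_
          rcases List.mem_cons.1 hy with rfl | hy
          · exact not_lt.1 hle
          · exact (not_lt.1 hle).trans ((List.pairwise_cons.1 hm.1).1 y hy)
        refine (hallAct_cons_of_lt (hh.trans (lt_mul_left hord u v)) ?_
          (hallAct_spec hord v _ hv hm).1 (hallAct_spec hord u _ hu hm).1 ?_ ?_).2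
        · intro hb
          exact absurd (isBasic_mul_mul.1 hb).2.2.2 (not_le.2 hh)
        · exact fun m' h' => (hallAct_spec hord u m' hu ((hallAct_spec hord v _ hv hm).2 h').hall).1
        · exact fun m' h' => (hallAct_spec hord v m' hv ((hallAct_spec hord u _ hu hm).2 h').hall).1
  rw [Finsupp.supported_eq_span_single] at hx
  have : Submodule.span (ZMod 2) ((fun i => Finsupp.single i (1 : ZMod 2)) ''
      {m : List (FreeMagma β) | IsHallList m}) ≤ LinearMap.eqLocus (hallOp (u * v))
        (hallOp u ∘ₗ hallOp v + hallOp v ∘ₗ hallOp u) := by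
    refine Submodule.span_le.2 ?_
    rintro _ ⟨m, hm, rfl⟩
    show hallOp (u * v) (Finsupp.single m 1) = hallOp u (hallOp v (Finsupp.single m 1)) +
      hallOp v (hallOp u (Finsupp.single m 1))
    rw [hallOp_single, hallOp_single, hallOp_single]
    exact hsing m hm
  exact this hx

end HallAction

/-! ### The universal property of the free Lie algebra on a vector space -/

section LieLift

variable {V : Type*} [AddCommGroup V] [Module (ZMod 2) V]
variable {E : Type*} [LieRing E] [LieAlgebra (ZMod 2) E]

theorem lift_eq_zero_of_mem_linIdeal (f : V →ₗ[ZMod 2] E) {x : FreeLieAlgebra (ZMod 2) V}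
    (hx : x ∈ linIdeal V) : FreeLieAlgebra.lift (ZMod 2) f x = 0 := by
  have : linIdeal V ≤ (FreeLieAlgebra.lift (ZMod 2) (f : V → E)).ker := by
    refine LieSubmodule.lieSpan_le.2 ?_
    rintro _ (⟨a, b, rfl⟩ | ⟨c, a, rfl⟩) <;> simp
  exact LieHom.mem_ker.1 (this hx)

/-- The homomorphism of Lie algebras extending a linear map `f` on `V`. -/
def lieLift (f : V →ₗ[ZMod 2] E) : FreeSLieTi V →ₗ⁅ZMod 2⁆ E :=
  { (linIdeal V).toSubmodule.liftQ (FreeLieAlgebra.lift (ZMod 2) (f : V → E)).toLinearMap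
      (fun _ hx => lift_eq_zero_of_mem_linIdeal f hx) with
    map_lie' := by
      intro x y
      obtain ⟨x, rfl⟩ := LieSubmodule.Quotient.surjective_mk' _ x
      obtain ⟨y, rfl⟩ := LieSubmodule.Quotient.surjective_mk' _ y
      exact (FreeLieAlgebra.lift (ZMod 2) (f : V → E)).map_lie x y }

@[simp] theorem lieLift_lieIncl (f : V →ₗ[ZMod 2] E) (v : V) : lieLift f (lieIncl V v) = f v :=
  FreeLieAlgebra.lift_of_apply f v

/-- The free algebra is generated by `V`. -/
theorem freeSLieTi_mem {S : LieSubalgebra (ZMod 2) (FreeSLieTi V)} (h : ∀ v, lieIncl V v ∈ S)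
    (x : FreeSLieTi V) : x ∈ S := by
  obtain ⟨x, rfl⟩ := LieSubmodule.Quotient.surjective_mk' _ x
  let π : FreeLieAlgebra (ZMod 2) V →ₗ⁅ZMod 2⁆ FreeSLieTi V :=
    { (linIdeal V).toSubmodule.mkQ with map_lie' := fun {x y} => rfl }
  have : π = S.incl.comp (FreeLieAlgebra.lift (ZMod 2) fun v => (⟨lieIncl V v, h v⟩ : S)) := by
    refine FreeLieAlgebra.hom_ext fun v => ?_
    rw [LieHom.comp_apply, FreeLieAlgebra.lift_of_apply]
    rfl
  have h2 := congrArg (fun g => g x) this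
  have h3 : π x = (linIdeal V).toSubmodule.mkQ x := rfl
  show (linIdeal V).toSubmodule.mkQ x ∈ S
  rw [← h3, this]
  exact Subtype.prop _

end LieLift

/-! ### The Hall basis of the free totally isotropic shifted Lie algebra -/

section HallBasis

variable {V : Type*} [AddCommGroup V] [Module (ZMod 2) V] {β : Type*}

@[simp] theorem lieBracket_apply (x y : FreeSLieTi V) : lieBracket V x y = ⁅x, y⁆ := rfl

theorem lieBracket_symm (x y : FreeSLieTi V) : ⁅x, y⁆ = ⁅y, x⁆ := by
  rw [← lie_skew, ZModModule.neg_eq_self]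

theorem evalWord_mul (b : β → V) (u v : FreeMagma β) :
    evalWord b (u * v) = ⁅evalWord b u, evalWord b v⁆ := rfl

theorem isLieMonomial_evalWord {𝓥 : ℤ → Submodule (ZMod 2) V} {b : β → V} {d : β → ℤ}
    (hb : ∀ x : β, b x ∈ 𝓥 (d x)) (w : FreeMagma β) :
    IsLieMonomial 𝓥 (wordDeg d w) (evalWord b w) := by
  induction w with
  | ih1 x => exact IsLieMonomial.incl _ _ (hb x)
  | ih2 u v hu hv => exact IsLieMonomial.bracket _ _ _ _ hu hv

variable [LinearOrder (FreeMagma β)]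
variable (hord : ∀ w₁ w₂ : FreeMagma β, w₁.length < w₂.length → w₁ < w₂)

theorem isHallPattern_evalWord (b : β → V) (d : β → ℤ) :
    IsHallPattern d (fun _ => ⊥) (lieBracket V) (evalWord b) where
  basic _ _ _ := rfl
  square a _ := by rw [lieBracket_apply, lie_self]; exact zero_mem _
  swap a c _ _ _ := lieBracket_symm _ _
  jacobi a u v _ _ _ := by
    simp only [lieBracket_apply, evalWord_mul]
    rw [lieBracket_symm (evalWord b v) (evalWord b a), leibniz_lie (evalWord b a),
      lieBracket_symm _ (evalWord b v), add_comm]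
  vanish a _ n x hx := by
    rw [(Submodule.mem_bot (ZMod 2)).1 hx, map_zero]

include hord in
theorem lie_evalWord_mem (b : β → V) {u v : FreeMagma β} (hu : IsBasic u) (hv : IsBasic v) :
    ⁅evalWord b u, evalWord b v⁆ ∈ hallSpan (evalWord b) (letters u + letters v) := by
  have := (isHallPattern_evalWord b (fun _ => 0)).bracket_mem hord u v hu hv
  rwa [sup_bot_eq] at this

include hord in
theorem span_evalWord (b : Module.Basis β (ZMod 2) V) :
    ⊤ ≤ Submodule.span (ZMod 2) (Set.range fun w : {w : FreeMagma β // IsBasic w} =>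
      evalWord b w.1) := by
  set S := Submodule.span (ZMod 2) (Set.range fun w : {w : FreeMagma β // IsBasic w} =>
      evalWord b w.1)
  have hle : ∀ m, hallSpan (evalWord b) m ≤ S := fun m => Submodule.span_mono (by
    rintro _ ⟨c, hc, rfl⟩
    exact ⟨⟨c, hc.1⟩, rfl⟩)
  let S' : LieSubalgebra (ZMod 2) (FreeSLieTi V) :=
    { S with
      lie_mem' := by
        intro x y hx hy
        refine Submodule.span_induction₂ (p := fun x y _ _ => ⁅x, y⁆ ∈ S) ?_ ?_ ?_ ?_ ?_ ?_ ?_ hx hy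
        · rintro _ _ ⟨u, rfl⟩ ⟨v, rfl⟩
          exact hle _ (lie_evalWord_mem hord b u.2 v.2)
        · intro y _; rw [zero_lie]; exact zero_mem _
        · intro y _; rw [lie_zero]; exact zero_mem _
        · intro x y z _ _ _ h1 h2; rw [add_lie]; exact add_mem h1 h2
        · intro x y z _ _ _ h1 h2; rw [lie_add]; exact add_mem h1 h2
        · intro c x y _ _ h; rw [smul_lie]; exact Submodule.smul_mem _ _ h
        · intro c x y _ _ h; rw [lie_smul]; exact Submodule.smul_mem _ _ h }
  rintro x -
  refine freeSLieTi_mem (S := S') ?_ x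
  intro v
  have : Submodule.span (ZMod 2) (Set.range b) ≤ S.comap (lieIncl V) := by
    rw [Submodule.span_le]
    rintro _ ⟨x, rfl⟩
    exact Submodule.subset_span ⟨⟨.of x, trivial⟩, rfl⟩
  rw [b.span_eq] at this
  exact this trivial

attribute [local instance] LieRing.ofAssociativeRing

/-- The representation of the free Lie algebra on lists of words for which the letters act by
`hallOp`. -/
def hallRep (b : Module.Basis β (ZMod 2) V) :
    FreeSLieTi V →ₗ⁅ZMod 2⁆ Module.End (ZMod 2) (List (FreeMagma β) →₀ ZMod 2) :=
  lieLift (b.constr (ZMod 2) fun x => hallOp (.of x))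

theorem hallRep_lie (b : Module.Basis β (ZMod 2) V) (x y : FreeSLieTi V)
    (m : List (FreeMagma β) →₀ ZMod 2) :
    hallRep b ⁅x, y⁆ m = hallRep b x (hallRep b y m) + hallRep b y (hallRep b x m) := by
  rw [LieHom.map_lie, LieRing.of_associative_ring_bracket, LinearMap.sub_apply, sub_eq_add_neg,
    ZModModule.neg_eq_self]
  rfl

include hord in
theorem hallRep_evalWord (b : Module.Basis β (ZMod 2) V) {w : FreeMagma β} (hw : IsBasic w)
    {x : List (FreeMagma β) →₀ ZMod 2}
    (hx : x ∈ Finsupp.supported (ZMod 2) (ZMod 2) {m | IsHallList m}) :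
    hallRep b (evalWord b w) x = hallOp w x := by
  induction w generalizing x with
  | ih1 y =>
    show hallRep b (lieIncl V (b y)) x = hallOp (.of y) x
    rw [hallRep, lieLift_lieIncl, Module.Basis.constr_basis]
  | ih2 u v hu hv =>
    obtain ⟨bu, bv, -⟩ := hw.of_mul
    rw [evalWord_mul, hallRep_lie, hv bv hx, hu bu hx, hu bu (hallOp_mem hord bv hx),
      hv bv (hallOp_mem hord bu hx), hallOp_mul hord hw hx]

include hord in
theorem hallRep_evalWord_nil (b : Module.Basis β (ZMod 2) V) {w : FreeMagma β} (hw : IsBasic w) :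
    hallRep b (evalWord b w) (Finsupp.single [] 1) = Finsupp.single [w] 1 := by
  rw [hallRep_evalWord hord b hw, hallOp_single, (hallAct_nil w).2]
  exact Finsupp.single_mem_supported _ _ ⟨List.Pairwise.nil, by simp⟩

/-- The action on the empty list. It sends a basic product `w` to the list `[w]`, which shows that
basic products are linearly independent. -/
def hallVac (b : Module.Basis β (ZMod 2) V) :
    FreeSLieTi V →ₗ[ZMod 2] (List (FreeMagma β) →₀ ZMod 2) :=
  LinearMap.applyₗ (Finsupp.single ([] : List (FreeMagma β)) (1 : ZMod 2)) ∘ₗ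
    (hallRep b : FreeSLieTi V →ₗ[ZMod 2] _)

theorem hallVac_apply (b : Module.Basis β (ZMod 2) V) (x : FreeSLieTi V) :
    hallVac b x = hallRep b x (Finsupp.single [] 1) := rfl

include hord in
theorem linearIndependent_hallVac (b : Module.Basis β (ZMod 2) V) :
    LinearIndependent (ZMod 2) fun w : {w : FreeMagma β // IsBasic w} =>
      hallVac b (evalWord b w.1) := by
  have h1 := (Finsupp.basisSingleOne (R := ZMod 2)).linearIndependent.comp
    (fun w : {w : FreeMagma β // IsBasic w} => [w.1]) (fun w w' h => Subtype.ext (by simpa using h))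
  convert h1 using 1
  ext1 w
  rw [hallVac_apply, hallRep_evalWord_nil hord b w.2]
  simp

include hord in
/-- The basis of the free totally isotropic shifted Lie algebra by the basic products. -/
def hallBasis (b : Module.Basis β (ZMod 2) V) :
    Module.Basis {w : FreeMagma β // IsBasic w} (ZMod 2) (FreeSLieTi V) :=
  Module.Basis.mk (v := fun w : {w : FreeMagma β // IsBasic w} => evalWord b w.1)
    (LinearIndependent.of_comp (hallVac b) (linearIndependent_hallVac hord b))
    (span_evalWord hord b)

theorem hallBasis_apply (b : Module.Basis β (ZMod 2) V) (w : {w : FreeMagma β // IsBasic w}) :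
    hallBasis hord b w = evalWord b w.1 := Module.Basis.mk_apply _ _ _

include hord in
theorem hallVac_injective (b : Module.Basis β (ZMod 2) V) : Function.Injective (hallVac b) := by
  rw [← LinearMap.ker_eq_bot, LinearMap.ker_eq_bot']
  intro x hx
  rw [← (hallBasis hord b).linearCombination_repr x, Finsupp.apply_linearCombination] at hx
  have h2 : (fun w : {w : FreeMagma β // IsBasic w} => hallVac b (evalWord b w.1)) =
      hallVac b ∘ hallBasis hord b := by
    ext1 w; simp [hallBasis_apply]
  rw [← h2] at hx
  have h3 := linearIndependent_iff.1 (linearIndependent_hallVac hord b) _ hx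
  exact (hallBasis hord b).repr.map_eq_zero_iff.1 h3

variable {𝓥 : ℤ → Submodule (ZMod 2) V} (b : Module.Basis β (ZMod 2) V) (d : β → ℤ)

/-- The homogeneous parts are spanned by the basic products of the given degree. -/
theorem lieGrading_eq_span (hint : DirectSum.IsInternal 𝓥) (hb : ∀ x : β, b x ∈ 𝓥 (d x)) (n : ℤ) :
    lieGrading 𝓥 n = Submodule.span (ZMod 2)
      (hallBasis hord b '' {w | wordDeg d w.1 = n}) := by
  apply le_antisymm
  · refine Submodule.span_le.2 fun x hx => ?_
    induction hx with
    | incl n v hv =>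
      rw [mem_of_homogeneous_basis b d hint hb n] at hv
      have : Submodule.span (ZMod 2) (b '' {i | d i = n}) ≤ (Submodule.span (ZMod 2)
          (hallBasis hord b '' {w | wordDeg d w.1 = n})).comap (lieIncl V) := by
        refine Submodule.span_le.2 ?_
        rintro _ ⟨x, hx, rfl⟩
        exact Submodule.subset_span ⟨⟨.of x, trivial⟩, hx, hallBasis_apply hord b _⟩
      exact this hv
    | bracket i j x y _ _ hx hy =>
      refine Submodule.span_induction₂ (p := fun x y _ _ => ⁅x, y⁆ ∈ Submodule.span (ZMod 2)
          (hallBasis hord b '' {w | wordDeg d w.1 = i + j - 1})) ?_ ?_ ?_ ?_ ?_ ?_ ?_ hx hy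
      · rintro _ _ ⟨u, rfl, rfl⟩ ⟨v, rfl, rfl⟩
        rw [hallBasis_apply, hallBasis_apply]
        refine Submodule.span_mono ?_ (lie_evalWord_mem hord b u.2 v.2)
        rintro _ ⟨c, hc, rfl⟩
        exact ⟨⟨c, hc.1⟩, wordDeg_of_letters_eq hc.2, hallBasis_apply hord b _⟩
      · intro y _; rw [zero_lie]; exact zero_mem _
      · intro y _; rw [lie_zero]; exact zero_mem _
      · intro x y z _ _ _ h1 h2; rw [add_lie]; exact add_mem h1 h2
      · intro x y z _ _ _ h1 h2; rw [lie_add]; exact add_mem h1 h2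
      · intro c x y _ _ h; rw [smul_lie]; exact Submodule.smul_mem _ _ h
      · intro c x y _ _ h; rw [lie_smul]; exact Submodule.smul_mem _ _ h
  · refine Submodule.span_mono ?_
    rintro _ ⟨w, rfl, rfl⟩
    rw [hallBasis_apply]
    exact isLieMonomial_evalWord hb w.1

include hord in
theorem isSLieTi_lieBracket (hint : DirectSum.IsInternal 𝓥) (hb : ∀ x : β, b x ∈ 𝓥 (d x)) :
    IsSLieTi (lieGrading 𝓥) (lieBracket V) where
  internal := isInternal_of_basis (hallBasis hord b) (fun w => wordDeg d w.1)
    (lieGrading_eq_span hord b d hint hb)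
  degree i j x hx y hy := by
    refine Submodule.span_induction₂ (p := fun x y _ _ => ⁅x, y⁆ ∈ lieGrading 𝓥 (i + j - 1))
      ?_ ?_ ?_ ?_ ?_ ?_ ?_ hx hy
    · intro x y hx hy
      exact Submodule.subset_span (IsLieMonomial.bracket _ _ _ _ hx hy)
    · intro y _; rw [zero_lie]; exact zero_mem _
    · intro y _; rw [lie_zero]; exact zero_mem _
    · intro x y z _ _ _ h1 h2; rw [add_lie]; exact add_mem h1 h2
    · intro x y z _ _ _ h1 h2; rw [lie_add]; exact add_mem h1 h2
    · intro c x y _ _ h; rw [smul_lie]; exact Submodule.smul_mem _ _ h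
    · intro c x y _ _ h; rw [lie_smul]; exact Submodule.smul_mem _ _ h
  symm := lieBracket_symm
  jacobi := lie_jacobi
  self _ x _ := lie_self x

/-- The identity `[x, x] = 0` for homogeneous `x` extends to all `x`, as the bracket is
symmetric. -/
theorem IsSLieTi.bracket_self {E : Type*} [AddCommGroup E] [Module (ZMod 2) E]
    {𝓔 : ℤ → Submodule (ZMod 2) E} {C : E →ₗ[ZMod 2] E →ₗ[ZMod 2] E} (h : IsSLieTi 𝓔 C) (x : E) :
    C x x = 0 := by
  have hx : x ∈ ⨆ n, 𝓔 n := by rw [h.internal.submodule_iSup_eq_top]; trivial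
  refine Submodule.iSup_induction 𝓔 (motive := fun x => C x x = 0) hx h.self (by simp) ?_
  · intro x y hx hy
    rw [map_add, map_add, LinearMap.add_apply, LinearMap.add_apply, hx, hy, h.symm y x, zero_add,
      add_zero, ZModModule.add_self]

include hord in
theorem isFreeSLieTi_freeSLieTi.{t} (hint : DirectSum.IsInternal 𝓥)
    (hb : ∀ x : β, b x ∈ 𝓥 (d x)) :
    IsFreeSLieTi.{t} 𝓥 (lieGrading 𝓥) (lieBracket V) (lieIncl V) where
  isSLieTi := isSLieTi_lieBracket hord b d hint hb
  graded n v hv := Submodule.subset_span (IsLieMonomial.incl n v hv)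
  universal E _ _ 𝓔 C hC f hf := by
    let : LieRing E :=
      { (inferInstance : AddCommGroup E) with
        bracket := fun x y => C x y
        add_lie := fun x y z => by show C (x + y) z = C x z + C y z; simp
        lie_add := fun x y z => (C x).map_add y z
        lie_self := hC.bracket_self
        leibniz_lie := fun x y z => by
          show C x (C y z) = C (C x y) z + C y (C x z)
          have := hC.jacobi x y z
          rw [hC.symm (C x y) z, hC.symm x z, add_comm (C z _), ← sub_eq_zero, sub_eq_add_neg,
            ZModModule.neg_eq_self, ← add_assoc]
          exact this }
    let : LieAlgebra (ZMod 2) E := { lie_smul := fun c x y => (C x).map_smul c y }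
    refine ⟨(lieLift f : FreeSLieTi V →ₗ[ZMod 2] E), ⟨?_, fun x y => (lieLift f).map_lie x y,
      lieLift_lieIncl f⟩, ?_⟩
    · intro n x hx
      have : lieGrading 𝓥 n ≤ (𝓔 n).comap (lieLift f : FreeSLieTi V →ₗ[ZMod 2] E) := by
        refine Submodule.span_le.2 fun y hy => ?_
        clear hx
        induction hy with
        | incl n v hv =>
          show lieLift f (lieIncl V v) ∈ 𝓔 n
          rw [lieLift_lieIncl]
          exact hf n v hv
        | bracket i j x y _ _ hx hy =>
          show lieLift f ⁅x, y⁆ ∈ 𝓔 _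
          rw [LieHom.map_lie]
          exact hC.degree i j _ hx _ hy
      exact this hx
    · rintro G ⟨-, hG, hGf⟩
      refine (hallBasis hord b).ext fun w => ?_
      rw [hallBasis_apply]
      induction w.1 with
      | ih1 x => exact (hGf _).trans (lieLift_lieIncl f _).symm
      | ih2 u v hu hv =>
        show G ⁅evalWord b u, evalWord b v⁆ = lieLift f ⁅evalWord b u, evalWord b v⁆
        rw [← lieBracket_apply, hG, hu, hv, lieBracket_apply, LieHom.map_lie]
        rfl

end HallBasis

/-! ### Extensions of Lie algebras by squares -/

section Extension

variable {σ L : Type*} [LieRing L] [LieAlgebra (ZMod 2) L]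
  (ρ : L →ₗ[ZMod 2] Module.End (ZMod 2) (σ →₀ ZMod 2))

variable (σ) in
/-- The inclusion of a vector space with basis `σ` in its symmetric algebra. -/
def toSym : (σ →₀ ZMod 2) →ₗ[ZMod 2] MvPolynomial σ (ZMod 2) :=
  Finsupp.linearCombination (ZMod 2) MvPolynomial.X

theorem toSym_single (i : σ) : toSym σ (Finsupp.single i 1) = MvPolynomial.X i := by
  rw [toSym, Finsupp.linearCombination_single, one_smul]

theorem toSym_injective : Function.Injective (toSym σ) := by
  classical
  rw [← LinearMap.ker_eq_bot, LinearMap.ker_eq_bot']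
  intro x hx
  ext i
  have := congrArg (MvPolynomial.coeff (Finsupp.single i 1)) hx
  rw [toSym, Finsupp.linearCombination_apply, Finsupp.sum, MvPolynomial.coeff_sum] at this
  simpa [MvPolynomial.coeff_X, Finsupp.single_left_inj] using this

/-- The action of `L` on the symmetric algebra by derivations. -/
def symDer : L →ₗ[ZMod 2]
    Derivation (ZMod 2) (MvPolynomial σ (ZMod 2)) (MvPolynomial σ (ZMod 2)) where
  toFun l := MvPolynomial.mkDerivation (ZMod 2) fun i => toSym σ (ρ l (Finsupp.single i 1))
  map_add' l l' := MvPolynomial.derivation_ext fun i => by simp [MvPolynomial.mkDerivation_X]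
  map_smul' c l := MvPolynomial.derivation_ext fun i => by simp [MvPolynomial.mkDerivation_X]

theorem symDer_toSym (l : L) (m : σ →₀ ZMod 2) : symDer ρ l (toSym σ m) = toSym σ (ρ l m) := by
  have : (symDer ρ l).toLinearMap ∘ₗ toSym σ = toSym σ ∘ₗ ρ l := by
    refine Finsupp.lhom_ext' fun i => LinearMap.ext_ring ?_
    show symDer ρ l (toSym σ (Finsupp.single i 1)) = toSym σ (ρ l (Finsupp.single i 1))
    rw [toSym_single]
    exact MvPolynomial.mkDerivation_X _ _ _
  exact LinearMap.congr_fun this m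

variable {ρ}

theorem symDer_lie (hρ : ∀ x y m, ρ ⁅x, y⁆ m = ρ x (ρ y m) + ρ y (ρ x m)) (x y : L)
    (c : MvPolynomial σ (ZMod 2)) :
    symDer ρ ⁅x, y⁆ c = symDer ρ x (symDer ρ y c) + symDer ρ y (symDer ρ x c) := by
  have : symDer ρ ⁅x, y⁆ = ⁅symDer ρ x, symDer ρ y⁆ := by
    refine MvPolynomial.derivation_ext fun i => ?_
    rw [Derivation.commutator_apply, ← toSym_single]
    simp only [symDer_toSym]
    rw [hρ, map_add, sub_eq_add_neg, ZModModule.neg_eq_self]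
  rw [this, Derivation.commutator_apply, sub_eq_add_neg, ZModModule.neg_eq_self]

variable (ρ) in
/-- The bracket on `L × M × Sym M`, for a representation of `L` on the vector space `M` with basis
`σ`, by which `L` acts on `M` and on `Sym M`, the bracket of two elements of `M` is their product
in `Sym M`, and `M` and `Sym M` commute with `Sym M`. In characteristic two it is symmetric and
satisfies the Jacobi identity, but it is not alternating: an element with component `m` in `M` has
the square `m ^ 2`. -/
def extBracket : (L × (σ →₀ ZMod 2) × MvPolynomial σ (ZMod 2)) →ₗ[ZMod 2]
    (L × (σ →₀ ZMod 2) × MvPolynomial σ (ZMod 2)) →ₗ[ZMod 2]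
      (L × (σ →₀ ZMod 2) × MvPolynomial σ (ZMod 2)) :=
  LinearMap.mk₂ (ZMod 2)
    (fun x y => (⁅x.1, y.1⁆, ρ x.1 y.2.1 + ρ y.1 x.2.1,
      toSym σ x.2.1 * toSym σ y.2.1 + symDer ρ x.1 y.2.2 + symDer ρ y.1 x.2.2))
    (fun x x' y => by
      refine Prod.ext ?_ (Prod.ext ?_ ?_)
      · simp
      · simp; abel
      · simp [add_mul]; abel)
    (fun c x y => by
      refine Prod.ext ?_ (Prod.ext ?_ ?_)
      · simp
      · simp
      · simp)
    (fun x y y' => by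
      refine Prod.ext ?_ (Prod.ext ?_ ?_)
      · simp
      · simp; abel
      · simp [mul_add]; abel)
    (fun c x y => by
      refine Prod.ext ?_ (Prod.ext ?_ ?_)
      · simp
      · simp
      · simp)

theorem extBracket_apply (x y : L × (σ →₀ ZMod 2) × MvPolynomial σ (ZMod 2)) :
    extBracket ρ x y = (⁅x.1, y.1⁆, ρ x.1 y.2.1 + ρ y.1 x.2.1,
      toSym σ x.2.1 * toSym σ y.2.1 + symDer ρ x.1 y.2.2 + symDer ρ y.1 x.2.2) := rfl

theorem extBracket_symm (x y : L × (σ →₀ ZMod 2) × MvPolynomial σ (ZMod 2)) :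
    extBracket ρ x y = extBracket ρ y x := by
  refine Prod.ext ?_ (Prod.ext ?_ ?_)
  · simp only [extBracket_apply]
    rw [← lie_skew, ZModModule.neg_eq_self]
  · exact add_comm _ _
  · simp only [extBracket_apply]
    ring

theorem extBracket_jacobi (hρ : ∀ x y m, ρ ⁅x, y⁆ m = ρ x (ρ y m) + ρ y (ρ x m))
    (x y z : L × (σ →₀ ZMod 2) × MvPolynomial σ (ZMod 2)) :
    extBracket ρ x (extBracket ρ y z) + extBracket ρ y (extBracket ρ z x) +
      extBracket ρ z (extBracket ρ x y) = 0 := by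
  have h2 : (2 : MvPolynomial σ (ZMod 2)) = 0 := CharTwo.two_eq_zero
  have h2' : ∀ a : σ →₀ ZMod 2, a + a = 0 := ZModModule.add_self
  refine Prod.ext ?_ (Prod.ext ?_ ?_)
  · exact lie_jacobi x.1 y.1 z.1
  · simp only [extBracket_apply, Prod.snd_add, Prod.fst_add, Prod.snd_zero, Prod.fst_zero, map_add,
      hρ]
    have key : ∀ a b c d e f : σ →₀ ZMod 2,
        (a + b + (c + d) + (e + f + (b + a)) + (d + c + (f + e))) = 0 := by
      intro a b c d e f
      calc _ = (a + a) + (b + b) + (c + c) + (d + d) + (e + e) + (f + f) := by abel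
        _ = 0 := by simp only [h2']
    refine Eq.trans ?_ (key (ρ x.1 (ρ y.1 z.2.1)) (ρ x.1 (ρ z.1 y.2.1)) (ρ y.1 (ρ z.1 x.2.1))
      (ρ z.1 (ρ y.1 x.2.1)) (ρ y.1 (ρ x.1 z.2.1)) (ρ z.1 (ρ x.1 y.2.1)))
    abel
  · simp only [extBracket_apply, Prod.snd_add, Prod.snd_zero, map_add, Derivation.leibniz,
      symDer_toSym, symDer_lie hρ, smul_eq_mul]
    ring_nf
    simp only [h2, mul_zero, add_zero]

end Extension

/-! ### The cocycle of squares on the free Lie algebra -/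

section Cocycle

variable {V : Type*} [AddCommGroup V] [Module (ZMod 2) V] {β : Type*} [LinearOrder (FreeMagma β)]
  (hord : ∀ w₁ w₂ : FreeMagma β, w₁.length < w₂.length → w₁ < w₂)
  (b : Module.Basis β (ZMod 2) V)

/-- The extension of the free Lie algebra by its representation on lists and the symmetric algebra
of this. -/
abbrev HallExt (V β : Type*) [AddCommGroup V] [Module (ZMod 2) V] : Type _ :=
  FreeSLieTi V × (List (FreeMagma β) →₀ ZMod 2) × MvPolynomial (List (FreeMagma β)) (ZMod 2)

/-- The bracket of `extBracket` for the representation `hallRep`. -/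
def hallExtBracket : HallExt V β →ₗ[ZMod 2] HallExt V β →ₗ[ZMod 2] HallExt V β :=
  extBracket (hallRep b : FreeSLieTi V →ₗ[ZMod 2] _)

theorem hallExtBracket_symm (x y : HallExt V β) :
    hallExtBracket b x y = hallExtBracket b y x := extBracket_symm _ _

theorem hallExtBracket_jacobi (x y z : HallExt V β) :
    hallExtBracket b x (hallExtBracket b y z) + hallExtBracket b y (hallExtBracket b z x) +
      hallExtBracket b z (hallExtBracket b x y) = 0 :=
  extBracket_jacobi (hallRep_lie b) x y z

/-- The value of a word in the extension, for a lift of the letters in which the component in the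
module is the image of the empty list. -/
def extWord : FreeMagma β → HallExt V β
  | .of x => (lieIncl V (b x), hallVac b (lieIncl V (b x)), 0)
  | .mul u v => hallExtBracket b (extWord u) (extWord v)

theorem extWord_mul (u v : FreeMagma β) :
    extWord b (u * v) = hallExtBracket b (extWord b u) (extWord b v) := rfl

theorem hallVac_lie (x y : FreeSLieTi V) :
    hallVac b ⁅x, y⁆ = hallRep b x (hallVac b y) + hallRep b y (hallVac b x) :=
  hallRep_lie b x y _

theorem extWord_fst (w : FreeMagma β) :
    (extWord b w).1 = evalWord b w ∧ (extWord b w).2.1 = hallVac b (evalWord b w) := by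
  induction w with
  | ih1 x => exact ⟨rfl, rfl⟩
  | ih2 u v hu hv =>
    constructor
    · show ⁅(extWord b u).1, (extWord b v).1⁆ = _
      rw [hu.1, hv.1]
      rfl
    · show hallRep b (extWord b u).1 (extWord b v).2.1 +
        hallRep b (extWord b v).1 (extWord b u).2.1 = _
      rw [hu.1, hv.1, hu.2, hv.2, evalWord_mul, hallVac_lie]

/-- The map to the extension whose value at a basic product is the square of its lift. Its values
are central, as derivations kill squares in characteristic two. -/
def extSquare : FreeSLieTi V →ₗ[ZMod 2] HallExt V β :=
  AddMonoidHom.toZModLinearMap 2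
    { toFun := fun x => (0, 0, toSym _ (hallVac b x) ^ 2)
      map_zero' := by simp
      map_add' := fun x y => by
        rw [map_add, map_add, CharTwo.add_sq, Prod.mk_add_mk, Prod.mk_add_mk, add_zero, add_zero] }

theorem extSquare_apply (x : FreeSLieTi V) :
    extSquare b x = ((0, 0, toSym _ (hallVac b x) ^ 2) : HallExt V β) := rfl

include hord in
theorem extSquare_injective : Function.Injective (extSquare b) := by
  rw [← LinearMap.ker_eq_bot, LinearMap.ker_eq_bot']
  intro x hx
  have h1 : toSym _ (hallVac b x) ^ 2 = 0 := congrArg (fun t : HallExt V β => t.2.2) hx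
  have h2 := eq_zero_of_pow_eq_zero h1
  exact (map_eq_zero_iff _ (hallVac_injective hord b)).1
    ((map_eq_zero_iff _ toSym_injective).1 h2)

theorem hallExtBracket_extSquare (x : HallExt V β) (y : FreeSLieTi V) :
    hallExtBracket b x (extSquare b y) = 0 := by
  rw [hallExtBracket, extBracket_apply, extSquare_apply]
  refine Prod.ext ?_ (Prod.ext ?_ ?_)
  · simp
  · simp
  · simp [pow_two, Derivation.leibniz, ZModModule.add_self]

/-- The linear section of the extension over the free Lie algebra whose value at a basic product
is the value of this word in the extension. -/
def hallSection : FreeSLieTi V →ₗ[ZMod 2] HallExt V β :=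
  (hallBasis hord b).constr (ZMod 2) fun w => extWord b w.1

theorem hallSection_evalWord {w : FreeMagma β} (hw : IsBasic w) :
    hallSection hord b (evalWord b w) = extWord b w := by
  have := (hallBasis hord b).constr_basis (ZMod 2) (fun w => extWord b w.1) ⟨w, hw⟩
  rwa [hallBasis_apply] at this

theorem hallSection_fst (x : FreeSLieTi V) :
    (hallSection hord b x).1 = x ∧ (hallSection hord b x).2.1 = hallVac b x := by
  have h1 : LinearMap.fst _ _ _ ∘ₗ hallSection hord b = LinearMap.id := by
    refine (hallBasis hord b).ext fun w => ?_
    rw [hallBasis_apply, LinearMap.comp_apply, hallSection_evalWord hord b w.2]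
    exact (extWord_fst b w.1).1
  have h2 : (LinearMap.fst _ _ _ ∘ₗ LinearMap.snd _ _ _) ∘ₗ hallSection hord b = hallVac b := by
    refine (hallBasis hord b).ext fun w => ?_
    rw [hallBasis_apply, LinearMap.comp_apply, hallSection_evalWord hord b w.2]
    exact (extWord_fst b w.1).2
  exact ⟨LinearMap.congr_fun h1 x, LinearMap.congr_fun h2 x⟩

theorem hallExtBracket_self (x : HallExt V β) :
    hallExtBracket b x x = (0, 0, toSym _ x.2.1 ^ 2) := by
  rw [hallExtBracket, extBracket_apply]
  refine Prod.ext ?_ (Prod.ext ?_ ?_)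
  · simp
  · exact ZModModule.add_self _
  · show _ * _ + _ + _ = _
    rw [add_assoc, ZModModule.add_self, add_zero, pow_two]

theorem isHallPattern_extWord (d : β → ℤ) :
    IsHallPattern d (fun n => Submodule.span (ZMod 2)
      {x | ∃ w, IsBasic w ∧ wordDeg d w + wordDeg d w - 1 = n ∧ x = extSquare b (evalWord b w)})
      (hallExtBracket b) (extWord b) where
  basic _ _ _ := rfl
  square a ha := by
    refine Submodule.subset_span ⟨a, ha, rfl, ?_⟩
    rw [hallExtBracket_self, (extWord_fst b a).2]
    rfl
  swap _ _ _ _ _ := hallExtBracket_symm b _ _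
  jacobi a u v _ _ _ := by
    have := hallExtBracket_jacobi b (extWord b a) (extWord b u) (extWord b v)
    show hallExtBracket b (extWord b a) (hallExtBracket b (extWord b u) (extWord b v)) = _
    rw [add_assoc] at this
    rw [eq_neg_of_add_eq_zero_left this, ZModModule.neg_eq_self]
  vanish a _ n x hx := by
    have : Submodule.span (ZMod 2)
        {x | ∃ w, IsBasic w ∧ wordDeg d w + wordDeg d w - 1 = n ∧ x = extSquare b (evalWord b w)} ≤
        LinearMap.ker (hallExtBracket b (extWord b a)) := by
      refine Submodule.span_le.2 ?_
      rintro _ ⟨w, -, -, rfl⟩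
      exact hallExtBracket_extSquare b _ _
    exact this hx

include hord in
/-- There is a symmetric bilinear `D` with `D x x = x` satisfying the cocycle identity which
vanishes on pairs whose product is basic. It measures the failure of `hallSection` to preserve
brackets: by collection in the extension this defect is a combination of squares, and `extSquare`
is injective. The last clause says that `D` halves degrees. -/
theorem exists_hallCocycle :
    ∃ D : FreeSLieTi V →ₗ[ZMod 2] FreeSLieTi V →ₗ[ZMod 2] FreeSLieTi V,
      (∀ x y, D x y = D y x) ∧ (∀ x, D x x = x) ∧
      (∀ x y z, D x ⁅y, z⁆ + D y ⁅z, x⁆ + D z ⁅x, y⁆ = 0) ∧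
      (∀ u v, IsBasic (u * v) → D (evalWord b u) (evalWord b v) = 0) ∧
      ∀ (d : β → ℤ) (u v : FreeMagma β), IsBasic u → IsBasic v →
        D (evalWord b u) (evalWord b v) ∈ Submodule.span (ZMod 2) (evalWord b ''
          {w | IsBasic w ∧ wordDeg d w + wordDeg d w = wordDeg d u + wordDeg d v}) := by
  obtain ⟨g, hg⟩ := (extSquare b).exists_leftInverse_of_injective
    (LinearMap.ker_eq_bot.2 (extSquare_injective hord b))
  have hg : ∀ x, g (extSquare b x) = x := LinearMap.congr_fun hg
  let s := hallSection hord b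
  let D : FreeSLieTi V →ₗ[ZMod 2] FreeSLieTi V →ₗ[ZMod 2] FreeSLieTi V :=
    ((hallExtBracket b).compl₁₂ s s + (lieBracket V).compr₂ s).compr₂ g
  have hD : ∀ x y, D x y = g (hallExtBracket b (s x) (s y) + s ⁅x, y⁆) := fun _ _ => rfl
  -- the defect of `s` lies in the image of `extSquare`
  have hmem : ∀ (d : β → ℤ) (u v : FreeMagma β), IsBasic u → IsBasic v → ∃ t ∈
      Submodule.span (ZMod 2) (evalWord b ''
          {w | IsBasic w ∧ wordDeg d w + wordDeg d w = wordDeg d u + wordDeg d v}),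
      hallExtBracket b (s (evalWord b u)) (s (evalWord b v)) + s ⁅evalWord b u, evalWord b v⁆ =
        extSquare b t := by
    intro d u v hu hv
    have h := (isHallPattern_extWord b d).bracket_mem hord u v hu hv
    obtain ⟨p, hp, q, hq, hpq⟩ := Submodule.mem_sup.1 h
    have hp' : ∃ z, p = s z := by
      have : hallSpan (extWord b) (letters u + letters v) ≤ LinearMap.range s := by
        refine Submodule.span_le.2 ?_
        rintro _ ⟨c, hc, rfl⟩
        exact ⟨evalWord b c, hallSection_evalWord hord b hc.1⟩
      obtain ⟨z, hz⟩ := this hp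
      exact ⟨z, hz.symm⟩
    have hq' : ∃ t ∈ Submodule.span (ZMod 2) (evalWord b ''
          {w | IsBasic w ∧ wordDeg d w + wordDeg d w = wordDeg d u + wordDeg d v}),
        extSquare b t = q := by
      have hle : Submodule.span (ZMod 2) {x | ∃ w, IsBasic w ∧
          wordDeg d w + wordDeg d w - 1 = wordDeg d u + wordDeg d v - 1 ∧
            x = extSquare b (evalWord b w)} ≤
          (Submodule.span (ZMod 2) (evalWord b ''
            {w | IsBasic w ∧ wordDeg d w + wordDeg d w = wordDeg d u + wordDeg d v})).map
            (extSquare b) := by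
        refine Submodule.span_le.2 ?_
        rintro _ ⟨w, hw, hd, rfl⟩
        exact ⟨_, Submodule.subset_span ⟨w, ⟨hw, by omega⟩, rfl⟩, rfl⟩
      exact hle hq
    obtain ⟨z, rfl⟩ := hp'
    obtain ⟨t, ht, rfl⟩ := hq'
    refine ⟨t, ht, ?_⟩
    rw [hallSection_evalWord hord b hu, hallSection_evalWord hord b hv]
    have hz : z = ⁅evalWord b u, evalWord b v⁆ := by
      have h1 := congrArg Prod.fst hpq
      have h2 : (hallExtBracket b (extWord b u) (extWord b v)).1 =
          ⁅evalWord b u, evalWord b v⁆ := by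
        show ⁅(extWord b u).1, (extWord b v).1⁆ = _
        rw [(extWord_fst b u).1, (extWord_fst b v).1]
      rw [h2, Prod.fst_add, (hallSection_fst hord b z).1, extSquare_apply, add_zero] at h1
      exact h1
    rw [← hpq, hz, add_right_comm, ZModModule.add_self, zero_add]
  have hrange : ∀ x y, hallExtBracket b (s x) (s y) + s ⁅x, y⁆ ∈ LinearMap.range (extSquare b) := by
    intro x y
    have hx := span_evalWord hord b (Submodule.mem_top (x := x))
    have hy := span_evalWord hord b (Submodule.mem_top (x := y))
    let Δ := (hallExtBracket b).compl₁₂ s s + (lieBracket V).compr₂ s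
    refine Submodule.span_induction₂ (p := fun x y _ _ => Δ x y ∈ LinearMap.range (extSquare b))
      ?_ ?_ ?_ ?_ ?_ ?_ ?_ hx hy
    · rintro _ _ ⟨u, rfl⟩ ⟨v, rfl⟩
      obtain ⟨t, -, ht⟩ := hmem (fun _ => 0) u.1 v.1 u.2 v.2
      exact ⟨t, ht.symm⟩
    · intro y _; rw [map_zero]; exact zero_mem _
    · intro y _; rw [map_zero]; exact zero_mem _
    · intro x y z _ _ _ h1 h2; rw [map_add]; exact add_mem h1 h2
    · intro x y z _ _ _ h1 h2; rw [map_add]; exact add_mem h1 h2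
    · intro c x y _ _ h; rw [map_smul]; exact Submodule.smul_mem _ _ h
    · intro c x y _ _ h; rw [map_smul]; exact Submodule.smul_mem _ _ h
  have hσD : ∀ x y, extSquare b (D x y) = hallExtBracket b (s x) (s y) + s ⁅x, y⁆ := by
    intro x y
    obtain ⟨t, ht⟩ := hrange x y
    rw [hD, ← ht, hg]
  refine ⟨D, ?_, ?_, ?_, ?_, ?_⟩
  · intro x y
    rw [hD, hD, hallExtBracket_symm, lieBracket_symm]
  · intro x
    rw [hD, lie_self, map_zero, add_zero, hallExtBracket_self, (hallSection_fst hord b x).2]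
    exact hg x
  · intro x y z
    apply extSquare_injective hord b
    have key : ∀ x y z, extSquare b (D x ⁅y, z⁆) =
        hallExtBracket b (s x) (hallExtBracket b (s y) (s z)) + s ⁅x, ⁅y, z⁆⁆ := by
      intro x y z
      have h1 : s ⁅y, z⁆ = hallExtBracket b (s y) (s z) + extSquare b (D y z) := by
        rw [hσD, ← add_assoc, ZModModule.add_self, zero_add]
      rw [hσD, h1, map_add, hallExtBracket_extSquare, add_zero]
    have h1 := hallExtBracket_jacobi b (s x) (s y) (s z)
    have h2 := congrArg s (lie_jacobi x y z)
    rw [map_add, map_add, map_zero] at h2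
    have e : ∀ p q r p' q' r' : HallExt V β,
        p + p' + (q + q') + (r + r') = p + q + r + (p' + q' + r') := fun _ _ _ _ _ _ => by abel
    rw [map_add, map_add, key, key, key, map_zero, e, h1, h2, add_zero]
  · intro u v huv
    obtain ⟨hu, hv, -⟩ := huv.of_mul
    have h1 : s ⁅evalWord b u, evalWord b v⁆ =
        hallExtBracket b (extWord b u) (extWord b v) := by
      rw [← evalWord_mul, ← extWord_mul]
      exact hallSection_evalWord hord b huv
    rw [hD, h1, hallSection_evalWord hord b hu, hallSection_evalWord hord b hv,
      ZModModule.add_self, map_zero]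
  · intro d u v hu hv
    obtain ⟨t, ht, h⟩ := hmem d u v hu hv
    rw [hD, h, hg]
    exact ht

end Cocycle

/-! ### Brackets determined by their recursion on basic products -/

section HallData

variable {β : Type*} [LinearOrder (FreeMagma β)]
variable {A : Type*} [AddCommGroup A] [Module (ZMod 2) A]
variable {E : Type*} [AddCommGroup E] [Module (ZMod 2) E]

/-- A bracket with prescribed rules on the elements `e w` attached to basic products `w`, where
`q w` is the square of `e w` and the `q w` are annihilated by the `e u`. -/
structure IsHallRecursion (B : A →ₗ[ZMod 2] A →ₗ[ZMod 2] A) (e q : FreeMagma β → A) : Prop where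
  basic : ∀ u v, IsBasic (u * v) → B (e u) (e v) = e (u * v)
  square : ∀ w, IsBasic w → B (e w) (e w) = q w
  swap : ∀ u v, IsBasic u → IsBasic v → v < u → B (e u) (e v) = B (e v) (e u)
  jacobi : ∀ a u v, IsBasic a → IsBasic (u * v) → a < u →
    B (e a) (e (u * v)) = B (e u) (B (e v) (e a)) + B (e v) (B (e a) (e u))
  vanish : ∀ u v, IsBasic u → IsBasic v → B (e u) (q v) = 0

/-- The componentwise bracket on a product. -/
def prodBracket (B : A →ₗ[ZMod 2] A →ₗ[ZMod 2] A) (C : E →ₗ[ZMod 2] E →ₗ[ZMod 2] E) :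
    A × E →ₗ[ZMod 2] A × E →ₗ[ZMod 2] A × E :=
  LinearMap.mk₂ (ZMod 2) (fun x y => (B x.1 y.1, C x.2 y.2))
    (fun _ _ _ => by simp) (fun _ _ _ => by simp) (fun _ _ _ => by simp) (fun _ _ _ => by simp)

variable {B : A →ₗ[ZMod 2] A →ₗ[ZMod 2] A} {C : E →ₗ[ZMod 2] E →ₗ[ZMod 2] E}
  {e q : FreeMagma β → A} {e' q' : FreeMagma β → E}

/-- A linear map between two such brackets which respects the elements `e w` and `q w` respects
the brackets of the `e w`. By collection in the product, the pair of brackets is a combination of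
the pairs `(e w, F (e w))` and `(q w, F (q w))`, and so lies in the graph of `F`. -/
theorem IsHallRecursion.map_bracket
    (hord : ∀ w₁ w₂ : FreeMagma β, w₁.length < w₂.length → w₁ < w₂)
    (hB : IsHallRecursion B e q) (hC : IsHallRecursion C e' q') {F : A →ₗ[ZMod 2] E}
    (he : ∀ w, IsBasic w → F (e w) = e' w) (hq : ∀ w, IsBasic w → F (q w) = q' w)
    {u v : FreeMagma β} (hu : IsBasic u) (hv : IsBasic v) :
    F (B (e u) (e v)) = C (F (e u)) (F (e v)) := by
  let N := Submodule.span (ZMod 2) {x : A × E | ∃ w, IsBasic w ∧ x = (q w, q' w)}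
  have hpat : IsHallPattern (fun _ => 0) (fun _ => N) (prodBracket B C) fun w => (e w, e' w) :=
    { basic := fun a c h => Prod.ext (hB.basic a c h) (hC.basic a c h)
      square := fun a h => Submodule.subset_span
        ⟨a, h, Prod.ext (hB.square a h) (hC.square a h)⟩
      swap := fun a c ha hc h => Prod.ext (hB.swap a c ha hc h) (hC.swap a c ha hc h)
      jacobi := fun a x y ha hxy h => Prod.ext (hB.jacobi a x y ha hxy h) (hC.jacobi a x y ha hxy h)
      vanish := fun a ha _ x hx => by
        have : N ≤ LinearMap.ker (prodBracket B C (e a, e' a)) := by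
          refine Submodule.span_le.2 ?_
          rintro _ ⟨w, hw, rfl⟩
          exact Prod.ext (hB.vanish a w ha hw) (hC.vanish a w ha hw)
        exact this hx }
  have hle : hallSpan (fun w => (e w, e' w)) (letters u + letters v) ⊔ N ≤ F.graph := by
    refine sup_le (Submodule.span_le.2 ?_) (Submodule.span_le.2 ?_)
    · rintro _ ⟨w, hw, rfl⟩
      exact (LinearMap.mem_graph_iff F _).2 (he w hw.1).symm
    · rintro _ ⟨w, hw, rfl⟩
      exact (LinearMap.mem_graph_iff F _).2 (hq w hw).symm
  have := (LinearMap.mem_graph_iff F _).1 (hle (hpat.bracket_mem hord u v hu hv))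
  rw [he u hu, he v hv]
  exact this.symm

theorem bracket_square_eq_zero (hsymm : ∀ x y, C x y = C y x)
    (hjac : ∀ x y z, C x (C y z) + C y (C z x) + C z (C x y) = 0) (x y : E) :
    C x (C y y) = 0 := by
  have := hjac x y y
  rwa [hsymm y x, add_assoc, ZModModule.add_self, add_zero] at this

/-- The value of a word for a bracket `C` and values `g` of the letters. -/
def bracketWord (C : E →ₗ[ZMod 2] E →ₗ[ZMod 2] E) (g : β → E) : FreeMagma β → E
  | .of x => g x
  | .mul u v => C (bracketWord C g u) (bracketWord C g v)

theorem isHallRecursion_bracketWord (hsymm : ∀ x y, C x y = C y x)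
    (hjac : ∀ x y z, C x (C y z) + C y (C z x) + C z (C x y) = 0) (g : β → E) :
    IsHallRecursion C (bracketWord C g) fun w => C (bracketWord C g w) (bracketWord C g w) where
  basic _ _ _ := rfl
  square _ _ := rfl
  swap _ _ _ _ _ := hsymm _ _
  jacobi a u v _ _ _ := by
    have := hjac (bracketWord C g a) (bracketWord C g u) (bracketWord C g v)
    rw [add_assoc] at this
    show C (bracketWord C g a) (C (bracketWord C g u) (bracketWord C g v)) = _
    rw [eq_neg_of_add_eq_zero_left this, ZModModule.neg_eq_self]
  vanish _ _ _ _ := bracket_square_eq_zero hsymm hjac _ _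

end HallData

/-! ### The bracket on the free allowable module -/

section FreeAlg

variable {V : Type*} [AddCommGroup V] [Module (ZMod 2) V] {𝓥 : ℤ → Submodule (ZMod 2) V}
  {β : Type*} {b : Module.Basis β (ZMod 2) V} {d : β → ℤ}

theorem one_le_deg (hpos : ∀ n : ℤ, n ≤ 0 → 𝓥 n = ⊥) (hb : ∀ x : β, b x ∈ 𝓥 (d x)) (x : β) :
    1 ≤ d x := by
  by_contra h
  have h1 := hb x
  rw [hpos (d x) (by omega)] at h1
  exact b.ne_zero x ((Submodule.mem_bot _).1 h1)

theorem hallElt_mem (hb : ∀ x : β, b x ∈ 𝓥 (d x)) (J : List ℕ) (w : FreeMagma β) :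
    hallElt 𝓥 b J w ∈ algGrading 𝓥 (wordDeg d w + seqDeg J) :=
  Submodule.subset_span ⟨J, wordDeg d w, evalWord b w,
    Submodule.subset_span (isLieMonomial_evalWord hb w), rfl, rfl⟩

variable [LinearOrder (FreeMagma β)]

variable (β d) in
/-- Two descriptions of the index set of the basis. -/
def hallPairEquiv : {p : List ℕ × {w : FreeMagma β // IsBasic w} // IsCUFor (wordDeg d p.2.1) p.1} ≃
    {p : List ℕ × FreeMagma β // IsHallPair d p.1 p.2} where
  toFun p := ⟨(p.1.1, p.1.2.1), p.2.1, p.1.2.2, p.2.2⟩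
  invFun p := ⟨(p.1.1, ⟨p.1.2, p.2.2.1⟩), p.2.1, p.2.2.2⟩

variable (hord : ∀ w₁ w₂ : FreeMagma β, w₁.length < w₂.length → w₁ < w₂)
  (hint : DirectSum.IsInternal 𝓥) (hb : ∀ x : β, b x ∈ 𝓥 (d x)) (hd : ∀ x, 1 ≤ d x)

/-- The basis of `FreeAlg 𝓥` by the elements `Q̄^J w`. -/
def algBasis : Module.Basis {p : List ℕ × FreeMagma β // IsHallPair d p.1 p.2} (ZMod 2)
    (FreeAlg 𝓥) :=
  (freeAllowableBasis (hallBasis hord b) (fun w => wordDeg d w.1)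
    (lieGrading_eq_span hord b d hint hb) (fun w => one_le_wordDeg hd w.1)).reindex
      (hallPairEquiv β d)

theorem algBasis_apply (p : {p : List ℕ × FreeMagma β // IsHallPair d p.1 p.2}) :
    algBasis hord hint hb hd p = hallElt 𝓥 b p.1.1 p.1.2 := by
  rw [algBasis, Module.Basis.reindex_apply, freeAllowableBasis_apply, hallBasis_apply]
  rfl

include hord hint hb hd

theorem algGrading_eq_span (n : ℤ) : algGrading 𝓥 n = Submodule.span (ZMod 2)
    (algBasis hord hint hb hd '' {p | wordDeg d p.1.2 + seqDeg p.1.1 = n}) := by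
  rw [algGrading, allowGrading_eq_span_basis (lieGrading_eq_span hord b d hint hb)
    (fun w => one_le_wordDeg hd w.1)]
  congr 1
  ext t
  constructor
  · rintro ⟨p, hp, rfl⟩
    exact ⟨hallPairEquiv β d p, hp, by rw [algBasis, Module.Basis.reindex_apply,
      Equiv.symm_apply_apply]⟩
  · rintro ⟨p, hp, rfl⟩
    exact ⟨(hallPairEquiv β d).symm p, hp, by rw [algBasis, Module.Basis.reindex_apply]⟩

theorem nonneg_algGrading : nonneg (algGrading 𝓥) = ⊤ := by
  have h := isAllowable_freeAllowable (lieGrading_eq_span hord b d hint hb)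
    (fun w => one_le_wordDeg hd w.1)
  exact nonneg_eq_top h.internal h.nonneg

/-- The projection onto the free Lie algebra which kills all `Q̄^J w` with `J` non-empty. It kills
every `Q̄^k t` because rewriting into the basis preserves the length of a sequence. -/
theorem exists_algProj : ∃ pr : FreeAlg 𝓥 →ₗ[ZMod 2] FreeSLieTi V,
    (∀ x, pr (allowIncl (lieGrading 𝓥) x) = x) ∧ ∀ k t, pr (Qbar k • t) = 0 := by
  classical
  let pr := (algBasis hord hint hb hd).constr (ZMod 2) fun p =>
    if p.1.1 = [] then evalWord b p.1.2 else 0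
  have hpr : ∀ J w, IsHallPair d J w → pr (hallElt 𝓥 b J w) =
      if J = [] then evalWord b w else 0 := by
    intro J w h
    have := (algBasis hord hint hb hd).constr_basis (ZMod 2)
      (fun p => if p.1.1 = [] then evalWord b p.1.2 else 0) ⟨(J, w), h⟩
    rwa [algBasis_apply] at this
  refine ⟨pr, fun x => ?_, fun k t => ?_⟩
  · have : pr ∘ₗ allowIncl (lieGrading 𝓥) = LinearMap.id := by
      refine (hallBasis hord b).ext fun w => ?_
      have h := hpr [] w.1 ⟨by simp [IsCU], w.2, by simp⟩
      rw [hallElt, QbarSeq_nil, one_smul, if_pos rfl] at h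
      rw [hallBasis_apply, LinearMap.comp_apply, h]
      rfl
    exact LinearMap.congr_fun this x
  · have : pr ∘ₗ rbarSMul (FreeAlg 𝓥) (Qbar k) = 0 := by
      refine (algBasis hord hint hb hd).ext fun p => ?_
      obtain ⟨⟨J, w⟩, hp⟩ := p
      rw [algBasis_apply, LinearMap.comp_apply, rbarSMul_apply, hallElt, smul_smul,
        ← QbarSeq_cons, LinearMap.zero_apply]
      have hw : evalWord b w ∈ lieGrading 𝓥 (wordDeg d w) :=
        Submodule.subset_span (isLieMonomial_evalWord hb w)
      have h1 := QbarSeq_smul_mem_cuSpan (one_le_wordDeg hd w)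
        (QbarSeq_smul_allowIncl_eq_zero hw) (k :: J)
      have h2 : cuSpan (allowIncl (lieGrading 𝓥) (evalWord b w)) (wordDeg d w) (k :: J).length
          (k :: J).sum ≤ LinearMap.ker pr := by
        refine Submodule.span_le.2 ?_
        rintro _ ⟨I, hI, hlen, -, rfl⟩
        have hne : I ≠ [] := by rintro rfl; simp at hlen
        have := hpr I w ⟨hI.1, hp.2.1, hI.2⟩
        rw [if_neg hne] at this
        exact this
      exact h2 h1
    exact LinearMap.congr_fun this t

/-- The bracket is `[x, y] = ι [pr x, pr y] + Φ (D (pr x) (pr y))`, where `pr` is the projection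
to the free Lie algebra, `ι` the inclusion, `D` the cocycle of squares and `Φ` the linear map with
`Φ w = Q̄^{|w|} w` on basic products. -/
theorem exists_isHallBracket : ∃ B : FreeAlg 𝓥 →ₗ[ZMod 2] FreeAlg 𝓥 →ₗ[ZMod 2] FreeAlg 𝓥,
    IsHallBracket 𝓥 b d B ∧ IsSLie (algGrading 𝓥) B ∧ (∀ k x y, B x (Qbar k • y) = 0) ∧
      ∀ (k : ℕ), ∀ x ∈ algGrading 𝓥 k, Qbar k • x = B x x := by
  obtain ⟨pr, hprι, hprQ⟩ := exists_algProj hord hint hb hd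
  obtain ⟨D, hDsymm, hDself, hDjac, hDbasic, hDdeg⟩ := exists_hallCocycle hord b
  let ι := allowIncl (lieGrading 𝓥)
  -- the linear operation which is `x ↦ Q̄^{|x|} x` on homogeneous elements
  let Φ := (hallBasis hord b).constr (ZMod 2) fun w => hallElt 𝓥 b [(wordDeg d w.1).toNat] w.1
  have hΦ : ∀ w, IsBasic w → Φ (evalWord b w) = hallElt 𝓥 b [(wordDeg d w).toNat] w := by
    intro w hw
    have := (hallBasis hord b).constr_basis (ZMod 2)
      (fun w => hallElt 𝓥 b [(wordDeg d w.1).toNat] w.1) ⟨w, hw⟩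
    rwa [hallBasis_apply] at this
  have hprQ' : ∀ J, J ≠ [] → ∀ w, pr (hallElt 𝓥 b J w) = 0 := by
    intro J hJ w
    obtain ⟨j, J, rfl⟩ := List.exists_cons_of_ne_nil hJ
    rw [hallElt, QbarSeq_cons, mul_smul, hprQ]
  have hprw : ∀ w, pr (hallElt 𝓥 b [] w) = evalWord b w := by
    intro w
    rw [hallElt, QbarSeq_nil, one_smul, hprι]
  have hprΦ : ∀ x, pr (Φ x) = 0 := by
    intro x
    have : pr ∘ₗ Φ = 0 := (hallBasis hord b).ext fun w => by
      rw [hallBasis_apply, LinearMap.comp_apply, hΦ _ w.2, hprQ' _ (by simp)]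
      rfl
    exact LinearMap.congr_fun this x
  let B : FreeAlg 𝓥 →ₗ[ZMod 2] FreeAlg 𝓥 →ₗ[ZMod 2] FreeAlg 𝓥 :=
    ((lieBracket V).compr₂ ι + D.compr₂ Φ).compl₁₂ pr pr
  have hB : ∀ x y, B x y = ι ⁅pr x, pr y⁆ + Φ (D (pr x) (pr y)) := fun _ _ => rfl
  have hsymm : ∀ x y, B x y = B y x := fun x y => by rw [hB, hB, lieBracket_symm, hDsymm]
  have hprB : ∀ x y, pr (B x y) = ⁅pr x, pr y⁆ := fun x y => by
    rw [hB, map_add, hprι, hprΦ, add_zero]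
  have hjac : ∀ x y z, B x (B y z) + B y (B z x) + B z (B x y) = 0 := by
    intro x y z
    have e : ∀ p q r p' q' r' : FreeAlg 𝓥,
        p + p' + (q + q') + (r + r') = p + q + r + (p' + q' + r') := fun _ _ _ _ _ _ => by abel
    rw [hB x (B y z), hB y (B z x), hB z (B x y), hprB, hprB, hprB, e,
      ← map_add, ← map_add, ← map_add, ← map_add,
      lie_jacobi, hDjac, map_zero, map_zero, add_zero]
  have hvan : ∀ k x y, B x (Qbar k • y) = 0 := by
    intro k x y
    rw [hB, hprQ, lie_zero, map_zero, map_zero, map_zero, add_zero]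
  have hvan' : ∀ J₁ J₂ w₁ w₂, J₁ ≠ [] ∨ J₂ ≠ [] →
      B (hallElt 𝓥 b J₁ w₁) (hallElt 𝓥 b J₂ w₂) = 0 := by
    rintro J₁ J₂ w₁ w₂ (h | h)
    · rw [hB, hprQ' _ h, zero_lie, map_zero, map_zero, LinearMap.zero_apply, map_zero, add_zero]
    · rw [hB, hprQ' _ h, lie_zero, map_zero, map_zero, map_zero, add_zero]
  have hsq : ∀ w k, IsBasic w → wordDeg d w = (k : ℕ) →
      B (hallElt 𝓥 b [] w) (hallElt 𝓥 b [] w) = hallElt 𝓥 b [k] w := by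
    intro w k hw hk
    rw [hB, hprw, lie_self, hDself, hΦ w hw, map_zero, zero_add, hk, Int.toNat_natCast]
  refine ⟨B, ⟨fun J₁ J₂ w₁ w₂ _ _ h => hvan' J₁ J₂ w₁ w₂ h, ?_, hsq, fun _ _ _ _ _ => hsymm _ _,
    ?_⟩, ⟨?_, ?_, hsymm, hjac⟩, hvan, ?_⟩
  · intro w₁ w₂ _ _ h
    rw [hB, hprw, hprw, hDbasic w₁ w₂ h, map_zero, add_zero, hallElt, QbarSeq_nil, one_smul,
      evalWord_mul]
  · intro w₁ w₃ w₄ _ h34 _ _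
    have h1 : hallElt 𝓥 b [] (w₃ * w₄) = ι ⁅evalWord b w₃, evalWord b w₄⁆ := by
      rw [hallElt, QbarSeq_nil, one_smul, evalWord_mul]
    have h2 : B (hallElt 𝓥 b [] w₁) (hallElt 𝓥 b [] (w₃ * w₄)) =
        B (hallElt 𝓥 b [] w₁) (B (hallElt 𝓥 b [] w₃) (hallElt 𝓥 b [] w₄)) := by
      rw [hB, hB, hprB, h1, hprι, hprw, hprw, hprw]
    have := hjac (hallElt 𝓥 b [] w₁) (hallElt 𝓥 b [] w₃) (hallElt 𝓥 b [] w₄)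
    rw [add_assoc] at this
    rw [h2, eq_neg_of_add_eq_zero_left this, ZModModule.neg_eq_self]
  · exact isInternal_of_basis (algBasis hord hint hb hd) _ (algGrading_eq_span hord hint hb hd)
  · intro i j x hx y hy
    rw [algGrading_eq_span hord hint hb hd] at hx hy
    refine Submodule.span_induction₂ (p := fun x y _ _ => B x y ∈ algGrading 𝓥 (i + j - 1))
      ?_ ?_ ?_ ?_ ?_ ?_ ?_ hx hy
    · rintro _ _ ⟨⟨⟨J₁, w₁⟩, h₁⟩, rfl, rfl⟩ ⟨⟨⟨J₂, w₂⟩, h₂⟩, rfl, rfl⟩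
      rw [algBasis_apply, algBasis_apply]
      by_cases hJ : J₁ ≠ [] ∨ J₂ ≠ []
      · rw [hvan' _ _ _ _ hJ]; exact zero_mem _
      push Not at hJ
      obtain ⟨rfl, rfl⟩ := hJ
      have h0 : seqDeg [] = 0 := by simp [seqDeg]
      simp only [h0, add_zero]
      rw [hB, hprw, hprw]
      refine add_mem ?_ ?_
      · refine Submodule.subset_span ⟨[], _, _, Submodule.subset_span (IsLieMonomial.bracket _ _ _ _
          (isLieMonomial_evalWord hb w₁) (isLieMonomial_evalWord hb w₂)), ?_, ?_⟩
        · simp [seqDeg]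
        · rw [QbarSeq_nil, one_smul]
      · have : Submodule.span (ZMod 2) (evalWord b ''
            {w | IsBasic w ∧ wordDeg d w + wordDeg d w = wordDeg d w₁ + wordDeg d w₂}) ≤
            (algGrading 𝓥 (wordDeg d w₁ + wordDeg d w₂ - 1)).comap Φ := by
          refine Submodule.span_le.2 ?_
          rintro _ ⟨w, ⟨hw, hdeg⟩, rfl⟩
          rw [SetLike.mem_coe, Submodule.mem_comap, hΦ w hw]
          have h1 := hallElt_mem hb [(wordDeg d w).toNat] w
          have h2 := one_le_wordDeg hd w
          have h3 : wordDeg d w + seqDeg [(wordDeg d w).toNat] =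
              wordDeg d w₁ + wordDeg d w₂ - 1 := by
            rw [seqDeg_cons, Int.toNat_of_nonneg (by omega)]
            have h0 : seqDeg [] = 0 := by simp [seqDeg]
            omega
          rwa [h3] at h1
        exact this (hDdeg d w₁ w₂ h₁.2.1 h₂.2.1)
    · intro y _; rw [map_zero]; exact zero_mem _
    · intro y _; rw [map_zero]; exact zero_mem _
    · intro x y z _ _ _ h1 h2; rw [map_add]; exact add_mem h1 h2
    · intro x y z _ _ _ h1 h2; rw [map_add]; exact add_mem h1 h2
    · intro c x y _ _ h; rw [map_smul]; exact Submodule.smul_mem _ _ h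
    · intro c x y _ _ h; rw [map_smul]; exact Submodule.smul_mem _ _ h
  · intro k x hx
    rw [algGrading_eq_span hord hint hb hd] at hx
    induction hx using Submodule.span_induction with
    | mem x hx =>
      obtain ⟨⟨⟨J, w⟩, h⟩, hdeg, rfl⟩ := hx
      have hdeg : wordDeg d w + seqDeg J = k := hdeg
      rw [algBasis_apply]
      by_cases hJ : J = []
      · subst hJ
        rw [hsq w k h.2.1 (by simpa [seqDeg] using hdeg), hallElt, hallElt, QbarSeq_nil, one_smul,
          QbarSeq_singleton]
      · rw [hvan' _ _ _ _ (Or.inl hJ), hallElt, smul_smul, ← QbarSeq_cons]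
        refine QbarSeq_smul_allowIncl_eq_zero
          (Submodule.subset_span (isLieMonomial_evalWord hb w)) _ _ ?_
        have := List.length_pos_iff.2 hJ
        rw [seqDeg_eq] at hdeg
        show (k : ℤ) < (J.sum : ℤ) + wordDeg d w
        omega
    | zero => rw [smul_zero, map_zero]
    | add x y _ _ hx hy =>
      rw [smul_add, hx, hy, map_add, map_add, LinearMap.add_apply, LinearMap.add_apply, hsymm y x,
        add_assoc, ← add_assoc (B x y), ZModModule.add_self, zero_add]
    | smul c x _ hx =>
      have hc : c = 0 ∨ c = 1 := by revert c; decide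
      rcases hc with rfl | rfl
      · rw [zero_smul, smul_zero, map_zero]
      · rw [one_smul, hx]

end FreeAlg

/-! ### Uniqueness of the bracket and freeness -/

section FreeAlg

variable {V : Type*} [AddCommGroup V] [Module (ZMod 2) V] {𝓥 : ℤ → Submodule (ZMod 2) V}
  {β : Type*} [LinearOrder (FreeMagma β)] {b : Module.Basis β (ZMod 2) V} {d : β → ℤ}

theorem IsHallBracket.isHallRecursion {B : FreeAlg 𝓥 →ₗ[ZMod 2] FreeAlg 𝓥 →ₗ[ZMod 2] FreeAlg 𝓥}
    (hord : ∀ w₁ w₂ : FreeMagma β, w₁.length < w₂.length → w₁ < w₂)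
    (hd : ∀ x, 1 ≤ d x) (hB : IsHallBracket 𝓥 b d B) :
    IsHallRecursion B (hallElt 𝓥 b []) fun w => hallElt 𝓥 b [(wordDeg d w).toNat] w where
  basic u v h := hB.basic u v h.of_mul.1 h.of_mul.2.1 h
  square w hw := hB.square w _ hw (by have := one_le_wordDeg hd w; omega)
  swap := hB.swap
  jacobi a u v ha huv h := hB.jacobi a u v ha huv (h.trans (lt_mul_left hord u v)) h
  vanish u v hu hv := by
    refine hB.vanish [] [(wordDeg d v).toNat] u v ⟨by simp [IsCU], hu, by simp⟩
      ⟨by simp [IsCU], hv, ?_⟩ (Or.inr (by simp))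
    have := one_le_wordDeg hd v
    simp only [List.getLast?_singleton, Option.mem_def, Option.some.injEq, forall_eq']
    omega

variable (hord : ∀ w₁ w₂ : FreeMagma β, w₁.length < w₂.length → w₁ < w₂)
  (hint : DirectSum.IsInternal 𝓥) (hb : ∀ x : β, b x ∈ 𝓥 (d x)) (hd : ∀ x, 1 ≤ d x)

include hord hint hb hd

theorem IsHallBracket.unique {B B' : FreeAlg 𝓥 →ₗ[ZMod 2] FreeAlg 𝓥 →ₗ[ZMod 2] FreeAlg 𝓥}
    (hB : IsHallBracket 𝓥 b d B) (hB' : IsHallBracket 𝓥 b d B') : B' = B := by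
  refine (algBasis hord hint hb hd).ext fun p => (algBasis hord hint hb hd).ext fun p' => ?_
  obtain ⟨⟨J, w⟩, h⟩ := p
  obtain ⟨⟨J', w'⟩, h'⟩ := p'
  rw [algBasis_apply, algBasis_apply]
  by_cases hJ : J ≠ [] ∨ J' ≠ []
  · rw [hB.vanish _ _ _ _ h h' hJ, hB'.vanish _ _ _ _ h h' hJ]
  push Not at hJ
  obtain ⟨rfl, rfl⟩ := hJ
  exact (hB'.isHallRecursion hord hd).map_bracket hord (hB.isHallRecursion hord hd)
    (F := LinearMap.id) (fun _ _ => rfl) (fun _ _ => rfl) h.2.1 h'.2.1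

/-- As `V` is concentrated in positive degrees, so is `FreeAlg 𝓥`, and the operations are defined
on all of it. -/
theorem exists_allowableSLie {B : FreeAlg 𝓥 →ₗ[ZMod 2] FreeAlg 𝓥 →ₗ[ZMod 2] FreeAlg 𝓥}
    (hB : IsSLie (algGrading 𝓥) B) (hvan : ∀ k x y, B x (Qbar k • y) = 0)
    (hsq : ∀ (k : ℕ), ∀ x ∈ algGrading 𝓥 k, Qbar k • x = B x x) :
    ∃ S : AllowableSLie (algGrading 𝓥), S.bracket = B ∧
      ∀ (r : RBar) (x : nonneg (algGrading 𝓥)),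
        (S.act r x : FreeAlg 𝓥) = r • (x : FreeAlg 𝓥) := by
  have htop := nonneg_algGrading hord hint hb hd
  let _ : SMul RBar (nonneg (algGrading 𝓥)) := ⟨fun r x => ⟨r • (x : FreeAlg 𝓥), htop.ge trivial⟩⟩
  let _ : Module RBar (nonneg (algGrading 𝓥)) :=
    Function.Injective.module RBar (nonneg (algGrading 𝓥)).subtype.toAddMonoidHom
      Subtype.val_injective fun _ _ => rfl
  have hA := isAllowable_freeAllowable (lieGrading_eq_span hord b d hint hb)
    (fun w => one_le_wordDeg hd w.1)
  refine ⟨⟨B, hB, ⟨?_, ?_, ?_, ?_⟩, fun k x hx => hsq k x hx, fun _ _ x y k _ _ => hvan k x y⟩, rfl,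
    fun _ _ => rfl⟩
  · exact nonnegGrading_isInternal (algBasis hord hint hb hd) _
      (algGrading_eq_span hord hint hb hd) htop
  · intro n hn
    have h : algGrading 𝓥 n = ⊥ := hA.nonneg n hn
    rw [nonnegGrading, h]
    exact (nonneg (algGrading 𝓥)).ker_subtype
  · exact fun j n x hx => hA.degree j n x hx
  · exact fun j J n x hx h => Subtype.ext (hA.vanish j J n x hx h)

/-- The extension of `f` sends a basic product to its value in `E`, and is then the map of
`R̄`-modules given by freeness; `IsHallRecursion.map_bracket` shows that it preserves brackets.
The values lie in non-negative degrees, where the operations of `E` are defined. -/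
theorem isFreeAllowableSLie_freeAlg.{t} {S : AllowableSLie (algGrading 𝓥)}
    (hS : IsHallBracket 𝓥 b d S.bracket)
    (hact : ∀ (r : RBar) (x : nonneg (algGrading 𝓥)),
      (S.act r x : FreeAlg 𝓥) = r • (x : FreeAlg 𝓥)) :
    IsFreeAllowableSLie.{t} 𝓥 S (algIncl 𝓥) where
  graded n v hv := Submodule.subset_span ⟨[], n, lieIncl V v,
    Submodule.subset_span (IsLieMonomial.incl n v hv), by simp [seqDeg], by
      rw [QbarSeq_nil, one_smul]; rfl⟩
  universal E _ _ 𝓔 T f hf := by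
    have htop := nonneg_algGrading hord hint hb hd
    let _ := T.module
    let g := bracketWord T.bracket fun x => f (b x)
    have hg : ∀ w, g w ∈ 𝓔 (wordDeg d w) := by
      intro w
      induction w with
      | ih1 x => exact hf _ _ (hb x)
      | ih2 u v hu hv => exact T.isSLie.degree _ _ _ hu _ hv
    have hg' : ∀ w, g w ∈ nonneg 𝓔 := fun w =>
      Submodule.mem_iSup_of_mem (p := fun n : {n : ℤ // 0 ≤ n} => 𝓔 n)
        ⟨wordDeg d w, by have := one_le_wordDeg hd w; omega⟩ (hg w)
    let G : FreeSLieTi V →ₗ[ZMod 2] nonneg 𝓔 :=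
      (hallBasis hord b).constr (ZMod 2) fun w => ⟨g w.1, hg' w.1⟩
    have hG : ∀ w, IsBasic w → G (evalWord b w) = ⟨g w, hg' w⟩ := by
      intro w hw
      have := (hallBasis hord b).constr_basis (ZMod 2)
        (fun w => (⟨g w.1, hg' w.1⟩ : nonneg 𝓔)) ⟨w, hw⟩
      rwa [hallBasis_apply] at this
    have hGgr : IsGradedMap (lieGrading 𝓥) (nonnegGrading 𝓔) G :=
      isGradedMap_of_basis (lieGrading_eq_span hord b d hint hb) fun w => by
        rw [hallBasis_apply, hG _ w.2]
        exact hg w.1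
    obtain ⟨F₀, ⟨hF₀gr, hF₀act, hF₀ι⟩, -⟩ := (isFreeAllowable_freeAllowable
      (lieGrading_eq_span hord b d hint hb) (fun w => one_le_wordDeg hd w.1)).universal
        (nonneg 𝓔) (nonnegGrading 𝓔) T.allowable G hGgr
    let F : FreeAlg 𝓥 →ₗ[ZMod 2] E := (nonneg 𝓔).subtype ∘ₗ F₀
    have hFgr : IsGradedMap (algGrading 𝓥) 𝓔 F := fun n x hx => hF₀gr n x hx
    have hFw : ∀ w, IsBasic w → F (hallElt 𝓥 b [] w) = g w := by
      intro w hw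
      show ((F₀ _ : nonneg 𝓔) : E) = _
      rw [hallElt, QbarSeq_nil, one_smul, hF₀ι, hG w hw]
    have hFQ : ∀ j J w x, T.bracket x (F (hallElt 𝓥 b (j :: J) w)) = 0 := by
      intro j J w x
      have h1 : F (hallElt 𝓥 b (j :: J) w) = (Qbar j • F₀ (hallElt 𝓥 b J w) : nonneg 𝓔) := by
        rw [← hF₀act, hallElt, hallElt, smul_smul, ← QbarSeq_cons]
        rfl
      have hx : x ∈ ⨆ n, 𝓔 n := by rw [T.isSLie.internal.submodule_iSup_eq_top]; trivial
      rw [h1]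
      refine Submodule.iSup_induction 𝓔 (motive := fun x => T.bracket x _ = 0) hx ?_ (by simp) ?_
      · intro i x hx
        exact T.vanishing i _ x _ j hx (hF₀gr _ _ (hallElt_mem hb J w))
      · intro x y hx hy
        rw [map_add, LinearMap.add_apply, hx, hy, add_zero]
    have hFB : ∀ x y, F (S.bracket x y) = T.bracket (F x) (F y) := by
      have : S.bracket.compr₂ F = T.bracket.compl₁₂ F F := by
        refine (algBasis hord hint hb hd).ext fun p => (algBasis hord hint hb hd).ext fun p' => ?_
        obtain ⟨⟨J, w⟩, h⟩ := p
        obtain ⟨⟨J', w'⟩, h'⟩ := p'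
        rw [algBasis_apply, algBasis_apply, LinearMap.compr₂_apply, LinearMap.compl₁₂_apply]
        by_cases hJ : J ≠ [] ∨ J' ≠ []
        · rw [hS.vanish _ _ _ _ h h' hJ, map_zero]
          rcases hJ with hJ | hJ
          · obtain ⟨j, J, rfl⟩ := List.exists_cons_of_ne_nil hJ
            rw [T.isSLie.symm, hFQ]
          · obtain ⟨j, J, rfl⟩ := List.exists_cons_of_ne_nil hJ
            rw [hFQ]
        push Not at hJ
        obtain ⟨rfl, rfl⟩ := hJ
        refine (hS.isHallRecursion hord hd).map_bracket hord
          (isHallRecursion_bracketWord T.isSLie.symm T.isSLie.jacobi fun x => f (b x)) hFw ?_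
          h.2.1 h'.2.1
        intro u hu
        have hdu : ((wordDeg d u).toNat : ℤ) = wordDeg d u := by
          have := one_le_wordDeg hd u
          omega
        have h1 := T.square (wordDeg d u).toNat ⟨g u, hg' u⟩ (by rw [hdu]; exact hg u)
        refine Eq.trans ?_ h1
        show ((F₀ _ : nonneg 𝓔) : E) = _
        rw [hallElt, QbarSeq_singleton, hF₀act, hF₀ι, hG u hu]
      exact fun x y => LinearMap.congr_fun₂ this x y
    refine ⟨F, ⟨⟨hFgr, hFB, fun r x => ?_⟩, fun v => ?_⟩, ?_⟩
    · rw [hact]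
      exact congrArg Subtype.val (hF₀act r x)
    · have : F ∘ₗ algIncl 𝓥 = f := b.ext fun x => by
        have h1 := hFw (.of x) trivial
        rw [hallElt, QbarSeq_nil, one_smul] at h1
        exact h1
      exact LinearMap.congr_fun this v
    · rintro H ⟨hH, hHf⟩
      have hHw : ∀ w, IsBasic w → H (hallElt 𝓥 b [] w) = g w := by
        intro w hw
        induction w with
        | ih1 x =>
          rw [hallElt, QbarSeq_nil, one_smul]
          exact hHf (b x)
        | ih2 u v hu hv =>
          obtain ⟨bu, bv, -⟩ := hw.of_mul
          rw [← hS.basic u v bu bv hw, hH.map_bracket, hu bu, hv bv]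
          rfl
      refine (algBasis hord hint hb hd).ext fun p => ?_
      obtain ⟨⟨J, w⟩, h⟩ := p
      rw [algBasis_apply]
      have h1 : ∀ x : FreeAlg 𝓥, x ∈ nonneg (algGrading 𝓥) := fun x => by rw [htop]; trivial
      have h2 := hH.map_act (QbarSeq J) ⟨hallElt 𝓥 b [] w, h1 _⟩
      have h3 : QbarSeq J • hallElt 𝓥 b [] w = hallElt 𝓥 b J w := by
        rw [hallElt, hallElt, QbarSeq_nil, one_smul]
      rw [hact, h3] at h2
      have h4 : F₀ (hallElt 𝓥 b J w) = QbarSeq J • F₀ (hallElt 𝓥 b [] w) := by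
        rw [← hF₀act, h3]
      show H (hallElt 𝓥 b J w) = ((F₀ (hallElt 𝓥 b J w) : nonneg 𝓔) : E)
      rw [h2, h4]
      show ((QbarSeq J • (⟨H (hallElt 𝓥 b [] w), _⟩ : nonneg 𝓔) : nonneg 𝓔) : E) = _
      congr 2
      exact Subtype.ext ((hHw w h.2.1).trans (hFw w h.2.1).symm)

end FreeAlg

end SpectralLie

end

open SpectralLie in
theorem mainTheorem3 {V : Type u} [AddCommGroup V] [Module (ZMod 2) V]
    (𝓥 : ℤ → Submodule (ZMod 2) V) (hint : DirectSum.IsInternal 𝓥)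
    (hpos : ∀ n : ℤ, n ≤ 0 → 𝓥 n = ⊥)
    {β : Type v} (b : Module.Basis β (ZMod 2) V) (d : β → ℤ) (hb : ∀ x : β, b x ∈ 𝓥 (d x))
    [LinearOrder (FreeMagma β)]
    (hord : ∀ w₁ w₂ : FreeMagma β, w₁.length < w₂.length → w₁ < w₂) :
    IsFreeSLieTi.{w} 𝓥 (lieGrading 𝓥) (lieBracket V) (lieIncl V) ∧
    IsFreeAllowable.{w} (lieGrading 𝓥) (algGrading 𝓥) (allowIncl (lieGrading 𝓥)) ∧
    (∃ e : Module.Basis {p : List ℕ × FreeMagma β // IsHallPair d p.1 p.2} (ZMod 2) (FreeAlg 𝓥),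
      ∀ p, e p = hallElt 𝓥 b p.1.1 p.1.2) ∧
    ∃ B : FreeAlg 𝓥 →ₗ[ZMod 2] FreeAlg 𝓥 →ₗ[ZMod 2] FreeAlg 𝓥,
      IsHallBracket 𝓥 b d B ∧
      (∀ B' : FreeAlg 𝓥 →ₗ[ZMod 2] FreeAlg 𝓥 →ₗ[ZMod 2] FreeAlg 𝓥,
        IsHallBracket 𝓥 b d B' → B' = B) ∧
      ∃ S : AllowableSLie (algGrading 𝓥),
        S.bracket = B ∧
        (∀ (r : RBar) (x : nonneg (algGrading 𝓥)),
          (S.act r x : FreeAlg 𝓥) = r • (x : FreeAlg 𝓥)) ∧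
        IsFreeAllowableSLie.{w} 𝓥 S (algIncl 𝓥) := by
  have hd := one_le_deg hpos hb
  obtain ⟨B, hB, hSLie, hvan, hsq⟩ := exists_isHallBracket hord hint hb hd
  obtain ⟨S, rfl, hact⟩ := exists_allowableSLie hord hint hb hd hSLie hvan hsq
  exact ⟨isFreeSLieTi_freeSLieTi hord b d hint hb,
    isFreeAllowable_freeAllowable (lieGrading_eq_span hord b d hint hb)
      (fun w => one_le_wordDeg hd w.1),
    ⟨algBasis hord hint hb hd, algBasis_apply hord hint hb hd⟩,
    S.bracket, hB, fun _ h => hB.unique hord hint hb hd h, S, rfl, hact,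
    isFreeAllowableSLie_freeAlg hord hint hb hd hB hact⟩
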